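/- **Notation.** Let $n\ge 1$ and $s>0$. Put $R_0=0$, $R_j=2^{j-1}$ and $X_j=\{x\in\mathbb{R}^n: R_{j-1}<|x|<R_j\}$ for $j>0$, and let $B(1)$ be the open unit ball of $\mathbb{R}^n$ with center $0$. Functions are complex-valued unless stated otherwise. Let $$B=\Big\{u\in L^2(\mathbb{R}^n):\ \|u\|_B=\sum_{j>0}R_j^{1/2}\|u\|_{L^2(X_j)}<\infty\Big\},\qquad B^*=\Big\{v\in L^2_{\mathrm{loc}}(\mathbb{R}^n):\ \|v\|_{B^*}=\sup_{j>0}R_j^{-1/2}\|v\|_{L^2(X_j)}<\infty\Big\},$$ and let $B_s^*$ be the space of tempered distributions $f$ on $\mathbb{R}^n$ such that $(I-\Delta)^{s/2}f$ is a function in $B^*$, with norm $\|f\|_{B_s^*}=\|(I-\Delta)^{s/2}f\|_{B^*}$. A real-valued $V\in L^2_{\mathrm{loc}}(\mathbb{R}^n)$ is called *short range* if the map $f\mapsto Vf$ is compact from $B_s^*$ to $B$ (in particular, every $f\in B_s^*$ is an $L^2_{\mathrm{loc}}$ function and $Vf\in B$). **Proposition 2.5.** Let $n\ge1$ and $s>0$,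 and let $p$ satisfy $$p=\frac ns\ \text{ if } 0<s<\frac n2,\qquad 2<p\le\infty\ \text{ if } s=\frac n2,\qquad p=2\ \text{ if } s>\frac n2.$$ Let $V\in L^p_{\mathrm{loc}}(\mathbb{R}^n)$ be real-valued with $$\sum_{j>0}R_j\sup_{y\in X_j}\|V(\cdot+y)\|_{L^p(B(1))}<\infty .$$ Then multiplication by $V$ defines a compact operator from $B_s^*$ to $B$. In particular, $V$ is short range. -/

import Mathlib

open MeasureTheory Set Filter Topology
open scoped ENNReal NNReal SchwartzMap FourierTransform

noncomputable section

namespace ShortRange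

/-- `ℝⁿ` with its Euclidean norm. -/
abbrev Rn (n : ℕ) : Type := EuclideanSpace ℝ (Fin n)

/-! ### Dyadic shells -/

/-- The radii `R₀ = 0` and `R_j = 2^(j-1)` for `j > 0`. -/
def radius : ℕ → ℝ≥0
  | 0 => 0
  | j + 1 => 2 ^ j

/-- The open dyadic shell `{x : R_{j-1} < |x| < R_j}`, for `j > 0`.
(It is only used for `j > 0`.) -/
def shell (n j : ℕ) : Set (Rn n) :=
  {x | (radius (j - 1) : ℝ) < ‖x‖ ∧ ‖x‖ < (radius j : ℝ)}

lemma measurableSet_shell (n j : ℕ) : MeasurableSet (shell n j) :=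
  ((isOpen_lt continuous_const continuous_norm).inter
    (isOpen_lt continuous_norm continuous_const)).measurableSet

/-- Almost every point lies in one of the shells of index `j + 1`, `j ∈ ℕ`. -/
lemma ae_mem_shell (n : ℕ) [NeZero n] :
    ∀ᵐ x : Rn n, ∃ j : ℕ, x ∈ shell n (j + 1) := by
  have h : ∀ j : ℕ, ∀ᵐ x : Rn n, ‖x‖ ≠ (radius j : ℝ) := by
    intro j
    have h0 := Measure.addHaar_sphere (volume : Measure (Rn n)) 0 (radius j : ℝ)
    rw [ae_iff]
    convert h0 using 2
    ext x
    simp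
  filter_upwards [ae_all_iff.2 h] with x hx
  have hex : ∃ j : ℕ, ‖x‖ < (radius j : ℝ) := by
    obtain ⟨j, hj⟩ := pow_unbounded_of_one_lt ‖x‖ (one_lt_two (α := ℝ))
    exact ⟨j + 1, by simpa [radius] using hj⟩
  classical
  obtain ⟨m, hm, hmin⟩ : ∃ m : ℕ, ‖x‖ < (radius m : ℝ) ∧ ∀ k < m, ¬ ‖x‖ < (radius k : ℝ) :=
    ⟨Nat.find hex, Nat.find_spec hex, fun k hk => Nat.find_min hex hk⟩
  cases m with
  | zero =>
    simp only [radius, NNReal.coe_zero] at hm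
    exact absurd hm (not_lt.2 (norm_nonneg x))
  | succ j =>
    refine ⟨j, ?_, hm⟩
    rw [Nat.add_sub_cancel]
    exact lt_of_le_of_ne (not_lt.1 (hmin j (Nat.lt_succ_self j))) (hx j).symm

lemma ae_eq_zero_of_shells {n : ℕ} [NeZero n] {v : Rn n → ℂ}
    (hv : ∀ j : ℕ, v =ᵐ[volume.restrict (shell n (j + 1))] 0) : v =ᵐ[volume] 0 := by
  have h : ∀ j : ℕ, ∀ᵐ x : Rn n, x ∈ shell n (j + 1) → v x = 0 := fun j =>
    (ae_restrict_iff' (measurableSet_shell n (j + 1))).1 (hv j)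
  filter_upwards [ae_all_iff.2 h, ae_mem_shell n] with x hx ⟨j, hj⟩
  exact hx j hj

/-! ### Local Lebesgue spaces -/

/-- `f ∈ L^p_loc(ℝⁿ)`: `f` is in `L^p` on every compact set. -/
def MemLpLoc {n : ℕ} {F : Type*} [NormedAddCommGroup F] (f : Rn n → F) (p : ℝ≥0∞) : Prop :=
  ∀ K : Set (Rn n), IsCompact K → MemLp f p (volume.restrict K)

lemma MemLpLoc.locallyIntegrable {n : ℕ} {v : Rn n → ℂ} (hv : MemLpLoc v 2) :
    LocallyIntegrable v volume := by
  rw [locallyIntegrable_iff]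
  intro K hK
  have : IsFiniteMeasure (volume.restrict K) :=
    ⟨by simpa using hK.measure_lt_top⟩
  exact (hv K hK).integrable (by norm_num)

lemma MemLpLoc.aestronglyMeasurable {n : ℕ} {v : Rn n → ℂ} (hv : MemLpLoc v 2) :
    AEStronglyMeasurable v volume :=
  hv.locallyIntegrable.aestronglyMeasurable

/-! ### The space `B` -/

/-- `‖u‖_B = ∑_{j>0} R_j^{1/2} ‖u‖_{L²(X_j)}`, with values in `[0,∞]`. -/
def bENorm {n : ℕ} (u : Rn n → ℂ) : ℝ≥0∞ :=
  ∑' j : ℕ, (radius (j + 1) : ℝ≥0∞) ^ (1 / 2 : ℝ) *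
    eLpNorm u 2 (volume.restrict (shell n (j + 1)))

lemma bENorm_congr {n : ℕ} {u v : Rn n → ℂ} (h : u =ᵐ[volume] v) : bENorm u = bENorm v := by
  unfold bENorm
  congr 1
  ext j
  rw [eLpNorm_congr_ae (ae_restrict_of_ae h)]

lemma bENorm_add_le {n : ℕ} {u v : Rn n → ℂ} (hu : AEStronglyMeasurable u volume)
    (hv : AEStronglyMeasurable v volume) : bENorm (u + v) ≤ bENorm u + bENorm v := by
  unfold bENorm
  rw [← ENNReal.tsum_add]
  refine ENNReal.tsum_le_tsum fun j => ?_
  rw [← mul_add]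
  gcongr
  exact eLpNorm_add_le hu.restrict hv.restrict (by norm_num)

lemma bENorm_smul {n : ℕ} (c : ℂ) (u : Rn n → ℂ) : bENorm (c • u) = ‖c‖ₑ * bENorm u := by
  unfold bENorm
  rw [← ENNReal.tsum_mul_left]
  congr 1
  ext j
  rw [eLpNorm_const_smul]
  ring

/-- The subspace `B` of `L²(ℝⁿ)`, as a space of almost-everywhere classes of functions. -/
def bSubmodule (n : ℕ) : Submodule ℂ (Rn n →ₘ[volume] ℂ) where
  carrier := {u | MemLp u 2 volume ∧ bENorm u < ∞}
  zero_mem' := by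
    have h : ((0 : Rn n →ₘ[volume] ℂ) : Rn n → ℂ) =ᵐ[volume] 0 := AEEqFun.coeFn_zero
    refine ⟨(memLp_congr_ae h).2 MemLp.zero, ?_⟩
    rw [bENorm_congr h]
    simp [bENorm]
  add_mem' := by
    rintro u v ⟨hu, hu'⟩ ⟨hv, hv'⟩
    refine ⟨(memLp_congr_ae (AEEqFun.coeFn_add u v)).2 (hu.add hv), ?_⟩
    rw [bENorm_congr (AEEqFun.coeFn_add u v)]
    exact (bENorm_add_le u.aestronglyMeasurable v.aestronglyMeasurable).trans_lt
      (ENNReal.add_lt_top.2 ⟨hu', hv'⟩)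
  smul_mem' := by
    rintro c u ⟨hu, hu'⟩
    refine ⟨(memLp_congr_ae (AEEqFun.coeFn_smul c u)).2 (hu.const_smul c), ?_⟩
    rw [bENorm_congr (AEEqFun.coeFn_smul c u), bENorm_smul]
    exact ENNReal.mul_lt_top enorm_lt_top hu'

/-- The space `B`, which carries the norm `‖·‖_B`. -/
def BSpace (n : ℕ) : Type := ↥(bSubmodule n)

instance (n : ℕ) : AddCommGroup (BSpace n) := inferInstanceAs (AddCommGroup ↥(bSubmodule n))
instance (n : ℕ) : Module ℂ (BSpace n) := inferInstanceAs (Module ℂ ↥(bSubmodule n))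

/-- A function representing an element of `B`. -/
def BSpace.toFun {n : ℕ} (u : BSpace n) : Rn n → ℂ := ((u.1 : Rn n →ₘ[volume] ℂ) : Rn n → ℂ)

instance (n : ℕ) : Norm (BSpace n) := ⟨fun u => (bENorm u.toFun).toReal⟩

lemma BSpace.norm_def {n : ℕ} (u : BSpace n) : ‖u‖ = (bENorm u.toFun).toReal := rfl

lemma BSpace.core (n : ℕ) [NeZero n] : NormedSpace.Core ℂ (BSpace n) where
  norm_nonneg u := ENNReal.toReal_nonneg
  norm_smul c u := by
    have h : (c • u).toFun =ᵐ[volume] c • u.toFun := AEEqFun.coeFn_smul c u.1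
    rw [BSpace.norm_def, BSpace.norm_def, bENorm_congr h, bENorm_smul, ENNReal.toReal_mul]
    simp
  norm_triangle u v := by
    have h : (u + v).toFun =ᵐ[volume] u.toFun + v.toFun := AEEqFun.coeFn_add u.1 v.1
    rw [BSpace.norm_def, BSpace.norm_def, BSpace.norm_def, bENorm_congr h]
    exact ENNReal.toReal_le_add
      (bENorm_add_le u.1.aestronglyMeasurable v.1.aestronglyMeasurable) u.2.2.ne v.2.2.ne
  norm_eq_zero_iff u := by
    constructor
    · intro h0
      rw [BSpace.norm_def, ENNReal.toReal_eq_zero_iff,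
        or_iff_left (show bENorm u.toFun ≠ ∞ from u.2.2.ne), bENorm,
        ENNReal.tsum_eq_zero] at h0
      refine Subtype.ext (AEEqFun.ext ?_)
      refine (ae_eq_zero_of_shells fun j => ?_).trans AEEqFun.coeFn_zero.symm
      have hj := (mul_eq_zero.1 (h0 j)).resolve_left (by simp [radius])
      exact (eLpNorm_eq_zero_iff u.1.aestronglyMeasurable.restrict (by norm_num)).1 hj
    · rintro rfl
      have h : (0 : BSpace n).toFun =ᵐ[volume] 0 := AEEqFun.coeFn_zero
      rw [BSpace.norm_def, bENorm_congr h]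
      simp [bENorm]

instance (n : ℕ) [NeZero n] : NormedAddCommGroup (BSpace n) :=
  NormedAddCommGroup.ofCore (BSpace.core n)

instance (n : ℕ) [NeZero n] : NormedSpace ℂ (BSpace n) := NormedSpace.ofCore (BSpace.core n)

/-! ### The space `B*` -/

/-- `‖v‖_{B*} = sup_{j>0} R_j^{-1/2} ‖v‖_{L²(X_j)}`, with values in `[0,∞]`. -/
def bDualENorm {n : ℕ} (v : Rn n → ℂ) : ℝ≥0∞ :=
  ⨆ j : ℕ, (radius (j + 1) : ℝ≥0∞) ^ (-(1 / 2) : ℝ) *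
    eLpNorm v 2 (volume.restrict (shell n (j + 1)))

/-- Membership in `B*`. -/
def MemBDual {n : ℕ} (v : Rn n → ℂ) : Prop := MemLpLoc v 2 ∧ bDualENorm v < ∞

lemma bDualENorm_congr {n : ℕ} {u v : Rn n → ℂ} (h : u =ᵐ[volume] v) :
    bDualENorm u = bDualENorm v := by
  unfold bDualENorm
  congr 1
  ext j
  rw [eLpNorm_congr_ae (ae_restrict_of_ae h)]

lemma bDualENorm_add_le {n : ℕ} {u v : Rn n → ℂ} (hu : AEStronglyMeasurable u volume)
    (hv : AEStronglyMeasurable v volume) :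
    bDualENorm (u + v) ≤ bDualENorm u + bDualENorm v := by
  refine iSup_le fun j => ?_
  refine (mul_le_mul_right (eLpNorm_add_le hu.restrict hv.restrict (by norm_num)) _).trans ?_
  rw [mul_add]
  exact add_le_add
    (le_iSup (fun j : ℕ => (radius (j + 1) : ℝ≥0∞) ^ (-(1 / 2) : ℝ) *
      eLpNorm u 2 (volume.restrict (shell n (j + 1)))) j)
    (le_iSup (fun j : ℕ => (radius (j + 1) : ℝ≥0∞) ^ (-(1 / 2) : ℝ) *
      eLpNorm v 2 (volume.restrict (shell n (j + 1)))) j)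

lemma bDualENorm_smul {n : ℕ} (c : ℂ) (u : Rn n → ℂ) :
    bDualENorm (c • u) = ‖c‖ₑ * bDualENorm u := by
  unfold bDualENorm
  rw [ENNReal.mul_iSup]
  congr 1
  ext j
  rw [eLpNorm_const_smul]
  ring

lemma bDualENorm_zero {n : ℕ} : bDualENorm (0 : Rn n → ℂ) = 0 := by
  simp [bDualENorm]

lemma ae_eq_zero_of_bDualENorm {n : ℕ} [NeZero n] {v : Rn n → ℂ}
    (hv : AEStronglyMeasurable v volume) (h0 : bDualENorm v = 0) : v =ᵐ[volume] 0 := by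
  refine ae_eq_zero_of_shells fun j => ?_
  rw [bDualENorm, ENNReal.iSup_eq_zero] at h0
  have hj := (mul_eq_zero.1 (h0 j)).resolve_left (by simp [radius])
  exact (eLpNorm_eq_zero_iff hv.restrict (by norm_num)).1 hj

lemma MemBDual.zero {n : ℕ} : MemBDual (0 : Rn n → ℂ) :=
  ⟨fun _ _ => MemLp.zero, by rw [bDualENorm_zero]; exact ENNReal.zero_lt_top⟩

lemma MemBDual.add {n : ℕ} {u v : Rn n → ℂ} (hu : MemBDual u) (hv : MemBDual v) :
    MemBDual (u + v) :=
  ⟨fun K hK => (hu.1 K hK).add (hv.1 K hK),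
    (bDualENorm_add_le hu.1.aestronglyMeasurable hv.1.aestronglyMeasurable).trans_lt
      (ENNReal.add_lt_top.2 ⟨hu.2, hv.2⟩)⟩

lemma MemBDual.const_smul {n : ℕ} {u : Rn n → ℂ} (c : ℂ) (hu : MemBDual u) :
    MemBDual (c • u) :=
  ⟨fun K hK => (hu.1 K hK).const_smul c, by
    rw [bDualENorm_smul]
    exact ENNReal.mul_lt_top enorm_lt_top hu.2⟩

/-! ### Tempered distributions given by functions -/

/-- The tempered distribution `f` is (given by) the function `v`: every product `φ v` with a
Schwartz function `φ` is integrable, and `f(φ) = ∫ φ v`. -/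
def Represents {n : ℕ} (f : 𝓢'(Rn n, ℂ)) (v : Rn n → ℂ) : Prop :=
  ∀ φ : 𝓢(Rn n, ℂ), Integrable (fun x => φ x * v x) ∧ f φ = ∫ x, φ x * v x

lemma Represents.zero {n : ℕ} : Represents (0 : 𝓢'(Rn n, ℂ)) (0 : Rn n → ℂ) := by
  intro φ
  refine ⟨by simp, ?_⟩
  simp only [Pi.zero_apply, mul_zero, integral_zero]
  rfl

lemma Represents.add {n : ℕ} {f g : 𝓢'(Rn n, ℂ)} {u v : Rn n → ℂ} (hf : Represents f u)
    (hg : Represents g v) : Represents (f + g) (u + v) := by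
  intro φ
  simp only [Pi.add_apply, mul_add]
  refine ⟨(hf φ).1.add (hg φ).1, ?_⟩
  rw [integral_add (hf φ).1 (hg φ).1, ← (hf φ).2, ← (hg φ).2]
  rfl

lemma Represents.const_smul {n : ℕ} {f : 𝓢'(Rn n, ℂ)} {u : Rn n → ℂ} (c : ℂ)
    (hf : Represents f u) : Represents (c • f) (c • u) := by
  intro φ
  have h : (fun x => φ x * (c • u) x) = fun x => c * (φ x * u x) := by
    ext x
    simp only [Pi.smul_apply, smul_eq_mul]
    ring
  rw [h]
  refine ⟨(hf φ).1.const_mul c, ?_⟩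
  rw [integral_const_mul, ← (hf φ).2]
  rfl

/-- The function representing a tempered distribution is unique almost everywhere. -/
lemma Represents.unique {n : ℕ} {f : 𝓢'(Rn n, ℂ)} {u v : Rn n → ℂ} (hu : Represents f u)
    (hv : Represents f v) (hu' : LocallyIntegrable u volume)
    (hv' : LocallyIntegrable v volume) : u =ᵐ[volume] v := by
  refine ae_eq_of_integral_contDiff_smul_eq hu' hv' fun g hg hgs => ?_
  have h1 : HasCompactSupport (fun x => (g x : ℂ)) := hgs.comp_left Complex.ofReal_zero
  have h2 : ContDiff ℝ (⊤ : ℕ∞) (fun x => (g x : ℂ)) := Complex.ofRealCLM.contDiff.comp hg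
  have h3 := (hu (h1.toSchwartzMap h2)).2.symm.trans (hv (h1.toSchwartzMap h2)).2
  simpa [Complex.real_smul] using h3

lemma Represents.eq_zero {n : ℕ} {f : 𝓢'(Rn n, ℂ)} {u : Rn n → ℂ} (hu : Represents f u)
    (h : u =ᵐ[volume] 0) : f = 0 := by
  ext φ
  rw [(hu φ).2]
  have h' : (fun x => φ x * u x) =ᵐ[volume] fun _ => 0 := by
    filter_upwards [h] with x hx
    simp [hx]
  rw [integral_congr_ae h', integral_zero]
  rfl

/-! ### The operators `J_s` and the spaces `B_s*` -/

/-- The symbol of `J_s = (I - Δ)^{s/2}`. In terms of the Fourier transform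
`∫ e^{-iξ·x} f(x) dx` it is `(1 + |ξ|²)^{s/2}`; Mathlib's Fourier transform is
`∫ e^{-2πiη·x} f(x) dx`, so that `ξ = 2πη`. -/
def besselSymbol (n : ℕ) (s : ℝ) (η : Rn n) : ℝ := (1 + ‖(2 * Real.pi) • η‖ ^ 2) ^ (s / 2)

/-- The operator `J_s = (I - Δ)^{s/2}` on tempered distributions. -/
def besselJ (n : ℕ) (s : ℝ) : 𝓢'(Rn n, ℂ) →L[ℂ] 𝓢'(Rn n, ℂ) :=
  TemperedDistribution.fourierMultiplierCLM ℂ (fun η : Rn n => (besselSymbol n s η : ℂ))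

lemma besselSymbol_hasTemperateGrowth (n : ℕ) (s : ℝ) :
    (fun η : Rn n => (besselSymbol n s η : ℂ)).HasTemperateGrowth := by
  have h1 : (fun η : Rn n => (2 * Real.pi) • η).HasTemperateGrowth :=
    ((2 * Real.pi) • ContinuousLinearMap.id ℝ (Rn n)).hasTemperateGrowth
  have h2 := (Function.hasTemperateGrowth_one_add_norm_sq_rpow (Rn n) (s / 2)).comp h1
  exact Function.HasTemperateGrowth.comp Function.Complex.hasTemperateGrowth_ofReal h2

lemma besselJ_neg_besselJ (n : ℕ) (s : ℝ) (f : 𝓢'(Rn n, ℂ)) :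
    besselJ n (-s) (besselJ n s f) = f := by
  unfold besselJ
  rw [TemperedDistribution.fourierMultiplierCLM_fourierMultiplierCLM_apply
    (besselSymbol_hasTemperateGrowth n s) (besselSymbol_hasTemperateGrowth n (-s))]
  have h : ((fun η : Rn n => (besselSymbol n s η : ℂ)) * fun η : Rn n =>
      (besselSymbol n (-s) η : ℂ)) = fun _ => (1 : ℂ) := by
    ext η
    simp only [Pi.mul_apply, besselSymbol]
    rw [← Complex.ofReal_mul, ← Real.rpow_add (by positivity)]
    simp [neg_div]
  rw [h]
  simp

/-- `B_s*`: the tempered distributions `f` for which `J_s f` is a function in `B*`. -/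
def bsDualSubmodule (n : ℕ) (s : ℝ) : Submodule ℂ 𝓢'(Rn n, ℂ) where
  carrier := {f | ∃ v : Rn n → ℂ, MemBDual v ∧ Represents (besselJ n s f) v}
  zero_mem' := ⟨0, MemBDual.zero, by rw [map_zero]; exact Represents.zero⟩
  add_mem' := by
    rintro f g ⟨u, hu, hu'⟩ ⟨v, hv, hv'⟩
    exact ⟨u + v, hu.add hv, by rw [map_add]; exact hu'.add hv'⟩
  smul_mem' := by
    rintro c f ⟨u, hu, hu'⟩
    exact ⟨c • u, hu.const_smul c, by rw [map_smul]; exact hu'.const_smul c⟩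

/-- The space `B_s*`, which carries the norm `‖f‖_{B_s*} = ‖J_s f‖_{B*}`. -/
def BsDual (n : ℕ) (s : ℝ) : Type := ↥(bsDualSubmodule n s)

instance (n : ℕ) (s : ℝ) : AddCommGroup (BsDual n s) :=
  inferInstanceAs (AddCommGroup ↥(bsDualSubmodule n s))
instance (n : ℕ) (s : ℝ) : Module ℂ (BsDual n s) :=
  inferInstanceAs (Module ℂ ↥(bsDualSubmodule n s))

/-- An element of `B_s*` as a tempered distribution. -/
def BsDual.toDistribution {n : ℕ} {s : ℝ} (f : BsDual n s) : 𝓢'(Rn n, ℂ) := f.1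

/-- The function `J_s f ∈ B*`, for `f ∈ B_s*`; it is unique up to null sets. -/
def BsDual.density {n : ℕ} {s : ℝ} (f : BsDual n s) : Rn n → ℂ := Classical.choose f.2

lemma BsDual.memBDual_density {n : ℕ} {s : ℝ} (f : BsDual n s) : MemBDual f.density :=
  (Classical.choose_spec f.2).1

lemma BsDual.represents_density {n : ℕ} {s : ℝ} (f : BsDual n s) :
    Represents (besselJ n s f.toDistribution) f.density :=
  (Classical.choose_spec f.2).2

instance (n : ℕ) (s : ℝ) : Norm (BsDual n s) := ⟨fun f => (bDualENorm f.density).toReal⟩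

lemma BsDual.norm_def {n : ℕ} {s : ℝ} (f : BsDual n s) :
    ‖f‖ = (bDualENorm f.density).toReal := rfl

/-- The norm of `B_s*` may be computed from any representative of `J_s f`. -/
lemma BsDual.norm_eq {n : ℕ} {s : ℝ} (f : BsDual n s) {v : Rn n → ℂ} (hv : MemBDual v)
    (h : Represents (besselJ n s f.toDistribution) v) : ‖f‖ = (bDualENorm v).toReal := by
  rw [BsDual.norm_def, bDualENorm_congr (f.represents_density.unique h
    f.memBDual_density.1.locallyIntegrable hv.1.locallyIntegrable)]

lemma BsDual.core (n : ℕ) [NeZero n] (s : ℝ) : NormedSpace.Core ℂ (BsDual n s) where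
  norm_nonneg f := ENNReal.toReal_nonneg
  norm_smul c f := by
    have h : Represents (besselJ n s (c • f).toDistribution) (c • f.density) := by
      change Represents (besselJ n s (c • f.toDistribution)) _
      rw [map_smul]
      exact f.represents_density.const_smul c
    rw [BsDual.norm_eq _ (f.memBDual_density.const_smul c) h, bDualENorm_smul,
      ENNReal.toReal_mul, BsDual.norm_def]
    simp
  norm_triangle f g := by
    have h : Represents (besselJ n s (f + g).toDistribution) (f.density + g.density) := by
      change Represents (besselJ n s (f.toDistribution + g.toDistribution)) _
      rw [map_add]
      exact f.represents_density.add g.represents_density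
    rw [BsDual.norm_eq _ (f.memBDual_density.add g.memBDual_density) h, BsDual.norm_def,
      BsDual.norm_def]
    exact ENNReal.toReal_le_add (bDualENorm_add_le f.memBDual_density.1.aestronglyMeasurable
      g.memBDual_density.1.aestronglyMeasurable) f.memBDual_density.2.ne g.memBDual_density.2.ne
  norm_eq_zero_iff f := by
    constructor
    · intro h0
      rw [BsDual.norm_def, ENNReal.toReal_eq_zero_iff, or_iff_left f.memBDual_density.2.ne] at h0
      have h1 : besselJ n s f.toDistribution = 0 := f.represents_density.eq_zero
        (ae_eq_zero_of_bDualENorm f.memBDual_density.1.aestronglyMeasurable h0)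
      have h2 := besselJ_neg_besselJ n s f.toDistribution
      rw [h1, map_zero] at h2
      exact Subtype.ext h2.symm
    · rintro rfl
      have h : Represents (besselJ n s (0 : BsDual n s).toDistribution) (0 : Rn n → ℂ) := by
        change Represents (besselJ n s (0 : 𝓢'(Rn n, ℂ))) _
        rw [map_zero]
        exact Represents.zero
      rw [BsDual.norm_eq _ MemBDual.zero h, bDualENorm_zero]
      simp

instance (n : ℕ) [NeZero n] (s : ℝ) : NormedAddCommGroup (BsDual n s) :=
  NormedAddCommGroup.ofCore (BsDual.core n s)

instance (n : ℕ) [NeZero n] (s : ℝ) : NormedSpace ℂ (BsDual n s) :=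
  NormedSpace.ofCore (BsDual.core n s)

/-! ### Short range potentials -/

/-- `V` defines a compact multiplication operator from `B_s*` to `B`: every `f ∈ B_s*` is a
locally square integrable function `u`, the product `V u` is in `B`, and the operator `f ↦ V u`
is compact from `B_s*` to `B`. -/
def IsCompactMultiplication {n : ℕ} [NeZero n] (s : ℝ) (V : Rn n → ℝ) : Prop :=
  ∃ T : BsDual n s →L[ℂ] BSpace n, IsCompactOperator T ∧
    ∀ f : BsDual n s, ∃ u : Rn n → ℂ, MemLpLoc u 2 ∧ Represents f.toDistribution u ∧
      (T f).toFun =ᵐ[volume] fun x => (V x : ℂ) * u x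

/-- `V` is a short range potential (of order `s`). -/
def IsShortRange {n : ℕ} [NeZero n] (s : ℝ) (V : Rn n → ℝ) : Prop :=
  MemLpLoc V 2 ∧ IsCompactMultiplication s V

/-- The condition on the exponent: `p = n/s` if `s < n/2`, `p > 2` if `s = n/2`, and `p = 2`
if `s > n/2`. -/
def AdmissibleExponent (n : ℕ) (s : ℝ) (p : ℝ≥0∞) : Prop :=
  (s < n / 2 → p = ENNReal.ofReal (n / s)) ∧ (s = n / 2 → 2 < p) ∧ (n / 2 < s → p = 2)

/-- The quantity `∑_{j>0} R_j sup_{y ∈ X_j} ‖V(· + y)‖_{L^p(B(1))}`, with values in `[0,∞]`. -/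
def decaySum {n : ℕ} (p : ℝ≥0∞) (V : Rn n → ℝ) : ℝ≥0∞ :=
  ∑' j : ℕ, (radius (j + 1) : ℝ≥0∞) * ⨆ y ∈ shell n (j + 1),
    eLpNorm (fun x => V (x + y)) p (volume.restrict (Metric.ball 0 1))

end ShortRange

end

noncomputable section

namespace ShortRange

/-! The inverse of `J_s` is convolution with the Bessel kernel G, the average of the heat kernels at
time t when t follows the Gamma law of shape s/2. G is nonnegative, has mass one, and away from the
origin is bounded by every sufficiently high negative power of |x|. Hence f in B_s* equals G * v
with v = J_s f in B* (`represents_kernelConv`), and the theorem concerns the map v ↦ V (G * v) from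
B* to B.

Boundedness. Take q with 1/p + 1/q = 1/2, so that H^s embeds in L^q. Around a point y, split v into
its part in B(y, 2), which is in L² and is handled by the Sobolev embedding, and the rest, which is
handled by the decay of G. This bounds the L^q norm of G * v on B(y, 1/2) by a rapidly decaying
weighted L² norm of v centred at y (`exists_eLpNorm_ball_sq_le`). Hölder's inequality on these balls
brings in the local L^p norms of V. Averaging over y and using that the mass of |v|² grows at most
like the radius, one finds that the L² norm of V (G * v) on a shell of outer radius R is at most a
constant times sup ‖V‖_{L^p(B(y, 1))} R^{1/2} ‖v‖_{B*} (`exists_eLpNorm_shell_le`). The norm of B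
contributes another R^{1/2}, and the sum over the shells is the series in the hypothesis
(`exists_bENorm_le`).

Compactness. The exponent p may be assumed finite, since on unit balls it can be lowered. The bound
above is then small for V - W with a suitable bounded W of compact support
(`exists_bounded_approx`). For such W, replace G by a continuous compactly supported g, close to it
in the second moment norm. On the support of W the functions g * v, with v in the unit ball of B*,
are equicontinuous, so freezing them at finitely many points changes W (g * v) little
(`exists_finite_rank_approx`). Thus the operator is a uniform limit, on the unit ball, of maps with
values in compact sets; as B is complete, it is compact. -/

/-! ### The Bessel kernel -/

/-- The heat kernel `(4πt)^{-n/2} e^{-|x|²/4t}`. -/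
def heatKernel (n : ℕ) (t : ℝ) (x : Rn n) : ℝ :=
  (4 * Real.pi * t) ^ (-(n / 2 : ℝ)) * Real.exp (-‖x‖ ^ 2 / (4 * t))

/-- The probability measure `t^{s/2-1} e^{-t} dt / Γ(s/2)` on `(0, ∞)`. -/
def subordinator (s : ℝ) : Measure ℝ := ProbabilityTheory.gammaMeasure (s / 2) 1

/-- The kernel of `(I - Δ)^{-s/2}`. -/
def besselKernel (n : ℕ) (s : ℝ) (x : Rn n) : ℝ≥0∞ :=
  ∫⁻ t, ENNReal.ofReal (heatKernel n t x) ∂(subordinator s)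

lemma isProbabilityMeasure_subordinator {s : ℝ} (hs : 0 < s) :
    IsProbabilityMeasure (subordinator s) :=
  ProbabilityTheory.isProbabilityMeasure_gammaMeasure (by positivity) one_pos

lemma lintegral_subordinator {s : ℝ} (f : ℝ → ℝ≥0∞) (hf : Measurable f) :
    ∫⁻ t, f t ∂(subordinator s) = ∫⁻ t in Ioi 0,
      ENNReal.ofReal (1 / Real.Gamma (s / 2) * t ^ (s / 2 - 1) * Real.exp (-t)) * f t := by
  unfold subordinator ProbabilityTheory.gammaMeasure
  have hm : Measurable (ProbabilityTheory.gammaPDF (s / 2) 1) :=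
    (ProbabilityTheory.measurable_gammaPDFReal _ _).ennreal_ofReal
  rw [lintegral_withDensity_eq_lintegral_mul _ hm hf,
    ← lintegral_add_compl _ (measurableSet_Ici (a := (0 : ℝ))), compl_Ici]
  have h1 : ∫⁻ t in Iio 0, (ProbabilityTheory.gammaPDF (s / 2) 1 * f) t = 0 := by
    rw [setLIntegral_congr_fun (g := fun _ => 0) measurableSet_Iio, lintegral_zero]
    intro t ht
    simp [ProbabilityTheory.gammaPDF_of_neg ht]
  rw [h1, add_zero, setLIntegral_congr Ioi_ae_eq_Ici.symm]
  refine setLIntegral_congr_fun measurableSet_Ioi fun t (ht : 0 < t) => ?_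
  simp [ProbabilityTheory.gammaPDF_of_nonneg ht.le]

lemma ae_subordinator_pos (s : ℝ) : ∀ᵐ t ∂(subordinator s), 0 < t := by
  rw [ae_iff, ← lintegral_indicator_one (by measurability),
    lintegral_subordinator _ (by measurability)]
  rw [setLIntegral_congr_fun (g := fun _ => 0) measurableSet_Ioi, lintegral_zero]
  intro t (ht : 0 < t)
  simp [ht]

/-- The integral is Γ(s/2 + r) / Γ(s/2); the hypothesis is the convergence condition at t = 0. -/
lemma lintegral_rpow_subordinator_lt_top {s r : ℝ} (h : 0 < s / 2 + r) :
    ∫⁻ t, ENNReal.ofReal (t ^ r) ∂(subordinator s) < ∞ := by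
  rw [lintegral_subordinator _ (by fun_prop)]
  have hi := (Real.GammaIntegral_convergent h).const_mul (1 / Real.Gamma (s / 2))
  refine lt_of_eq_of_lt (setLIntegral_congr_fun measurableSet_Ioi fun t (ht : 0 < t) => ?_)
    (hi.lintegral_lt_top)
  rw [← ENNReal.ofReal_mul' (by positivity), mul_assoc, mul_assoc,
    mul_comm (t ^ (s / 2 - 1)), mul_assoc, ← Real.rpow_add ht]
  ring_nf

/-- The Laplace transform of the Gamma law. At l = |ξ|² it writes (1 + |ξ|²)^{-s/2} as a mixture of
the Gaussians exp(-t|ξ|²), whose inverse transforms are heat kernels. -/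
lemma integral_exp_subordinator {s l : ℝ} (hs : 0 < s) (hl : 0 ≤ l) :
    ∫ t, Real.exp (-(l * t)) ∂(subordinator s) = (1 + l) ^ (-(s / 2)) := by
  have hG := Real.Gamma_pos_of_pos (half_pos hs)
  rw [integral_eq_lintegral_of_nonneg_ae (ae_of_all _ fun t => (Real.exp_pos _).le)
    (by fun_prop), lintegral_subordinator _ (by fun_prop)]
  have h := Real.integral_rpow_mul_exp_neg_mul_Ioi (half_pos hs) (by linarith : 0 < 1 + l)
  have h2 : ∫ t in Ioi (0 : ℝ), 1 / Real.Gamma (s / 2) * (t ^ (s / 2 - 1) *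
      Real.exp (-((1 + l) * t))) = (1 + l) ^ (-(s / 2)) := by
    rw [integral_const_mul, h, Real.rpow_neg (by linarith), one_div (1 + l),
      Real.inv_rpow (by linarith)]
    field_simp
  rw [← h2, integral_eq_lintegral_of_nonneg_ae]
  · congr 1
    refine setLIntegral_congr_fun measurableSet_Ioi fun t (ht : 0 < t) => ?_
    rw [← ENNReal.ofReal_mul' (by positivity), mul_assoc, mul_assoc, ← Real.exp_add]
    ring_nf
  · refine (ae_restrict_iff' measurableSet_Ioi).2 (ae_of_all _ fun t (ht : 0 < t) => ?_)
    simp only [Pi.zero_apply]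
    positivity
  · fun_prop

/-! ### Mass, decay and moments of the heat and Bessel kernels. -/

lemma heatKernel_nonneg {n : ℕ} {t : ℝ} (ht : 0 < t) (x : Rn n) : 0 ≤ heatKernel n t x := by
  unfold heatKernel
  positivity

lemma measurable_heatKernel (n : ℕ) : Measurable fun q : ℝ × Rn n => heatKernel n q.1 q.2 := by
  unfold heatKernel
  fun_prop

lemma integrable_heatKernel {n : ℕ} {t : ℝ} (ht : 0 < t) : Integrable (heatKernel n t) := by
  have h := GaussianFourier.integrable_cexp_neg_mul_sq_norm_add
    (V := Rn n) (b := ((1 / (4 * t) : ℝ) : ℂ)) (by simpa using ht) 0 0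
  refine Integrable.const_mul (f := fun x : Rn n => Real.exp (-‖x‖ ^ 2 / (4 * t))) ?_ _
  refine h.re.congr (ae_of_all _ fun x => ?_)
  have : (-(((1 / (4 * t) : ℝ) : ℂ)) * (‖x‖ : ℂ) ^ 2 + 0 * (inner ℝ (0 : Rn n) x : ℂ)) =
      ((-‖x‖ ^ 2 / (4 * t) : ℝ) : ℂ) := by
    push_cast
    ring
  change (Complex.exp _).re = _
  rw [this, ← Complex.ofReal_exp, Complex.ofReal_re]

lemma integral_heatKernel {n : ℕ} {t : ℝ} (ht : 0 < t) : ∫ x, heatKernel n t x = 1 := by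
  unfold heatKernel
  rw [integral_const_mul]
  have h := GaussianFourier.integral_rexp_neg_mul_sq_norm (V := Rn n)
    (b := 1 / (4 * t)) (by positivity)
  have h2 : (fun x : Rn n => Real.exp (-‖x‖ ^ 2 / (4 * t))) =
      fun x => Real.exp (-(1 / (4 * t)) * ‖x‖ ^ 2) := by
    ext x
    congr 1
    ring
  rw [h2, h, Real.rpow_neg (by positivity), finrank_euclideanSpace_fin,
    show Real.pi / (1 / (4 * t)) = 4 * Real.pi * t by field_simp]
  exact inv_mul_cancel₀ (by positivity)

lemma lintegral_heatKernel {n : ℕ} {t : ℝ} (ht : 0 < t) :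
    ∫⁻ x, ENNReal.ofReal (heatKernel n t x) = 1 := by
  rw [← ofReal_integral_eq_lintegral_ofReal (integrable_heatKernel ht)
    (ae_of_all _ (heatKernel_nonneg ht)), integral_heatKernel ht, ENNReal.ofReal_one]

lemma measurable_besselKernel {n : ℕ} {s : ℝ} (hs : 0 < s) : Measurable (besselKernel n s) := by
  have := isProbabilityMeasure_subordinator hs
  exact Measurable.lintegral_prod_left' (measurable_heatKernel n).ennreal_ofReal

lemma lintegral_besselKernel (n : ℕ) {s : ℝ} (hs : 0 < s) : ∫⁻ x, besselKernel n s x = 1 := by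
  have := isProbabilityMeasure_subordinator hs
  have hm : Measurable (Function.uncurry fun (x : Rn n) (t : ℝ) =>
      ENNReal.ofReal (heatKernel n t x)) :=
    (measurable_heatKernel n).ennreal_ofReal.comp measurable_swap
  unfold besselKernel
  rw [lintegral_lintegral_swap hm.aemeasurable]
  have : ∀ᵐ t ∂(subordinator s), ∫⁻ x, ENNReal.ofReal (heatKernel n t x) = 1 := by
    filter_upwards [ae_subordinator_pos s] with t ht using lintegral_heatKernel ht
  rw [lintegral_congr_ae this]
  simp

/-- From exp(-y) ≤ M! / y^M at y = |x|² / 4t. Decay in x is bought with a power of t, whose integral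
against the Gamma law is known. -/
lemma heatKernel_le {n : ℕ} (M : ℕ) {t : ℝ} (ht : 0 < t) {x : Rn n} (hx : x ≠ 0) :
    heatKernel n t x ≤ (4 * Real.pi) ^ (-(n / 2 : ℝ)) * M.factorial * 4 ^ M *
      t ^ (M - n / 2 : ℝ) * (‖x‖ ^ (2 * M))⁻¹ := by
  have hx' : 0 < ‖x‖ := norm_pos_iff.2 hx
  have h1 : Real.exp (-‖x‖ ^ 2 / (4 * t)) ≤ M.factorial * (4 * t) ^ M * (‖x‖ ^ (2 * M))⁻¹ := by
    have h := Real.pow_div_factorial_le_exp (‖x‖ ^ 2 / (4 * t)) (by positivity) M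
    rw [neg_div, Real.exp_neg]
    refine (inv_anti₀ (by positivity) h).trans (le_of_eq ?_)
    field_simp
    rw [← mul_pow, div_mul_cancel₀ _ (by positivity), ← pow_mul]
  unfold heatKernel
  refine (mul_le_mul_of_nonneg_left h1 (by positivity)).trans (le_of_eq ?_)
  rw [Real.mul_rpow (by positivity) ht.le, mul_pow, sub_eq_add_neg, Real.rpow_add ht,
    Real.rpow_natCast]
  ring

/-- The Bessel kernel decays faster than any power at infinity. -/
lemma exists_besselKernel_le (n : ℕ) {s : ℝ} (M : ℕ) (hM : 0 < s / 2 + (M - n / 2)) :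
    ∃ C : ℝ≥0, ∀ x : Rn n, x ≠ 0 →
      besselKernel n s x ≤ C * ENNReal.ofReal (‖x‖ ^ (2 * M))⁻¹ := by
  have h0 := lintegral_rpow_subordinator_lt_top hM
  set K : ℝ := (4 * Real.pi) ^ (-(n / 2 : ℝ)) * M.factorial * 4 ^ M
  have hC : ENNReal.ofReal K * ∫⁻ t, ENNReal.ofReal (t ^ (M - n / 2 : ℝ)) ∂(subordinator s) ≠ ∞ :=
    (ENNReal.mul_lt_top ENNReal.ofReal_lt_top h0).ne
  refine ⟨(ENNReal.ofReal K * ∫⁻ t, ENNReal.ofReal (t ^ (M - n / 2 : ℝ))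
    ∂(subordinator s)).toNNReal, fun x hx => ?_⟩
  rw [ENNReal.coe_toNNReal hC, ← lintegral_const_mul _ (by fun_prop),
    ← lintegral_mul_const _ (by fun_prop)]
  refine lintegral_mono_ae ?_
  filter_upwards [ae_subordinator_pos s] with t ht
  rw [← ENNReal.ofReal_mul (by positivity), ← ENNReal.ofReal_mul (by positivity)]
  exact ENNReal.ofReal_le_ofReal (heatKernel_le M ht hx)

/-- All moments of the Bessel kernel are finite. -/
lemma lintegral_besselKernel_moment_lt_top (n : ℕ) {s : ℝ} (hs : 0 < s) (k : ℕ) :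
    ∫⁻ x : Rn n, ENNReal.ofReal ((1 + ‖x‖) ^ k) * besselKernel n s x < ∞ := by
  -- This power leaves, for |x| > 1, an integrable factor (1 + |x|)^{-(n+1)} after multiplication by
  -- (1 + |x|)^k. For |x| ≤ 1 the total mass of the kernel suffices.
  obtain ⟨C, hC⟩ := exists_besselKernel_le n (s := s) (n + k + 1)
    (by push_cast; have : (0 : ℝ) ≤ n := n.cast_nonneg; have : (0 : ℝ) ≤ k := k.cast_nonneg
        linarith)
  have hb : ∀ x : Rn n, ENNReal.ofReal ((1 + ‖x‖) ^ k) * besselKernel n s x ≤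
      2 ^ k * besselKernel n s x +
      C * 2 ^ (2 * (n + k + 1)) * ENNReal.ofReal ((1 + ‖x‖) ^ (-((n : ℝ) + 1))) := by
    intro x
    rcases le_or_gt ‖x‖ 1 with hx | hx
    · refine le_add_right ?_
      gcongr
      rw [show (2 : ℝ≥0∞) ^ k = ENNReal.ofReal (2 ^ k) by
        rw [ENNReal.ofReal_pow (by norm_num)]; simp]
      exact ENNReal.ofReal_le_ofReal (pow_le_pow_left₀ (by positivity) (by linarith) k)
    · refine le_add_left ?_
      have hx0 : x ≠ 0 := norm_pos_iff.1 (by linarith)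
      refine (mul_le_mul_right (hC x hx0) _).trans ?_
      rw [mul_left_comm, mul_assoc]
      refine mul_le_mul_right ?_ _
      rw [show (2 : ℝ≥0∞) ^ (2 * (n + k + 1)) = ENNReal.ofReal (2 ^ (2 * (n + k + 1))) by
        rw [ENNReal.ofReal_pow (by norm_num)]; simp, ← ENNReal.ofReal_mul (by positivity),
        ← ENNReal.ofReal_mul (by positivity)]
      refine ENNReal.ofReal_le_ofReal ?_
      have h1 : (1 + ‖x‖) ^ (-((n : ℝ) + 1)) = ((1 + ‖x‖) ^ (n + 1))⁻¹ := by
        rw [Real.rpow_neg (by positivity)]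
        norm_cast
      rw [h1]
      have h2 : (1 + ‖x‖) ^ k * (1 + ‖x‖) ^ (n + 1) ≤ (2 * ‖x‖) ^ (2 * (n + k + 1)) := by
        rw [← pow_add]
        calc (1 + ‖x‖) ^ (k + (n + 1)) ≤ (1 + ‖x‖) ^ (2 * (n + k + 1)) :=
              pow_le_pow_right₀ (by linarith) (by omega)
          _ ≤ _ := pow_le_pow_left₀ (by positivity) (by linarith) _
      rw [← div_eq_mul_inv, ← div_eq_mul_inv, div_le_div_iff₀ (by positivity) (by positivity),
        ← mul_pow]
      exact h2
  refine (lintegral_mono hb).trans_lt ?_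
  rw [lintegral_add_left (by have := measurable_besselKernel (n := n) hs; fun_prop),
    lintegral_const_mul _ (measurable_besselKernel hs), lintegral_besselKernel n hs,
    lintegral_const_mul _ (by fun_prop)]
  have h3 := integrable_one_add_norm (E := Rn n) (μ := volume) (r := (n : ℝ) + 1) (by simp)
  refine ENNReal.add_lt_top.2 ⟨by simp, ENNReal.mul_lt_top (ENNReal.mul_lt_top (by simp) (by simp)) h3.lintegral_lt_top⟩

/-! ### The Bessel kernel and the Fourier transform -/

/-- The transpose of `(I - Δ)^{-s/2}`, on Schwartz functions. -/
def schwartzBessel (n : ℕ) (s : ℝ) (φ : 𝓢(Rn n, ℂ)) : 𝓢(Rn n, ℂ) :=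
  𝓕 (SchwartzMap.smulLeftCLM ℂ (fun η : Rn n => (besselSymbol n (-s) η : ℂ)) (𝓕⁻ φ))

lemma besselSymbol_neg_eq_integral (n : ℕ) {s : ℝ} (hs : 0 < s) (η : Rn n) :
    besselSymbol n (-s) η =
      ∫ t, Real.exp (-(‖(2 * Real.pi) • η‖ ^ 2 * t)) ∂(subordinator s) := by
  rw [integral_exp_subordinator hs (by positivity), besselSymbol, neg_div]

/-- The substitution η ↦ -η exchanges the roles of 𝓕 and 𝓕⁻, because the symbol is even. -/
lemma schwartzBessel_apply_eq_integral_fourier (n : ℕ) (s : ℝ) (φ : 𝓢(Rn n, ℂ)) (x : Rn n) :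
    schwartzBessel n s φ x = ∫ η, Complex.exp (2 * Real.pi * Complex.I * (inner ℝ x η : ℝ)) *
      ((besselSymbol n (-s) η : ℂ) * 𝓕 (φ : Rn n → ℂ) η) := by
  unfold schwartzBessel
  rw [SchwartzMap.fourier_coe, Real.fourier_eq', ← integral_neg_eq_self]
  congr 1
  ext η
  rw [SchwartzMap.smulLeftCLM_apply_apply (besselSymbol_hasTemperateGrowth n (-s)),
    SchwartzMap.fourierInv_coe, Real.fourierInv_eq_fourier_neg, neg_neg, smul_eq_mul, smul_eq_mul]
  have h1 : besselSymbol n (-s) (-η) = besselSymbol n (-s) η := by simp [besselSymbol]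
  rw [h1, inner_neg_left, real_inner_comm]
  congr 2
  push_cast
  ring

/-- Each heat kernel has mass one, the law of t is a probability and φ is bounded. This licenses
Fubini in `schwartzBessel_apply`. -/
lemma integrable_heatKernel_mul_schwartz {n : ℕ} {s : ℝ} (hs : 0 < s) (φ : 𝓢(Rn n, ℂ))
    (x : Rn n) : Integrable (fun q : ℝ × Rn n => (heatKernel n q.1 (x - q.2) : ℂ) * φ q.2)
      ((subordinator s).prod volume) := by
  have := isProbabilityMeasure_subordinator hs
  obtain ⟨C, hC⟩ : ∃ C, ∀ z, ‖φ z‖ ≤ C :=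
    ⟨‖φ.toBoundedContinuousFunction‖, φ.toBoundedContinuousFunction.norm_coe_le_norm⟩
  have hm : Measurable fun q : ℝ × Rn n => heatKernel n q.1 (x - q.2) :=
    (measurable_heatKernel n).comp (measurable_fst.prodMk (measurable_const.sub measurable_snd))
  have h1 : Integrable (fun q : ℝ × Rn n => heatKernel n q.1 (x - q.2))
      ((subordinator s).prod volume) := by
    rw [integrable_prod_iff hm.aestronglyMeasurable]
    constructor
    · filter_upwards [ae_subordinator_pos s] with t ht
      exact (integrable_heatKernel ht).comp_sub_left x
    · refine (integrable_const (1 : ℝ)).congr ?_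
      filter_upwards [ae_subordinator_pos s] with t ht
      have : ∀ z, ‖heatKernel n t (x - z)‖ = heatKernel n t (x - z) := fun z =>
        Real.norm_of_nonneg (heatKernel_nonneg ht _)
      simp only [this]
      rw [integral_sub_left_eq_self (heatKernel n t), integral_heatKernel ht]
  refine Integrable.mono' (h1.norm.const_mul C) ?_ (ae_of_all _ fun q => ?_)
  · exact (Complex.measurable_ofReal.comp hm).aestronglyMeasurable.mul
      (φ.continuous.comp continuous_snd).aestronglyMeasurable
  · rw [norm_mul, Complex.norm_real, mul_comm]
    gcongr
    exact hC _

lemma fourier_gaussian_eq_heatKernel {n : ℕ} {t : ℝ} (ht : 0 < t) (x w : Rn n) :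
    𝓕 (fun η : Rn n => Complex.exp (-((4 * Real.pi ^ 2 * t : ℝ) : ℂ) * ‖η‖ ^ 2 +
      2 * Real.pi * Complex.I * (inner ℝ x η : ℝ))) w = heatKernel n t (x - w) := by
  have hb : 0 < ((4 * Real.pi ^ 2 * t : ℝ) : ℂ).re := by
    rw [Complex.ofReal_re]
    positivity
  rw [fourier_gaussian_innerProductSpace' hb x w, finrank_euclideanSpace_fin]
  unfold heatKernel
  rw [Complex.ofReal_mul ((4 * Real.pi * t) ^ (-(n / 2 : ℝ))), Complex.ofReal_exp, Real.rpow_neg (by positivity),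
    ← Real.inv_rpow (by positivity), Complex.ofReal_cpow (by positivity)]
  congr 1
  · congr 1
    · rw [← Complex.ofReal_div]
      congr 1
      field_simp
    · push_cast
      ring
  · congr 1
    push_cast
    have h1 : (Real.pi : ℂ) ≠ 0 := Complex.ofReal_ne_zero.2 Real.pi_ne_zero
    have h2 : (t : ℂ) ≠ 0 := Complex.ofReal_ne_zero.2 ht.ne'
    field_simp

/-- The symbol is a mixture of Gaussians in t. Fubini isolates one Gaussian, the multiplication
formula for the Fourier transform turns it into a heat kernel against φ, and Fubini again
reassembles the Bessel kernel. -/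
lemma schwartzBessel_apply {n : ℕ} {s : ℝ} (hs : 0 < s) (φ : 𝓢(Rn n, ℂ)) (x : Rn n) :
    schwartzBessel n s φ x = ∫ z, ((besselKernel n s (x - z)).toReal : ℂ) * φ z := by
  have := isProbabilityMeasure_subordinator hs
  have hφ : Integrable (𝓕 (φ : Rn n → ℂ)) := by
    rw [← SchwartzMap.fourier_coe]
    exact SchwartzMap.integrable _
  set g : ℝ → Rn n → ℂ := fun t η => Complex.exp (-((4 * Real.pi ^ 2 * t : ℝ) : ℂ) * ‖η‖ ^ 2 +
      2 * Real.pi * Complex.I * (inner ℝ x η : ℝ)) with hg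
  have hgexp : ∀ t η, g t η = Complex.exp (2 * Real.pi * Complex.I * (inner ℝ x η : ℝ)) *
      (Real.exp (-(‖(2 * Real.pi) • η‖ ^ 2 * t)) : ℝ) := by
    intro t η
    rw [hg, Complex.ofReal_exp, ← Complex.exp_add, norm_smul, Real.norm_of_nonneg (by positivity)]
    push_cast
    ring_nf
  have hgnorm : ∀ t η, ‖g t η‖ = Real.exp (-(‖(2 * Real.pi) • η‖ ^ 2 * t)) := by
    intro t η
    rw [hgexp, norm_mul, Complex.norm_real, Real.norm_of_nonneg (Real.exp_pos _).le,
      show (2 * Real.pi * Complex.I * (inner ℝ x η : ℝ) : ℂ) =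
        ((2 * Real.pi * inner ℝ x η : ℝ) : ℂ) * Complex.I by push_cast; ring,
      Complex.norm_exp_ofReal_mul_I, one_mul]
  have hgm : Continuous fun q : Rn n × ℝ => g q.2 q.1 := by
    simp only [hg]
    fun_prop
  have hint : Integrable (Function.uncurry fun (η : Rn n) (t : ℝ) =>
      g t η * 𝓕 (φ : Rn n → ℂ) η) (volume.prod (subordinator s)) := by
    refine Integrable.mono (hφ.comp_fst (subordinator s)) ?_ ?_
    · exact hgm.aestronglyMeasurable.mul (hφ.comp_fst (subordinator s)).aestronglyMeasurable
    · filter_upwards [(Measure.quasiMeasurePreserving_snd (μ := (volume : Measure (Rn n)))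
        (ν := subordinator s)).ae (ae_subordinator_pos s)] with q hq
      simp only [Function.uncurry, norm_mul]
      refine mul_le_of_le_one_left (norm_nonneg _) ?_
      rw [hgnorm, Real.exp_le_one_iff]
      have := mul_nonneg (sq_nonneg ‖(2 * Real.pi) • q.1‖) hq.le
      linarith
  have hgi : ∀ t, 0 < t → Integrable (g t) := by
    intro t ht
    have := GaussianFourier.integrable_cexp_neg_mul_sq_norm_add (V := Rn n)
      (b := ((4 * Real.pi ^ 2 * t : ℝ) : ℂ)) (by rw [Complex.ofReal_re]; positivity)
      (2 * Real.pi * Complex.I) x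
    exact this
  calc schwartzBessel n s φ x = ∫ η, ∫ t, g t η * 𝓕 (φ : Rn n → ℂ) η ∂(subordinator s) := by
        rw [schwartzBessel_apply_eq_integral_fourier]
        congr 1
        ext η
        rw [integral_mul_const, besselSymbol_neg_eq_integral n hs, ← mul_assoc]
        congr 1
        rw [← integral_complex_ofReal, ← integral_const_mul]
        congr 1
        ext t
        rw [hgexp]
    _ = ∫ t, (∫ η, g t η * 𝓕 (φ : Rn n → ℂ) η) ∂(subordinator s) := integral_integral_swap hint
    _ = ∫ t, (∫ z, (heatKernel n t (x - z) : ℂ) * φ z) ∂(subordinator s) := by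
        refine integral_congr_ae ?_
        filter_upwards [ae_subordinator_pos s] with t ht
        -- The multiplication formula ∫ ĝ φ = ∫ g φ̂ moves the transform from φ to the modulated
        -- Gaussian.
        have h := VectorFourier.integral_fourierIntegral_smul_eq_flip (L := innerₗ (Rn n))
          Real.continuous_fourierChar continuous_inner (hgi t ht) (φ.integrable (μ := volume))
        simp only [smul_eq_mul, flip_innerₗ] at h
        refine h.symm.trans ?_
        congr 1
        ext z
        congr 1
        exact fourier_gaussian_eq_heatKernel ht x z
    _ = ∫ z, ∫ t, (heatKernel n t (x - z) : ℂ) * φ z ∂(subordinator s) :=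
        integral_integral_swap (integrable_heatKernel_mul_schwartz hs φ x)
    _ = _ := by
        congr 1
        ext z
        rw [integral_mul_const, integral_complex_ofReal, integral_eq_lintegral_of_nonneg_ae]
        · rfl
        · filter_upwards [ae_subordinator_pos s] with t ht using heatKernel_nonneg ht _
        · exact ((measurable_heatKernel n).comp
            (measurable_id.prodMk measurable_const)).aestronglyMeasurable

/-! ### Sobolev inequalities for Schwartz functions -/

/-- The Fourier multiplier with symbol `η ↦ σ (-η)`, on Schwartz functions. -/
def schwartzMultiplier {n : ℕ} (σ : Rn n → ℂ) (φ : 𝓢(Rn n, ℂ)) : 𝓢(Rn n, ℂ) :=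
  𝓕 (SchwartzMap.smulLeftCLM ℂ σ (𝓕⁻ φ))

lemma eLpNorm_fourier {n : ℕ} (φ : 𝓢(Rn n, ℂ)) :
    eLpNorm (𝓕 φ : 𝓢(Rn n, ℂ)) 2 volume = eLpNorm φ 2 volume := by
  have h := SchwartzMap.norm_fourier_toL2_eq φ
  rw [SchwartzMap.norm_toLp, SchwartzMap.norm_toLp] at h
  have hfin : ∀ ψ : 𝓢(Rn n, ℂ), eLpNorm ψ 2 volume ≠ ∞ := fun ψ => (ψ.memLp 2 volume).eLpNorm_ne_top
  rwa [ENNReal.toReal_eq_toReal_iff' (hfin _) (hfin _)] at h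

lemma eLpNorm_fourierInv {n : ℕ} (φ : 𝓢(Rn n, ℂ)) :
    eLpNorm (𝓕⁻ φ : 𝓢(Rn n, ℂ)) 2 volume = eLpNorm φ 2 volume := by
  rw [← eLpNorm_fourier, FourierTransform.fourier_fourierInv_eq]

lemma eLpNorm_schwartzMultiplier {n : ℕ} {σ : Rn n → ℂ} (hσ : σ.HasTemperateGrowth)
    (φ : 𝓢(Rn n, ℂ)) :
    eLpNorm (schwartzMultiplier σ φ) 2 volume = eLpNorm (fun η => σ η * 𝓕⁻ φ η) 2 volume := by
  rw [schwartzMultiplier, eLpNorm_fourier]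
  congr 1
  ext η
  rw [SchwartzMap.smulLeftCLM_apply_apply hσ, smul_eq_mul]

/-- Cauchy–Schwarz in the Fourier integral, then Plancherel for φ. -/
lemma enorm_schwartzMultiplier_le {n : ℕ} {σ : Rn n → ℂ} (hσ : σ.HasTemperateGrowth)
    (φ : 𝓢(Rn n, ℂ)) (x : Rn n) :
    ‖schwartzMultiplier σ φ x‖ₑ ≤ eLpNorm σ 2 volume * eLpNorm φ 2 volume := by
  rw [schwartzMultiplier, SchwartzMap.fourier_coe, Real.fourier_eq']
  refine (enorm_integral_le_lintegral_enorm _).trans ?_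
  have h1 : ∀ η, ‖Complex.exp ((-2 * Real.pi * inner ℝ η x : ℝ) * Complex.I) •
      SchwartzMap.smulLeftCLM ℂ σ (𝓕⁻ φ) η‖ₑ = ‖σ η • (𝓕⁻ φ : 𝓢(Rn n, ℂ)) η‖ₑ := by
    intro η
    rw [enorm_smul, SchwartzMap.smulLeftCLM_apply_apply hσ, ← ofReal_norm,
      Complex.norm_exp_ofReal_mul_I, ENNReal.ofReal_one, one_mul]
  have h2 : AEStronglyMeasurable (𝓕⁻ φ : 𝓢(Rn n, ℂ)) volume :=
    (SchwartzMap.continuous _).aestronglyMeasurable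
  have h3 : AEStronglyMeasurable σ volume := hσ.1.continuous.aestronglyMeasurable
  have h4 := eLpNorm_smul_le_mul_eLpNorm (p := 2) (q := 2) (r := 1) h2 h3
  rw [lintegral_congr h1, ← eLpNorm_fourierInv]
  rw [eLpNorm_one_eq_lintegral_enorm] at h4
  exact h4

/-- The base is at least 1, so s may be lowered to a, and then dominates |η|². The freedom a < s is
needed for s = n/2, where |η|^{-2s} is not locally integrable. -/
lemma besselSymbol_neg_le {n : ℕ} {s a : ℝ} (ha : 0 ≤ a) (has : a ≤ s) {η : Rn n} (hη : η ≠ 0) :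
    besselSymbol n (-s) η ≤ ‖η‖ ^ (-a) := by
  have hη' : 0 < ‖η‖ := norm_pos_iff.2 hη
  unfold besselSymbol
  calc (1 + ‖(2 * Real.pi) • η‖ ^ 2) ^ (-s / 2) ≤ (1 + ‖(2 * Real.pi) • η‖ ^ 2) ^ (-a / 2) :=
        Real.rpow_le_rpow_of_exponent_le (by simp) (by linarith)
    _ ≤ (‖η‖ ^ 2) ^ (-a / 2) := by
        refine Real.rpow_le_rpow_of_nonpos (by positivity) ?_ (by linarith)
        rw [norm_smul, mul_pow, Real.norm_of_nonneg (by positivity)]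
        nlinarith [Real.pi_gt_three, sq_nonneg ‖η‖, mul_nonneg (sq_nonneg ‖η‖)
          (by nlinarith [Real.pi_gt_three] : 0 ≤ (2 * Real.pi) ^ 2 - 1)]
    _ = _ := by
        rw [← Real.rpow_natCast, ← Real.rpow_mul hη'.le]
        congr 1
        push_cast
        ring

lemma besselSymbol_nonneg (n : ℕ) (s : ℝ) (η : Rn n) : 0 ≤ besselSymbol n s η := by
  unfold besselSymbol
  positivity

/-- The embedding of `H^s` into `L^∞` for `s > n/2`. -/
lemma exists_eLpNorm_top_schwartzBessel_le (n : ℕ) {s : ℝ} (hs : n / 2 < s) :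
    ∃ C : ℝ≥0, ∀ φ : 𝓢(Rn n, ℂ),
      eLpNorm (schwartzBessel n s φ) ∞ volume ≤ C * eLpNorm φ 2 volume := by
  have hσ := besselSymbol_hasTemperateGrowth n (-s)
  have h2 : eLpNorm (fun η : Rn n => (besselSymbol n (-s) η : ℂ)) 2 volume < ∞ := by
    have : MemLp (fun η : Rn n => (besselSymbol n (-s) η : ℂ)) 2 volume := by
      rw [memLp_two_iff_integrable_sq_norm hσ.1.continuous.aestronglyMeasurable]
      have hi := integrable_rpow_neg_one_add_norm_sq (E := Rn n) (μ := volume) (r := 2 * s)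
        (by rw [finrank_euclideanSpace_fin]; linarith)
      refine hi.mono' (hσ.1.continuous.norm.pow 2).aestronglyMeasurable (ae_of_all _ fun η => ?_)
      rw [Complex.norm_real, norm_pow, norm_norm, Real.norm_of_nonneg (besselSymbol_nonneg n _ _),
        besselSymbol, ← Real.rpow_natCast, ← Real.rpow_mul (by positivity)]
      have hn : (0 : ℝ) ≤ n := n.cast_nonneg
      rw [show -s / 2 * ((2 : ℕ) : ℝ) = -(2 * s) / 2 by push_cast; ring]
      refine Real.rpow_le_rpow_of_nonpos (by positivity) ?_ (by linarith)
      rw [norm_smul, mul_pow, Real.norm_of_nonneg (by positivity)]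
      nlinarith [Real.pi_gt_three, mul_nonneg (sq_nonneg ‖η‖)
          (by nlinarith [Real.pi_gt_three] : 0 ≤ (2 * Real.pi) ^ 2 - 1)]
    exact this.2
  refine ⟨(eLpNorm (fun η : Rn n => (besselSymbol n (-s) η : ℂ)) 2 volume).toNNReal, fun φ => ?_⟩
  rw [ENNReal.coe_toNNReal h2.ne]
  rw [eLpNorm_exponent_top]
  exact eLpNormEssSup_le_of_ae_enorm_bound (ae_of_all _ (enorm_schwartzMultiplier_le hσ φ))

/-! ### The Sobolev embedding into L^q with q finite, through level sets. -/

lemma exists_lintegral_ball_norm_rpow (n : ℕ) [NeZero n] {a : ℝ} (ha : a < n / 2) :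
    ∃ K : ℝ, 0 ≤ K ∧ ∀ r : ℝ, 0 < r →
      ∫⁻ η in Metric.ball (0 : Rn n) r, ENNReal.ofReal (‖η‖ ^ (-(2 * a))) =
        ENNReal.ofReal (K * r ^ (n - 2 * a : ℝ)) := by
  refine ⟨∫ η in Metric.ball (0 : Rn n) 1, ‖η‖ ^ (-(2 * a)), integral_nonneg fun η => by positivity,
    fun r hr => ?_⟩
  have hn : 1 ≤ n := NeZero.one_le
  have hi : IntegrableOn (fun η : Rn n => ‖η‖ ^ (-(2 * a))) (Metric.ball 0 r) volume := by
    refine integrableOn_ball_of_norm_le_rpow (C := 1) (α := 2 * a)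
      (by rwa [finrank_euclideanSpace_fin])
      (by rw [finrank_euclideanSpace_fin]; linarith) (ae_of_all _ fun η => ?_)
      (measurable_norm.pow_const _).aestronglyMeasurable
    rw [one_mul, Real.norm_of_nonneg (by positivity)]
  rw [← ofReal_integral_eq_lintegral_ofReal hi (ae_of_all _ fun η => by positivity)]
  congr 1
  -- Dilation to the unit ball: homogeneity gives the power n - 2a of r, and K is the integral over
  -- the unit ball.
  have h := Measure.setIntegral_comp_smul_of_pos (volume : Measure (Rn n))
    (fun η : Rn n => ‖η‖ ^ (-(2 * a))) (Metric.ball 0 1) hr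
  rw [smul_unitBall_of_pos hr, finrank_euclideanSpace_fin, smul_eq_mul] at h
  have h2 : ∀ η : Rn n, ‖r • η‖ ^ (-(2 * a)) = r ^ (-(2 * a)) * ‖η‖ ^ (-(2 * a)) := by
    intro η
    rw [norm_smul, Real.norm_of_nonneg hr.le, Real.mul_rpow hr.le (norm_nonneg _)]
  simp only [h2] at h
  rw [integral_const_mul, eq_inv_mul_iff_mul_eq₀ (by positivity)] at h
  rw [← h, sub_eq_add_neg, Real.rpow_add hr, Real.rpow_natCast]
  ring

lemma ae_ne_zero (n : ℕ) [NeZero n] : ∀ᵐ η : Rn n, η ≠ 0 := by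
  have : Nontrivial (Rn n) := Module.nontrivial_of_finrank_pos (R := ℝ)
    (by rw [finrank_euclideanSpace_fin]; exact Nat.pos_of_neZero n)
  exact compl_mem_ae_iff.2 (measure_singleton (0 : Rn n))

lemma eLpNorm_two_eq {n : ℕ} {F : Type*} [NormedAddCommGroup F] (f : Rn n → F)
    (μ : Measure (Rn n)) : eLpNorm f 2 μ = (∫⁻ x, ‖f x‖ₑ ^ 2 ∂μ) ^ (1 / 2 : ℝ) := by
  rw [eLpNorm_eq_lintegral_rpow_enorm_toReal (by norm_num) (by norm_num)]
  simp

lemma eLpNorm_two_sq {n : ℕ} {F : Type*} [NormedAddCommGroup F] (f : Rn n → F)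
    (μ : Measure (Rn n)) : eLpNorm f 2 μ ^ 2 = ∫⁻ x, ‖f x‖ₑ ^ 2 ∂μ := by
  rw [eLpNorm_two_eq, ← ENNReal.rpow_natCast, ← ENNReal.rpow_mul]
  simp

lemma enorm_besselSymbol_sq_le {n : ℕ} {s a : ℝ} (ha : 0 ≤ a) (has : a ≤ s) {η : Rn n}
    (hη : η ≠ 0) :
    ‖(besselSymbol n (-s) η : ℂ)‖ₑ ^ 2 ≤ ENNReal.ofReal (‖η‖ ^ (-(2 * a))) := by
  rw [← ofReal_norm, ← ENNReal.ofReal_pow (norm_nonneg _), Complex.norm_real,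
    Real.norm_of_nonneg (besselSymbol_nonneg n _ _)]
  refine ENNReal.ofReal_le_ofReal ?_
  refine (pow_le_pow_left₀ (besselSymbol_nonneg n _ _) (besselSymbol_neg_le ha has hη) 2).trans
    (le_of_eq ?_)
  rw [← Real.rpow_natCast, ← Real.rpow_mul (norm_nonneg _)]
  congr 1
  push_cast
  ring

/-- Splitting into frequencies below and above `A` bounds the distribution function. -/
lemma measure_lt_norm_schwartzBessel_le {n : ℕ} [NeZero n] {s a K A N l : ℝ} (ha : 0 ≤ a)
    (has : a ≤ s) (hK0 : 0 ≤ K)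
    (hK : ∀ r : ℝ, 0 < r → ∫⁻ η in Metric.ball (0 : Rn n) r, ENNReal.ofReal (‖η‖ ^ (-(2 * a))) =
        ENNReal.ofReal (K * r ^ (n - 2 * a : ℝ)))
    (hA : 0 < A) (hl : 0 < l) (φ : 𝓢(Rn n, ℂ)) (hN : eLpNorm φ 2 volume ≤ ENNReal.ofReal N)
    (h : Real.sqrt (K * (2 * A) ^ (n - 2 * a : ℝ)) * N ≤ l / 2) :
    volume {x | l < ‖schwartzBessel n s φ x‖} ≤
      (∫⁻ η in {η : Rn n | A ≤ ‖η‖}, ENNReal.ofReal (‖η‖ ^ (-(2 * a))) *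
        ‖(𝓕⁻ φ : 𝓢(Rn n, ℂ)) η‖ₑ ^ 2) / ENNReal.ofReal ((l / 2) ^ 2) := by
  set m : Rn n → ℂ := fun η => (besselSymbol n (-s) η : ℂ) with hm
  have hmt : m.HasTemperateGrowth := besselSymbol_hasTemperateGrowth n (-s)
  -- The frequency cut-off is 1 for |η| ≤ A and 0 for |η| ≥ 2A. It is smooth so that both pieces of
  -- the symbol have temperate growth and act on Schwartz functions.
  let f : ContDiffBump (0 : Rn n) := ⟨A, 2 * A, hA, by linarith⟩
  have hft : (fun η => (f η : ℂ)).HasTemperateGrowth :=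
    (f.hasCompactSupport.comp_left Complex.ofReal_zero).hasTemperateGrowth
      (Complex.ofRealCLM.contDiff.comp f.contDiff)
  set σ : Rn n → ℂ := (fun η => (f η : ℂ)) * m with hσ
  have hσt : σ.HasTemperateGrowth := hft.mul hmt
  have hdt : (m - σ).HasTemperateGrowth := hmt.sub hσt
  have hdec : ∀ x, schwartzMultiplier (m - σ) φ x =
      schwartzBessel n s φ x - schwartzMultiplier σ φ x := by
    intro x
    have : schwartzMultiplier (m - σ) φ = schwartzBessel n s φ - schwartzMultiplier σ φ := by
      unfold schwartzMultiplier schwartzBessel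
      rw [SchwartzMap.smulLeftCLM_sub hmt hσt, sub_apply,
        sub_eq_add_neg, FourierTransform.fourier_add, FourierTransform.fourier_neg, ← sub_eq_add_neg]
    rw [this, sub_apply]
  -- Low frequencies are bounded pointwise by Cauchy–Schwarz, so where the whole exceeds l the
  -- high-frequency part is at least l/2; that set is measured by Chebyshev and Plancherel.
  have hlow : ∀ x, ‖schwartzMultiplier σ φ x‖ ≤ l / 2 := by
    intro x
    have h1 : eLpNorm σ 2 volume ≤ ENNReal.ofReal (Real.sqrt (K * (2 * A) ^ (n - 2 * a : ℝ))) := by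
      rw [eLpNorm_two_eq, Real.sqrt_eq_rpow]
      have h0 : 0 ≤ K * (2 * A) ^ (n - 2 * a : ℝ) := by positivity
      rw [← ENNReal.ofReal_rpow_of_nonneg h0 (by norm_num), ← hK _ (by linarith),
        ← lintegral_indicator measurableSet_ball]
      gcongr 1
      refine lintegral_mono_ae ?_
      filter_upwards [ae_ne_zero n] with η hη
      by_cases hb : η ∈ Metric.ball (0 : Rn n) (2 * A)
      · rw [indicator_of_mem hb]
        refine le_trans ?_ (enorm_besselSymbol_sq_le ha has hη)
        gcongr 1
        rw [hσ, Pi.mul_apply, enorm_mul]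
        refine mul_le_of_le_one_left' ?_
        rw [← ofReal_norm, Complex.norm_real, Real.norm_of_nonneg f.nonneg]
        exact ENNReal.ofReal_le_one.2 f.le_one
      · rw [indicator_of_notMem hb, hσ, Pi.mul_apply, f.zero_of_le_dist (by simpa using hb)]
        simp
    have h2 := (enorm_schwartzMultiplier_le hσt φ x).trans (mul_le_mul' h1 hN)
    rw [← ENNReal.ofReal_mul (Real.sqrt_nonneg _), ← ofReal_norm] at h2
    exact (ENNReal.ofReal_le_ofReal_iff (by linarith)).1
      (h2.trans (ENNReal.ofReal_le_ofReal h))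
  have hhigh : ∫⁻ x, ‖schwartzMultiplier (m - σ) φ x‖ₑ ^ 2 ≤
      ∫⁻ η in {η : Rn n | A ≤ ‖η‖}, ENNReal.ofReal (‖η‖ ^ (-(2 * a))) *
        ‖(𝓕⁻ φ : 𝓢(Rn n, ℂ)) η‖ₑ ^ 2 := by
    rw [← eLpNorm_two_sq, eLpNorm_schwartzMultiplier hdt, eLpNorm_two_sq,
      ← lintegral_indicator (measurableSet_le measurable_const measurable_norm)]
    refine lintegral_mono_ae ?_
    filter_upwards [ae_ne_zero n] with η hη
    by_cases hb : A ≤ ‖η‖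
    · rw [indicator_of_mem (show η ∈ {η : Rn n | A ≤ ‖η‖} from hb), enorm_mul, mul_pow]
      gcongr 1
      refine le_trans ?_ (enorm_besselSymbol_sq_le ha has hη)
      gcongr 1
      have : (m - σ) η = ((1 - f η : ℝ) : ℂ) * m η := by
        rw [hσ, Pi.sub_apply, Pi.mul_apply]
        push_cast
        ring
      rw [this, enorm_mul]
      refine mul_le_of_le_one_left' ?_
      rw [← ofReal_norm, Complex.norm_real, Real.norm_of_nonneg (sub_nonneg.2 f.le_one)]
      exact ENNReal.ofReal_le_one.2 (by linarith [f.nonneg (x := η)])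
    · have : (m - σ) η = 0 := by
        rw [hσ, Pi.sub_apply, Pi.mul_apply, f.one_of_mem_closedBall
          (by simpa using (not_le.1 hb).le)]
        simp
      rw [this]
      simp
  have hm2 : Measurable fun x => ‖schwartzMultiplier (m - σ) φ x‖ₑ ^ 2 :=
    (SchwartzMap.continuous _).enorm.measurable.pow_const 2
  refine le_trans (measure_mono fun x (hx : l < _) => ?_)
    ((meas_ge_le_lintegral_div hm2.aemeasurable (ε := ENNReal.ofReal ((l / 2) ^ 2))
      (by simpa using by positivity) ENNReal.ofReal_ne_top).trans
      (ENNReal.div_le_div_right hhigh _))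
  simp only [mem_ofPred_eq]
  rw [← ofReal_norm, ← ENNReal.ofReal_pow (norm_nonneg _)]
  refine ENNReal.ofReal_le_ofReal (pow_le_pow_left₀ (by linarith) ?_ 2)
  rw [hdec x]
  have := norm_sub_norm_le (schwartzBessel n s φ x) (schwartzMultiplier σ φ x)
  linarith [hlow x]

lemma lintegral_Ioc_rpow {q L : ℝ} (hq : 2 < q) (hL : 0 ≤ L) :
    ∫⁻ l in Ioc 0 L, ENNReal.ofReal (l ^ (q - 3)) = ENNReal.ofReal (L ^ (q - 2) / (q - 2)) := by
  have hi : IntervalIntegrable (fun l : ℝ => l ^ (q - 3)) volume 0 L :=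
    intervalIntegral.intervalIntegrable_rpow' (by linarith)
  rw [← ofReal_integral_eq_lintegral_ofReal ((intervalIntegrable_iff_integrableOn_Ioc_of_le hL).1 hi)
    ((ae_restrict_iff' measurableSet_Ioc).2 (ae_of_all _ fun l hl => Real.rpow_nonneg hl.1.le _)),
    ← intervalIntegral.integral_of_le hL, integral_rpow (Or.inl (by linarith))]
  congr 1
  rw [Real.zero_rpow (by linarith), sub_zero]
  ring_nf

/-- The Sobolev embedding `H^s ⊆ L^q`, by the argument of Chemin and Xu. -/
lemma exists_eLpNorm_schwartzBessel_le (n : ℕ) [NeZero n] {s a q : ℝ} (ha : 0 < a) (has : a ≤ s)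
    (han : a < n / 2) (hq : 2 < q) (hqa : (n / 2 - a) * (q - 2) = 2 * a) :
    ∃ C : ℝ≥0, ∀ φ : 𝓢(Rn n, ℂ),
      eLpNorm (schwartzBessel n s φ) (ENNReal.ofReal q) volume ≤ C * eLpNorm φ 2 volume := by
  obtain ⟨K, hK0, hK⟩ := exists_lintegral_ball_norm_rpow n han
  -- The summand 1 only keeps L positive, since the case K = 0 is not excluded.
  set L : ℝ := Real.sqrt (K * 2 ^ (n - 2 * a : ℝ)) + 1 with hLdef
  have hL : 0 < L := by positivity
  set b : ℝ := n / 2 - a with hb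
  have hb0 : 0 < b := by linarith
  have hq2 : 0 < q - 2 := by linarith
  set D : ℝ := q * (4 * ((2 * L) ^ (q - 2) / (q - 2))) with hD
  have hD0 : 0 ≤ D := by positivity
  refine ⟨(D ^ (1 / q)).toNNReal, fun φ => ?_⟩
  have hfin : eLpNorm φ 2 volume ≠ ∞ := (φ.memLp 2 volume).eLpNorm_ne_top
  by_cases hφ : eLpNorm φ 2 volume = 0
  · have h0 : ∀ x, schwartzBessel n s φ x = 0 := by
      intro x
      -- The L² norm of the symbol may be ∞ here; the bound is still 0 because ∞ · 0 = 0.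
      have := enorm_schwartzMultiplier_le (besselSymbol_hasTemperateGrowth n (-s)) φ x
      rw [hφ, mul_zero, le_zero_iff, enorm_eq_zero] at this
      exact this
    rw [eLpNorm_congr_ae (ae_of_all _ h0)]
    simp
  set N : ℝ := (eLpNorm φ 2 volume).toReal with hNdef
  have hN : 0 < N := ENNReal.toReal_pos hφ hfin
  have hNφ : eLpNorm φ 2 volume = ENNReal.ofReal N := (ENNReal.ofReal_toReal hfin).symm
  set ψ : 𝓢(Rn n, ℂ) := 𝓕⁻ φ with hψ
  have hψ2 : ∫⁻ η, ‖ψ η‖ₑ ^ 2 = ENNReal.ofReal (N ^ 2) := by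
    rw [← eLpNorm_two_sq, hψ, eLpNorm_fourierInv, hNφ, ENNReal.ofReal_pow hN.le]
  set h : Rn n → ℝ≥0∞ := fun η => ENNReal.ofReal (4 * ‖η‖ ^ (-(2 * a))) * ‖ψ η‖ₑ ^ 2 with hh
  have hhm : Measurable h :=
    ((measurable_norm.pow_const _).const_mul 4).ennreal_ofReal.mul
      (ψ.continuous.enorm.measurable.pow_const 2)
  -- The height at which the cut-off frequency A, chosen below as a function of l, reaches |η|: the
  -- condition A ≤ |η| amounts to l ≤ Λ η.
  set Λ : Rn n → ℝ := fun η => 2 * L * N * ‖η‖ ^ b with hΛ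
  have hΛ0 : ∀ η, 0 ≤ Λ η := fun η => by positivity
  have hΛm : Measurable Λ := (measurable_norm.pow_const _).const_mul _
  have key : ∀ l : ℝ, 0 < l → volume {x | l < ‖schwartzBessel n s φ x‖} *
      ENNReal.ofReal (l ^ (q - 1)) ≤
      ∫⁻ η, {p : ℝ × Rn n | p.1 ≤ Λ p.2}.indicator
        (fun p => h p.2 * ENNReal.ofReal (p.1 ^ (q - 3))) (l, η) := by
    intro l hl
    -- The low-frequency part is at most L A^b N, and this A makes that equal to l/2.
    set A : ℝ := (l / (2 * L * N)) ^ (1 / b) with hA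
    have hA0 : 0 < A := by positivity
    have hAb : A ^ b = l / (2 * L * N) := by
      rw [hA, ← Real.rpow_mul (by positivity), one_div_mul_cancel hb0.ne', Real.rpow_one]
    have hcond : Real.sqrt (K * (2 * A) ^ (n - 2 * a : ℝ)) * N ≤ l / 2 := by
      rw [Real.mul_rpow (by norm_num) hA0.le, ← mul_assoc, Real.sqrt_mul (by positivity),
        show (n - 2 * a : ℝ) = b * 2 by rw [hb]; ring, Real.rpow_mul hA0.le, Real.rpow_two,
        Real.sqrt_sq (by positivity), hAb]
      rw [show b * 2 = (n - 2 * a : ℝ) by rw [hb]; ring]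
      calc _ ≤ L * (l / (2 * L * N)) * N := by
            gcongr
            linarith
        _ = l / 2 := by field_simp
    refine (mul_le_mul_left (measure_lt_norm_schwartzBessel_le ha.le has hK0 hK hA0 hl φ
      hNφ.le hcond) _).trans ?_
    rw [← hψ, ENNReal.div_eq_inv_mul, mul_right_comm, ← lintegral_const_mul' _ _
      (ENNReal.mul_ne_top (by simpa using by positivity) ENNReal.ofReal_ne_top),
      ← lintegral_indicator (measurableSet_le measurable_const measurable_norm)]
    refine lintegral_mono fun η => ?_
    by_cases hη : A ≤ ‖η‖
    · have h1 : l ≤ Λ η := by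
        have := Real.rpow_le_rpow hA0.le hη hb0.le
        rw [hAb, div_le_iff₀ (by positivity)] at this
        rw [hΛ]
        linarith
      rw [indicator_of_mem (show η ∈ {η : Rn n | A ≤ ‖η‖} from hη),
        indicator_of_mem (show (l, η) ∈ {p : ℝ × Rn n | p.1 ≤ Λ p.2} from h1)]
      simp only [hh]
      rw [← mul_assoc, ← ENNReal.ofReal_inv_of_pos (by positivity),
        ← ENNReal.ofReal_mul (by positivity), ← ENNReal.ofReal_mul (by positivity),
        mul_right_comm (ENNReal.ofReal (4 * _)), ← ENNReal.ofReal_mul (by positivity)]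
      refine mul_le_mul_left (ENNReal.ofReal_le_ofReal (le_of_eq ?_)) _
      rw [show q - 1 = (q - 3) + (2 : ℕ) by push_cast; ring, Real.rpow_add hl, Real.rpow_natCast]
      field_simp
      ring
    · rw [indicator_of_notMem (show η ∉ {η : Rn n | A ≤ ‖η‖} from hη)]
      exact zero_le
  have hmeas : Measurable ({p : ℝ × Rn n | p.1 ≤ Λ p.2}.indicator
      (fun p => h p.2 * ENNReal.ofReal (p.1 ^ (q - 3)))) :=
    ((hhm.comp measurable_snd).mul (measurable_fst.pow_const _).ennreal_ofReal).indicator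
      (measurableSet_le measurable_fst (hΛm.comp measurable_snd))
  have hfub : ∫⁻ l in Ioi (0 : ℝ), ∫⁻ η, {p : ℝ × Rn n | p.1 ≤ Λ p.2}.indicator
        (fun p => h p.2 * ENNReal.ofReal (p.1 ^ (q - 3))) (l, η) ≤
      ENNReal.ofReal (4 * ((2 * L) ^ (q - 2) / (q - 2)) * N ^ q) := by
    have hmeas' : Measurable (Function.uncurry fun (l : ℝ) (η : Rn n) =>
        {p : ℝ × Rn n | p.1 ≤ Λ p.2}.indicator
          (fun p => h p.2 * ENNReal.ofReal (p.1 ^ (q - 3))) (l, η)) := hmeas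
    rw [lintegral_lintegral_swap hmeas'.aemeasurable]
    have h1 : ∀ η, ∫⁻ l in Ioi (0 : ℝ), {p : ℝ × Rn n | p.1 ≤ Λ p.2}.indicator
        (fun p => h p.2 * ENNReal.ofReal (p.1 ^ (q - 3))) (l, η) =
        h η * ENNReal.ofReal (Λ η ^ (q - 2) / (q - 2)) := by
      intro η
      rw [← lintegral_Ioc_rpow hq (hΛ0 η), ← lintegral_const_mul _ (by fun_prop),
        ← lintegral_indicator measurableSet_Ioi, ← lintegral_indicator measurableSet_Ioc]
      congr 1
      ext l
      by_cases hl : 0 < l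
      · by_cases hl2 : l ≤ Λ η
        · rw [indicator_of_mem (show l ∈ Ioi 0 from hl), indicator_of_mem
            (show (l, η) ∈ {p : ℝ × Rn n | p.1 ≤ Λ p.2} from hl2),
            indicator_of_mem (show l ∈ Ioc 0 (Λ η) from ⟨hl, hl2⟩)]
        · rw [indicator_of_mem (show l ∈ Ioi 0 from hl), indicator_of_notMem
            (show (l, η) ∉ {p : ℝ × Rn n | p.1 ≤ Λ p.2} from hl2),
            indicator_of_notMem (show l ∉ Ioc 0 (Λ η) from fun h => hl2 h.2)]
      · rw [indicator_of_notMem (show l ∉ Ioi 0 from hl),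
          indicator_of_notMem (show l ∉ Ioc 0 (Λ η) from fun h => hl h.1)]
    rw [lintegral_congr h1]
    -- The relation b (q - 2) = 2a, that is 1/q = 1/2 - a/n, makes the power of |η| from the
    -- integral in l cancel the one in h. What remains is the L² norm of ψ.
    have h2 : ∀ᵐ η, h η * ENNReal.ofReal (Λ η ^ (q - 2) / (q - 2)) =
        ENNReal.ofReal (4 * ((2 * L * N) ^ (q - 2) / (q - 2))) * ‖ψ η‖ₑ ^ 2 := by
      filter_upwards [ae_ne_zero n] with η hη
      have hη' : 0 < ‖η‖ := norm_pos_iff.2 hη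
      simp only [hh, hΛ]
      rw [mul_right_comm, ← ENNReal.ofReal_mul (by positivity)]
      congr 2
      rw [Real.mul_rpow (by positivity) (by positivity), ← Real.rpow_mul hη'.le, hqa,
        Real.rpow_neg hη'.le]
      field_simp
    rw [lintegral_congr_ae h2, lintegral_const_mul _ (ψ.continuous.enorm.measurable.pow_const 2),
      hψ2, ← ENNReal.ofReal_mul (by positivity)]
    refine ENNReal.ofReal_le_ofReal (le_of_eq ?_)
    rw [Real.mul_rpow (by positivity) hN.le, show N ^ q = N ^ (q - 2) * N ^ 2 by
      rw [← Real.rpow_natCast, ← Real.rpow_add hN]; congr 1; push_cast; ring]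
    ring
  have hlay : ∫⁻ x, ENNReal.ofReal (‖schwartzBessel n s φ x‖ ^ q) ≤ ENNReal.ofReal (D * N ^ q) := by
    rw [lintegral_rpow_eq_lintegral_meas_lt_mul volume (ae_of_all _ fun x => norm_nonneg _)
      (schwartzBessel n s φ).continuous.norm.aemeasurable (by linarith)]
    have h3 : ENNReal.ofReal (D * N ^ q) = ENNReal.ofReal q *
        ENNReal.ofReal (4 * ((2 * L) ^ (q - 2) / (q - 2)) * N ^ q) := by
      rw [← ENNReal.ofReal_mul (by linarith), hD]
      ring_nf
    rw [h3]
    gcongr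
    exact (setLIntegral_mono' measurableSet_Ioi fun l hl => key l hl).trans hfub
  rw [eLpNorm_eq_lintegral_rpow_enorm_toReal (by simpa using by linarith) ENNReal.ofReal_ne_top,
    ENNReal.toReal_ofReal (by linarith), hNφ]
  have h4 : ∀ x, ‖schwartzBessel n s φ x‖ₑ ^ q =
      ENNReal.ofReal (‖schwartzBessel n s φ x‖ ^ q) := fun x => by
    rw [← ofReal_norm, ENNReal.ofReal_rpow_of_nonneg (norm_nonneg _) (by linarith)]
  rw [lintegral_congr h4]
  refine (ENNReal.rpow_le_rpow hlay (by positivity)).trans (le_of_eq ?_)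
  rw [ENNReal.ofReal_rpow_of_nonneg (by positivity) (by positivity),
    Real.mul_rpow hD0 (by positivity), ← Real.rpow_mul hN.le, mul_one_div_cancel (by linarith),
    Real.rpow_one, ENNReal.ofReal_mul (by positivity)]
  rfl

/-! ### Convolution with an integrable kernel -/

/-- The convolution of two nonnegative functions. -/
def lconv {n : ℕ} (D h : Rn n → ℝ≥0∞) (x : Rn n) : ℝ≥0∞ := ∫⁻ z, D (x - z) * h z

/-- The convolution of the kernel `k` and the function `v`. -/
def kernelConv {n : ℕ} (k v : Rn n → ℂ) (x : Rn n) : ℂ := ∫ z, k (x - z) * v z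

/-- Cauchy–Schwarz for the functions 1 and g with respect to the measure f dμ. -/
lemma lintegral_mul_sq_le {α : Type*} [MeasurableSpace α] {μ : Measure α} {f g : α → ℝ≥0∞}
    (hf : AEMeasurable f μ) (hg : AEMeasurable g μ) :
    (∫⁻ a, f a * g a ∂μ) ^ 2 ≤ (∫⁻ a, f a ∂μ) * ∫⁻ a, f a * g a ^ 2 ∂μ := by
  have h := ENNReal.lintegral_mul_le_Lp_mul_Lq μ Real.HolderConjugate.two_two
    (hf.pow_const (1 / 2 : ℝ)) ((hf.pow_const (1 / 2 : ℝ)).mul hg)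
  have h0 : ∀ y : ℝ≥0∞, y ^ (1 / 2 : ℝ) * y ^ (1 / 2 : ℝ) = y := fun y => by
    rw [← ENNReal.rpow_add_of_nonneg _ _ (by norm_num) (by norm_num)]
    norm_num
  have h1 : ∀ a, ((fun a => f a ^ (1 / 2 : ℝ)) * ((fun a => f a ^ (1 / 2 : ℝ)) * g)) a =
      f a * g a := fun a => by
    simp only [Pi.mul_apply]
    rw [← mul_assoc, h0]
  have h2 : ∀ a, (f a ^ (1 / 2 : ℝ)) ^ (2 : ℝ) = f a := fun a => by
    rw [← ENNReal.rpow_mul]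
    norm_num
  have h3 : ∀ a, ((fun a => f a ^ (1 / 2 : ℝ)) * g) a ^ (2 : ℝ) = f a * g a ^ 2 := fun a => by
    simp only [Pi.mul_apply]
    rw [ENNReal.mul_rpow_of_nonneg _ _ (by norm_num), h2, ENNReal.rpow_two]
  rw [lintegral_congr h1, lintegral_congr h2, lintegral_congr h3] at h
  refine (pow_le_pow_left' h 2).trans (le_of_eq ?_)
  rw [mul_pow, ← ENNReal.rpow_two, ← ENNReal.rpow_two, ← ENNReal.rpow_mul, ← ENNReal.rpow_mul]
  norm_num

lemma lintegral_sub_left {n : ℕ} (D : Rn n → ℝ≥0∞) (x : Rn n) :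
    ∫⁻ z, D (x - z) = ∫⁻ z, D z :=
  lintegral_sub_left_eq_self D x

lemma lintegral_sub_right {n : ℕ} (D : Rn n → ℝ≥0∞) (z : Rn n) :
    ∫⁻ x, D (x - z) = ∫⁻ x, D x :=
  lintegral_sub_right_eq_self D z

lemma lconv_sq_le {n : ℕ} {D h : Rn n → ℝ≥0∞} (hD : Measurable D) (hh : AEMeasurable h)
    (x : Rn n) : lconv D h x ^ 2 ≤ (∫⁻ z, D z) * ∫⁻ z, D (x - z) * h z ^ 2 := by
  rw [← lintegral_sub_left D x]
  exact lintegral_mul_sq_le (hD.comp (measurable_const.sub measurable_id)).aemeasurable hh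

/-- Schur's test. -/
lemma lintegral_mul_lconv_sq_le {n : ℕ} {D h ρ : Rn n → ℝ≥0∞} (hD : Measurable D)
    (hh : AEMeasurable h) (hρ : Measurable ρ) :
    ∫⁻ x, ρ x * lconv D h x ^ 2 ≤
      (∫⁻ z, D z) * ∫⁻ z, (∫⁻ x, ρ x * D (x - z)) * h z ^ 2 := by
  have hD2 : Measurable fun q : Rn n × Rn n => D (q.1 - q.2) :=
    hD.comp (measurable_fst.sub measurable_snd)
  have hm : AEMeasurable (Function.uncurry fun (x z : Rn n) => ρ x * (D (x - z) * h z ^ 2))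
      (volume.prod volume) :=
    (hρ.comp measurable_fst).aemeasurable.mul (hD2.aemeasurable.mul (hh.comp_snd.pow_const 2))
  have hm1 : AEMeasurable (fun x => ∫⁻ z, ρ x * (D (x - z) * h z ^ 2)) volume :=
    hm.lintegral_prod_right'
  calc ∫⁻ x, ρ x * lconv D h x ^ 2
      ≤ ∫⁻ x, (∫⁻ z, D z) * ∫⁻ z, ρ x * (D (x - z) * h z ^ 2) := by
        refine lintegral_mono fun x => ?_
        have hDx : Measurable fun z => D (x - z) := hD.comp (measurable_const.sub measurable_id)
        have hDx2 : AEMeasurable (fun z => D (x - z) * h z ^ 2) :=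
          hDx.aemeasurable.mul (hh.pow_const 2)
        rw [lintegral_const_mul'' _ hDx2, mul_left_comm]
        exact mul_le_mul_right (lconv_sq_le hD hh x) _
    _ = (∫⁻ z, D z) * ∫⁻ z, ∫⁻ x, ρ x * (D (x - z) * h z ^ 2) := by
        rw [lintegral_const_mul'' _ hm1, lintegral_lintegral_swap hm]
    _ = _ := by
        congr 2
        ext z
        have hDz : Measurable fun x => D (x - z) := hD.comp (measurable_id.sub measurable_const)
        have hDz2 : Measurable fun x => ρ x * D (x - z) := hρ.mul hDz
        rw [← lintegral_mul_const _ hDz2]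
        simp only [mul_assoc]

lemma lintegral_lconv_sq_le {n : ℕ} {D h : Rn n → ℝ≥0∞} (hD : Measurable D)
    (hh : AEMeasurable h) :
    ∫⁻ x, lconv D h x ^ 2 ≤ (∫⁻ z, D z) ^ 2 * ∫⁻ z, h z ^ 2 := by
  have h1 := lintegral_mul_lconv_sq_le hD hh (measurable_const (a := (1 : ℝ≥0∞)))
  simp only [one_mul, lintegral_sub_right D] at h1
  rwa [lintegral_const_mul'' _ (hh.pow_const 2), ← mul_assoc, ← sq] at h1

lemma measurable_lconv {n : ℕ} {D h : Rn n → ℝ≥0∞} (hD : Measurable D)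
    (hh : AEMeasurable h) : Measurable (lconv D h) := by
  have h1 : lconv D h = lconv D (hh.mk h) := by
    ext x
    refine lintegral_congr_ae ?_
    filter_upwards [hh.ae_eq_mk] with z hz
    rw [hz]
  rw [h1]
  exact Measurable.lintegral_prod_right'
    ((hD.comp (measurable_fst.sub measurable_snd)).mul (hh.measurable_mk.comp measurable_snd))

lemma enorm_kernelConv_le {n : ℕ} (k v : Rn n → ℂ) (x : Rn n) :
    ‖kernelConv k v x‖ₑ ≤ lconv (fun y => ‖k y‖ₑ) (fun z => ‖v z‖ₑ) x := by
  refine (enorm_integral_le_lintegral_enorm _).trans (le_of_eq ?_)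
  simp only [enorm_mul]
  rfl

lemma integrable_kernelConv {n : ℕ} {k v : Rn n → ℂ} (hk : Measurable k)
    (hv : AEStronglyMeasurable v) {x : Rn n}
    (h : lconv (fun y => ‖k y‖ₑ) (fun z => ‖v z‖ₑ) x < ∞) :
    Integrable fun z => k (x - z) * v z := by
  refine ⟨(hk.comp (measurable_const.sub measurable_id)).aestronglyMeasurable.mul hv, ?_⟩
  unfold HasFiniteIntegral
  simp only [enorm_mul]
  exact h

lemma aestronglyMeasurable_kernelConv {n : ℕ} {k v : Rn n → ℂ} (hk : Measurable k)
    (hv : AEStronglyMeasurable v) : AEStronglyMeasurable (kernelConv k v) := by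
  have h : AEStronglyMeasurable (fun q : Rn n × Rn n => k (q.1 - q.2) * v q.2)
      (volume.prod volume) :=
    (hk.comp (measurable_fst.sub measurable_snd)).aestronglyMeasurable.mul hv.comp_snd
  exact h.integral_prod_right'

lemma kernelConv_sub {n : ℕ} {k v w : Rn n → ℂ} {x : Rn n}
    (hv : Integrable fun z => k (x - z) * v z) (hw : Integrable fun z => k (x - z) * w z) :
    kernelConv k (fun z => v z - w z) x = kernelConv k v x - kernelConv k w x := by
  unfold kernelConv
  rw [← integral_sub hv hw]
  simp only [mul_sub]

/-- The convolution integral converges absolutely at almost every point, which is what makes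
`kernelConv` additive there. -/
lemma ae_lconv_lt_top {n : ℕ} {k v : Rn n → ℂ} (hk : Measurable k)
    (hk1 : ∫⁻ y, ‖k y‖ₑ < ∞) (hv : MemLp v 2 volume) :
    ∀ᵐ x, lconv (fun y => ‖k y‖ₑ) (fun z => ‖v z‖ₑ) x < ∞ := by
  have h2 : ∫⁻ z, ‖v z‖ₑ ^ 2 < ∞ := by
    rw [← eLpNorm_two_sq]
    exact ENNReal.pow_lt_top hv.2
  have h1 := (lintegral_lconv_sq_le hk.enorm hv.1.enorm).trans_lt
    (ENNReal.mul_lt_top (ENNReal.pow_lt_top hk1) h2)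
  filter_upwards [ae_lt_top ((measurable_lconv hk.enorm hv.1.enorm).pow_const 2) h1.ne] with x hx
  by_contra hc
  rw [not_lt, top_le_iff] at hc
  rw [hc] at hx
  simp at hx

/-- Young's inequality. -/
lemma eLpNorm_kernelConv_le {n : ℕ} {k v : Rn n → ℂ} (hk : Measurable k)
    (hv : AEStronglyMeasurable v) :
    eLpNorm (kernelConv k v) 2 volume ≤ (∫⁻ y, ‖k y‖ₑ) * eLpNorm v 2 volume := by
  have h : eLpNorm (kernelConv k v) 2 volume ^ 2 ≤ ((∫⁻ y, ‖k y‖ₑ) * eLpNorm v 2 volume) ^ 2 := by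
    rw [mul_pow, eLpNorm_two_sq, eLpNorm_two_sq]
    refine le_trans (lintegral_mono fun x => ?_) (lintegral_lconv_sq_le hk.enorm hv.enorm)
    exact pow_le_pow_left' (enorm_kernelConv_le k v x) 2
  exact (ENNReal.pow_le_pow_left_iff two_ne_zero).1 h

/-- The Bessel kernel as a complex-valued function. -/
def besselFun (n : ℕ) (s : ℝ) (x : Rn n) : ℂ := ((besselKernel n s x).toReal : ℂ)

lemma measurable_besselFun {n : ℕ} {s : ℝ} (hs : 0 < s) : Measurable (besselFun n s) :=
  Complex.measurable_ofReal.comp (measurable_besselKernel hs).ennreal_toReal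

/-- Only an inequality, because `toReal` sends to 0 the value ∞ that the kernel may take at the
origin. -/
lemma enorm_besselFun_le {n : ℕ} {s : ℝ} (x : Rn n) : ‖besselFun n s x‖ₑ ≤ besselKernel n s x := by
  rw [besselFun, ← ofReal_norm, Complex.norm_real, Real.norm_of_nonneg ENNReal.toReal_nonneg]
  exact ENNReal.ofReal_toReal_le

lemma lintegral_enorm_besselFun_le (n : ℕ) {s : ℝ} (hs : 0 < s) :
    ∫⁻ x : Rn n, ‖besselFun n s x‖ₑ ≤ 1 :=
  (lintegral_mono enorm_besselFun_le).trans (lintegral_besselKernel n hs).le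

lemma lintegral_enorm_besselFun_moment_lt_top (n : ℕ) {s : ℝ} (hs : 0 < s) (k : ℕ) :
    ∫⁻ x : Rn n, ENNReal.ofReal ((1 + ‖x‖) ^ k) * ‖besselFun n s x‖ₑ < ∞ :=
  (lintegral_mono fun x => mul_le_mul_right (enorm_besselFun_le x) _).trans_lt
    (lintegral_besselKernel_moment_lt_top n hs k)

/-! ### Passage from Schwartz functions to L². -/

lemma exists_schwartz_tendsto {n : ℕ} {h : Rn n → ℂ} (hh : MemLp h 2 volume) :
    ∃ φ : ℕ → 𝓢(Rn n, ℂ),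
      Tendsto (fun k => eLpNorm (fun x => φ k x - h x) 2 volume) atTop (𝓝 0) := by
  have hd := SchwartzMap.denseRange_toLpCLM (E := Rn n) (F := ℂ) (p := 2) (μ := volume)
    (by norm_num)
  have hex : ∀ k : ℕ, ∃ φ : 𝓢(Rn n, ℂ),
      eLpNorm (fun x => φ x - h x) 2 volume ≤ ENNReal.ofReal (1 / ((k : ℝ) + 1)) := by
    intro k
    obtain ⟨φ, hφ⟩ := hd.exists_dist_lt (hh.toLp h) (ε := 1 / ((k : ℝ) + 1)) (by positivity)
    refine ⟨φ, ?_⟩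
    rw [dist_comm, SchwartzMap.toLpCLM_apply, Lp.dist_def] at hφ
    have hcongr : (⇑(φ.toLp 2 volume) - ⇑(hh.toLp h)) =ᵐ[volume] fun x => φ x - h x := by
      filter_upwards [φ.coeFn_toLp 2 volume, hh.coeFn_toLp] with x h1 h2
      rw [Pi.sub_apply, h1, h2]
    rw [eLpNorm_congr_ae hcongr] at hφ
    refine ENNReal.le_ofReal_iff_toReal_le ?_ (by positivity) |>.2 hφ.le
    exact ((φ.memLp 2 volume).sub hh).eLpNorm_ne_top
  choose φ hφ using hex
  refine ⟨φ, tendsto_of_tendsto_of_tendsto_of_le_of_le tendsto_const_nhds ?_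
    (fun k => zero_le) hφ⟩
  have := ENNReal.tendsto_ofReal (tendsto_one_div_add_atTop_nhds_zero_nat (𝕜 := ℝ))
  simpa using this

/-- A Sobolev inequality for Schwartz functions extends to `L²`. -/
lemma eLpNorm_besselConv_le {n : ℕ} {s : ℝ} (hs : 0 < s) {q : ℝ≥0∞} {C : ℝ≥0}
    (hC : ∀ φ : 𝓢(Rn n, ℂ), eLpNorm (schwartzBessel n s φ) q volume ≤ C * eLpNorm φ 2 volume)
    {h : Rn n → ℂ} (hh : MemLp h 2 volume) :
    eLpNorm (kernelConv (besselFun n s) h) q volume ≤ C * eLpNorm h 2 volume := by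
  obtain ⟨φ, hφ⟩ := exists_schwartz_tendsto hh
  have hkm := measurable_besselFun (n := n) hs
  have hk1 := lintegral_enorm_besselFun_le n hs
  have hk1' := hk1.trans_lt ENNReal.one_lt_top
  have hconv : ∀ k, kernelConv (besselFun n s) (φ k) = schwartzBessel n s (φ k) := by
    intro k
    ext x
    exact (schwartzBessel_apply hs (φ k) x).symm
  have hL2 : Tendsto (fun k => eLpNorm (⇑(schwartzBessel n s (φ k)) -
      kernelConv (besselFun n s) h) 2 volume) atTop (𝓝 0) := by
    refine tendsto_of_tendsto_of_tendsto_of_le_of_le tendsto_const_nhds hφ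
      (fun k => zero_le) fun k => ?_
    have hφk := (φ k).memLp 2 volume
    have hae : (⇑(schwartzBessel n s (φ k)) - kernelConv (besselFun n s) h) =ᵐ[volume]
        kernelConv (besselFun n s) (fun x => φ k x - h x) := by
      filter_upwards [ae_lconv_lt_top hkm hk1' hφk, ae_lconv_lt_top hkm hk1' hh] with x h1 h2
      rw [kernelConv_sub (integrable_kernelConv hkm hφk.1 h1)
        (integrable_kernelConv hkm hh.1 h2), Pi.sub_apply, hconv]
    rw [eLpNorm_congr_ae hae]
    refine (eLpNorm_kernelConv_le hkm (hφk.1.sub hh.1)).trans ?_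
    exact mul_le_of_le_one_left' hk1
  -- Young's inequality gives L² convergence of the convolutions, hence almost everywhere
  -- convergence along a subsequence; Fatou's lemma then carries the L^q bound to the limit.
  obtain ⟨ns, hns, hae⟩ := (tendstoInMeasure_of_tendsto_eLpNorm (by norm_num)
    (fun k => (SchwartzMap.continuous _).aestronglyMeasurable)
    (aestronglyMeasurable_kernelConv hkm hh.1) hL2).exists_seq_tendsto_ae
  have hlim : Tendsto (fun k => C * eLpNorm (φ k) 2 volume) atTop (𝓝 (C * eLpNorm h 2 volume)) := by
    refine ENNReal.Tendsto.const_mul ?_ (Or.inr ENNReal.coe_ne_top)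
    have hle : ∀ k, eLpNorm (φ k) 2 volume ≤
        eLpNorm h 2 volume + eLpNorm (fun x => φ k x - h x) 2 volume := by
      intro k
      have := eLpNorm_add_le hh.1 (((φ k).memLp 2 volume).1.sub hh.1) (p := 2) (by norm_num)
      rw [add_sub_cancel] at this
      exact this
    have hge : ∀ k, eLpNorm h 2 volume - eLpNorm (fun x => φ k x - h x) 2 volume ≤
        eLpNorm (φ k) 2 volume := by
      intro k
      rw [tsub_le_iff_right]
      have := eLpNorm_sub_le ((φ k).memLp 2 volume).1 (((φ k).memLp 2 volume).1.sub hh.1)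
        (p := 2) (by norm_num)
      rw [sub_sub_cancel] at this
      exact this
    refine tendsto_of_tendsto_of_tendsto_of_le_of_le ?_ ?_ hge hle
    · have := ENNReal.Tendsto.sub (tendsto_const_nhds (x := eLpNorm h 2 volume)) hφ
        (Or.inl hh.2.ne)
      simpa using this
    · have := (tendsto_const_nhds (x := eLpNorm h 2 volume)).add hφ
      simpa using this
  calc eLpNorm (kernelConv (besselFun n s) h) q volume
      ≤ atTop.liminf fun k => eLpNorm (schwartzBessel n s (φ (ns k))) q volume :=
        Lp.eLpNorm_lim_le_liminf_eLpNorm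
          (fun k => (SchwartzMap.continuous _).aestronglyMeasurable) _ hae
    _ ≤ atTop.liminf fun k => C * eLpNorm (φ (ns k)) 2 volume :=
        liminf_le_liminf (Eventually.of_forall fun k => hC _)
    _ = C * eLpNorm h 2 volume := (hlim.comp hns.tendsto_atTop).liminf_eq

/-! ### Weighted estimates -/

lemma lintegral_le_tsum_shell {n : ℕ} [NeZero n] (F : Rn n → ℝ≥0∞) :
    ∫⁻ x, F x ≤ ∑' j : ℕ, ∫⁻ x in shell n (j + 1), F x := by
  have h : (⋃ j : ℕ, shell n (j + 1)) =ᵐ[volume] univ := by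
    rw [eventuallyEq_univ]
    filter_upwards [ae_mem_shell n] with x hx using mem_iUnion.2 hx
  rw [← setLIntegral_univ, ← setLIntegral_congr h]
  exact lintegral_iUnion_le _ _

lemma radius_succ (j : ℕ) : ((radius (j + 1) : ℝ≥0) : ℝ≥0∞) = 2 ^ j := by
  simp [radius]

lemma setLIntegral_shell_le {n : ℕ} (v : Rn n → ℂ) (j : ℕ) :
    ∫⁻ x in shell n (j + 1), ‖v x‖ₑ ^ 2 ≤ 2 ^ j * bDualENorm v ^ 2 := by
  have h1 : (radius (j + 1) : ℝ≥0∞) ^ (-(1 / 2) : ℝ) *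
      eLpNorm v 2 (volume.restrict (shell n (j + 1))) ≤ bDualENorm v :=
    le_iSup (fun j : ℕ => (radius (j + 1) : ℝ≥0∞) ^ (-(1 / 2) : ℝ) *
      eLpNorm v 2 (volume.restrict (shell n (j + 1)))) j
  have h2 := pow_le_pow_left' h1 2
  rw [mul_pow, eLpNorm_two_sq, radius_succ, ← ENNReal.rpow_natCast, ← ENNReal.rpow_mul,
    show -(1 / 2 : ℝ) * ((2 : ℕ) : ℝ) = -1 by norm_num, ENNReal.rpow_neg_one] at h2
  calc _ = 2 ^ j * ((2 ^ j)⁻¹ * ∫⁻ x in shell n (j + 1), ‖v x‖ₑ ^ 2) := by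
        rw [← mul_assoc, ENNReal.mul_inv_cancel (by positivity) (by finiteness), one_mul]
    _ ≤ _ := mul_le_mul_right h2 _

lemma pow_le_of_mem_shell {n j : ℕ} {x : Rn n} (hx : x ∈ shell n (j + 1)) :
    2 ^ j ≤ 2 * (1 + ‖x‖) := by
  have h := hx.1
  rw [Nat.add_sub_cancel] at h
  -- The innermost shell has inner radius 0, not 1/2; there the 1 in 1 + |x| does the work.
  cases j with
  | zero => simp only [pow_zero]; linarith [norm_nonneg x]
  | succ j =>
    simp only [radius, NNReal.coe_pow, NNReal.coe_ofNat] at h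
    rw [pow_succ]
    linarith

lemma norm_lt_of_mem_shell {n j : ℕ} {x : Rn n} (hx : x ∈ shell n (j + 1)) : ‖x‖ < 2 ^ j := by
  simpa [radius] using hx.2

/-- The weight `(1 + |z|)^{-2}`. -/
def weight {n : ℕ} (z : Rn n) : ℝ≥0∞ := ENNReal.ofReal ((1 + ‖z‖) ^ 2)⁻¹

lemma measurable_weight {n : ℕ} : Measurable (weight (n := n)) := by
  unfold weight
  fun_prop

/-- On the shell of outer radius 2^k the mass of |v|² is at most 2^k ‖v‖², and the factor is at most
min(1, 4 · 4^{j-k}). The shells k < j add up to at most 2^j, the others to at most 8 · 2^j. Without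
the truncation at 1 the bound would grow like 4^j. -/
lemma lintegral_mul_min_weight_le {n : ℕ} [NeZero n] (v : Rn n → ℂ) (j : ℕ) :
    ∫⁻ z, ‖v z‖ₑ ^ 2 * min 1 (4 ^ j * weight z) ≤ 9 * 2 ^ j * bDualENorm v ^ 2 := by
  set c : ℕ → ℝ≥0∞ := fun k => min 1 (4 ^ j * (4 * (4 ^ k)⁻¹)) with hc
  have h1 : ∀ k, ∫⁻ z in shell n (k + 1), ‖v z‖ₑ ^ 2 * min 1 (4 ^ j * weight z) ≤
      c k * 2 ^ k * bDualENorm v ^ 2 := by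
    intro k
    calc _ ≤ ∫⁻ z in shell n (k + 1), c k * ‖v z‖ₑ ^ 2 := by
          refine setLIntegral_mono' (measurableSet_shell n (k + 1)) fun z hz => ?_
          rw [mul_comm]
          refine mul_le_mul_left (min_le_min_left _ (mul_le_mul_right ?_ _)) _
          rw [weight, show (4 : ℝ≥0∞) * (4 ^ k)⁻¹ = ENNReal.ofReal (4 * (4 ^ k)⁻¹) by
            rw [ENNReal.ofReal_mul (by norm_num), ENNReal.ofReal_inv_of_pos (by positivity),
              ENNReal.ofReal_pow (by norm_num)]; simp]
          refine ENNReal.ofReal_le_ofReal ?_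
          rw [← div_eq_mul_inv, inv_le_comm₀ (by positivity) (by positivity), inv_div,
            div_le_iff₀ (by norm_num)]
          have := pow_le_pow_left₀ (by positivity) (pow_le_of_mem_shell hz) 2
          rw [← pow_mul, mul_comm k, pow_mul, mul_pow] at this
          norm_num at this
          linarith
      _ = c k * ∫⁻ z in shell n (k + 1), ‖v z‖ₑ ^ 2 :=
          lintegral_const_mul' _ _ (ne_top_of_le_ne_top ENNReal.one_ne_top (min_le_left _ _))
      _ ≤ c k * (2 ^ k * bDualENorm v ^ 2) := mul_le_mul_right (setLIntegral_shell_le v k) _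
      _ = _ := (mul_assoc _ _ _).symm
  have h2 : ∑' k, c k * 2 ^ k ≤ 9 * 2 ^ j := by
    rw [← Summable.sum_add_tsum_nat_add' (f := fun k => c k * 2 ^ k) (k := j) ENNReal.summable]
    have h3 : ∑ k ∈ Finset.range j, c k * 2 ^ k ≤ 2 ^ j := by
      calc ∑ k ∈ Finset.range j, c k * 2 ^ k ≤ ∑ k ∈ Finset.range j, (2 : ℝ≥0∞) ^ k :=
            Finset.sum_le_sum fun k _ => mul_le_of_le_one_left' (min_le_left _ _)
        _ ≤ 2 ^ j := by
            have : ∑ k ∈ Finset.range j, 2 ^ k ≤ 2 ^ j := by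
              have := Nat.geomSum_lt (m := 2) (n := j) (s := Finset.range j) le_rfl (by simp)
              exact this.le
            exact_mod_cast this
    have h4 : ∑' k, c (k + j) * 2 ^ (k + j) ≤ 8 * 2 ^ j := by
      calc ∑' k, c (k + j) * 2 ^ (k + j) ≤ ∑' k : ℕ, (4 * 2 ^ j) * (2⁻¹ : ℝ≥0∞) ^ k := by
            refine ENNReal.tsum_le_tsum fun k => ?_
            refine (mul_le_mul_left (min_le_right _ _) _).trans (le_of_eq ?_)
            rw [pow_add, pow_add, ENNReal.mul_inv (by simp) (by simp),
              show ((4 : ℝ≥0∞) ^ k)⁻¹ = (2⁻¹) ^ k * (2⁻¹) ^ k by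
                rw [← mul_pow, ← ENNReal.mul_inv (by simp) (by simp), ENNReal.inv_pow]; norm_num]
            have e1 : (4 : ℝ≥0∞) ^ j * (4 ^ j)⁻¹ = 1 :=
              ENNReal.mul_inv_cancel (by positivity) (by finiteness)
            have e2 : (2⁻¹ : ℝ≥0∞) ^ k * 2 ^ k = 1 := by
              rw [← mul_pow, ENNReal.inv_mul_cancel (by norm_num) (by norm_num), one_pow]
            calc (4 : ℝ≥0∞) ^ j * (4 * (2⁻¹ ^ k * 2⁻¹ ^ k * (4 ^ j)⁻¹)) * (2 ^ k * 2 ^ j)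
                = (4 ^ j * (4 ^ j)⁻¹) * (2⁻¹ ^ k * 2 ^ k) * (4 * 2 ^ j * 2⁻¹ ^ k) := by ring
              _ = _ := by rw [e1, e2, one_mul, one_mul]
        _ = 8 * 2 ^ j := by
            rw [ENNReal.tsum_mul_left, ENNReal.tsum_geometric]
            simp only [ENNReal.one_sub_inv_two, inv_inv]
            ring
    calc _ ≤ 2 ^ j + 8 * 2 ^ j := add_le_add h3 h4
      _ = 9 * 2 ^ j := by ring
  calc _ ≤ ∑' k, c k * 2 ^ k * bDualENorm v ^ 2 :=
        (lintegral_le_tsum_shell _).trans (ENNReal.tsum_le_tsum h1)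
    _ = (∑' k, c k * 2 ^ k) * bDualENorm v ^ 2 := ENNReal.tsum_mul_right
    _ ≤ _ := mul_le_mul_left h2 _

/-- The weighted integral `∫ (1 + |z|)^{-2} |v|²`. -/
def weightedSq {n : ℕ} (v : Rn n → ℂ) : ℝ≥0∞ := ∫⁻ z, weight z * ‖v z‖ₑ ^ 2

lemma weightedSq_le {n : ℕ} [NeZero n] (v : Rn n → ℂ) :
    weightedSq v ≤ 9 * bDualENorm v ^ 2 := by
  refine le_trans (le_of_eq ?_) ((lintegral_mul_min_weight_le v 0).trans (by simp))
  refine lintegral_congr fun z => ?_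
  rw [pow_zero, one_mul, min_eq_right, mul_comm]
  exact ENNReal.ofReal_le_one.2 (inv_le_one_of_one_le₀ (one_le_pow₀ (by linarith [norm_nonneg z])))

/-- The second moment `∫ (1 + |x|)² D(x)` of a kernel. -/
def secondMoment {n : ℕ} (D : Rn n → ℝ≥0∞) : ℝ≥0∞ :=
  ∫⁻ x, ENNReal.ofReal ((1 + ‖x‖) ^ 2) * D x

lemma lintegral_le_secondMoment {n : ℕ} (D : Rn n → ℝ≥0∞) : ∫⁻ x, D x ≤ secondMoment D := by
  refine lintegral_mono fun x => le_mul_of_one_le_left' ?_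
  rw [ENNReal.one_le_ofReal]
  exact one_le_pow₀ (by linarith [norm_nonneg x])

/-- Peetre's inequality 1 + |z| ≤ (1 + |x|)(1 + |x - z|), which moves the weight across a
convolution. -/
lemma weight_le {n : ℕ} (x z : Rn n) :
    weight x ≤ ENNReal.ofReal ((1 + ‖x - z‖) ^ 2) * weight z := by
  unfold weight
  rw [← ENNReal.ofReal_mul (by positivity)]
  refine ENNReal.ofReal_le_ofReal ?_
  rw [← div_eq_mul_inv, inv_le_comm₀ (by positivity) (by positivity), inv_div,
    div_le_iff₀ (by positivity), ← mul_pow]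
  refine pow_le_pow_left₀ (by positivity) ?_ 2
  have h := norm_sub_le x (x - z)
  rw [sub_sub_cancel] at h
  nlinarith [norm_nonneg x, norm_nonneg (x - z), mul_nonneg (norm_nonneg x) (norm_nonneg (x - z))]

/-- Schur's test with ρ the weight: by Peetre's inequality, the integral of weight(x) D(x - z) in x
is at most the second moment of D times weight(z). -/
lemma lintegral_weight_mul_lconv_sq_le {n : ℕ} {D : Rn n → ℝ≥0∞} (hD : Measurable D)
    {v : Rn n → ℂ} (hv : AEStronglyMeasurable v) :
    ∫⁻ x, weight x * lconv D (fun z => ‖v z‖ₑ) x ^ 2 ≤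
      (∫⁻ x, D x) * secondMoment D * weightedSq v := by
  refine (lintegral_mul_lconv_sq_le hD hv.enorm measurable_weight).trans ?_
  rw [mul_assoc]
  refine mul_le_mul_right ?_ _
  unfold weightedSq
  have hvm : AEMeasurable fun z => weight z * ‖v z‖ₑ ^ 2 :=
    measurable_weight.aemeasurable.mul (hv.enorm.pow_const 2)
  rw [← lintegral_const_mul'' _ hvm]
  refine lintegral_mono fun z => ?_
  rw [← mul_assoc]
  refine mul_le_mul_left ?_ _
  have hm : Measurable fun y : Rn n => ENNReal.ofReal ((1 + ‖y‖) ^ 2) * D y := by fun_prop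
  have hm1 : Measurable fun x => ENNReal.ofReal ((1 + ‖x - z‖) ^ 2) * D (x - z) :=
    hm.comp (measurable_id.sub measurable_const)
  rw [secondMoment, ← lintegral_sub_right (fun y => ENNReal.ofReal ((1 + ‖y‖) ^ 2) * D y) z,
    ← lintegral_mul_const _ hm1]
  refine lintegral_mono fun x => ?_
  calc weight x * D (x - z) ≤ ENNReal.ofReal ((1 + ‖x - z‖) ^ 2) * weight z * D (x - z) :=
        mul_le_mul_left (weight_le x z) _
    _ = _ := mul_right_comm _ _ _

lemma setLIntegral_ball_lconv_sq_le {n : ℕ} {D : Rn n → ℝ≥0∞} (hD : Measurable D)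
    {v : Rn n → ℂ} (hv : AEStronglyMeasurable v) {R : ℝ} (hR : 0 ≤ R) :
    ∫⁻ x in Metric.ball 0 R, lconv D (fun z => ‖v z‖ₑ) x ^ 2 ≤
      ENNReal.ofReal ((1 + R) ^ 2) * ((∫⁻ x, D x) * secondMoment D * weightedSq v) := by
  refine le_trans ?_ (mul_le_mul_right (lintegral_weight_mul_lconv_sq_le hD hv) _)
  rw [← lintegral_const_mul' _ _ ENNReal.ofReal_ne_top, ← lintegral_indicator measurableSet_ball]
  refine lintegral_mono fun x => ?_
  by_cases hx : x ∈ Metric.ball (0 : Rn n) R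
  · rw [indicator_of_mem hx, ← mul_assoc]
    refine le_mul_of_one_le_left' ?_
    rw [weight, ← ENNReal.ofReal_mul (by positivity), ENNReal.one_le_ofReal, ← div_eq_mul_inv,
      one_le_div (by positivity)]
    have : ‖x‖ < R := by simpa using hx
    gcongr
  · rw [indicator_of_notMem hx]
    exact zero_le

lemma secondMoment_besselFun_lt_top (n : ℕ) {s : ℝ} (hs : 0 < s) :
    secondMoment (fun x : Rn n => ‖besselFun n s x‖ₑ) < ∞ :=
  lintegral_enorm_besselFun_moment_lt_top n hs 2

lemma ae_lconv_lt_top_of_weightedSq {n : ℕ} {k v : Rn n → ℂ} (hk : Measurable k)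
    (hk2 : secondMoment (fun x => ‖k x‖ₑ) < ∞) (hv : AEStronglyMeasurable v)
    (hv2 : weightedSq v < ∞) :
    ∀ᵐ x, lconv (fun y => ‖k y‖ₑ) (fun z => ‖v z‖ₑ) x < ∞ := by
  have h1 := (lintegral_weight_mul_lconv_sq_le hk.enorm hv).trans_lt (ENNReal.mul_lt_top
    (ENNReal.mul_lt_top ((lintegral_le_secondMoment _).trans_lt hk2) hk2) hv2)
  filter_upwards [ae_lt_top (measurable_weight.mul
    ((measurable_lconv hk.enorm hv.enorm).pow_const 2)) h1.ne] with x hx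
  by_contra hc
  rw [not_lt, top_le_iff] at hc
  have h0 : weight x ≠ 0 := by
    rw [weight, Ne, ENNReal.ofReal_eq_zero, not_le]
    positivity
  rw [Pi.mul_apply, hc] at hx
  simp [h0] at hx

lemma memLpLoc_kernelConv {n : ℕ} {k v : Rn n → ℂ} (hk : Measurable k)
    (hk2 : secondMoment (fun x => ‖k x‖ₑ) < ∞) (hv : AEStronglyMeasurable v)
    (hv2 : weightedSq v < ∞) : MemLpLoc (kernelConv k v) 2 := by
  intro K hK
  obtain ⟨R, hR0, hR⟩ := hK.isBounded.subset_ball_lt 0 0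
  refine MemLp.mono_measure (Measure.restrict_mono hR le_rfl)
    ⟨(aestronglyMeasurable_kernelConv hk hv).restrict, ?_⟩
  have h2 := (setLIntegral_ball_lconv_sq_le hk.enorm hv hR0.le).trans_lt
    (ENNReal.mul_lt_top ENNReal.ofReal_lt_top (ENNReal.mul_lt_top
    (ENNReal.mul_lt_top ((lintegral_le_secondMoment _).trans_lt hk2) hk2) hv2))
  rw [eLpNorm_two_eq]
  refine ENNReal.rpow_lt_top_of_nonneg (by norm_num) (ne_top_of_le_ne_top h2.ne ?_)
  exact lintegral_mono fun x => pow_le_pow_left' (enorm_kernelConv_le k v x) 2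

/-! ### The inverse of `J_s` is convolution with the Bessel kernel -/

lemma besselFun_neg_sub {n : ℕ} {s : ℝ} (x z : Rn n) :
    besselFun n s (z - x) = besselFun n s (x - z) := by
  unfold besselFun besselKernel heatKernel
  simp only [norm_sub_rev]

lemma lintegral_norm_mul_schwartz_sq_lt_top {n : ℕ} (φ : 𝓢(Rn n, ℂ)) :
    ∫⁻ x, (ENNReal.ofReal (1 + ‖x‖) * ‖φ x‖ₑ) ^ 2 < ∞ := by
  set g : Rn n → ℂ := fun x => (((1 + ‖x‖ ^ 2) ^ (1 : ℝ) : ℝ) : ℂ) with hg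
  have hgt : g.HasTemperateGrowth := Function.HasTemperateGrowth.comp
    Function.Complex.hasTemperateGrowth_ofReal
    (Function.hasTemperateGrowth_one_add_norm_sq_rpow (Rn n) 1)
  set ψ := SchwartzMap.smulLeftCLM ℂ g φ with hψ
  have h1 : ∫⁻ x, 4 * ‖ψ x‖ₑ ^ 2 < ∞ := by
    rw [lintegral_const_mul _ (ψ.continuous.enorm.measurable.pow_const 2), ← eLpNorm_two_sq]
    exact ENNReal.mul_lt_top (by simp) (ENNReal.pow_lt_top (ψ.memLp 2 volume).2)
  refine (lintegral_mono fun x => ?_).trans_lt h1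
  rw [show (4 : ℝ≥0∞) = 2 ^ 2 by norm_num, ← mul_pow]
  refine pow_le_pow_left' ?_ 2
  rw [hψ, SchwartzMap.smulLeftCLM_apply_apply hgt, smul_eq_mul, enorm_mul, ← mul_assoc]
  refine mul_le_mul_left ?_ _
  rw [hg, ← ofReal_norm, Complex.norm_real, Real.rpow_one, Real.norm_of_nonneg (by positivity)]
  have h2 : (2 : ℝ≥0∞) * ENNReal.ofReal (1 + ‖x‖ ^ 2) = ENNReal.ofReal (2 * (1 + ‖x‖ ^ 2)) := by
    rw [ENNReal.ofReal_mul (by norm_num), ENNReal.ofReal_ofNat]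
  rw [h2]
  exact ENNReal.ofReal_le_ofReal (by nlinarith [sq_nonneg (‖x‖ - 1)])

lemma mul_le_sq_add_sq (a b : ℝ≥0∞) : a * b ≤ a ^ 2 + b ^ 2 := by
  rcases le_total a b with h | h
  · exact le_add_left ((mul_le_mul_left h b).trans (sq b).ge)
  · exact le_add_right ((mul_le_mul_right h a).trans (sq a).ge)

/-- Shift a factor 1 + |x| from the convolution to φ and use ab ≤ a² + b². This is the Fubini
hypothesis in `represents_kernelConv`. -/
lemma lintegral_schwartz_mul_lconv_lt_top {n : ℕ} (φ : 𝓢(Rn n, ℂ)) {D : Rn n → ℝ≥0∞}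
    (hD : Measurable D) (hD2 : secondMoment D < ∞) {v : Rn n → ℂ} (hv : AEStronglyMeasurable v)
    (hv2 : weightedSq v < ∞) :
    ∫⁻ x, ‖φ x‖ₑ * lconv D (fun z => ‖v z‖ₑ) x < ∞ := by
  have h1 : ∀ x, ‖φ x‖ₑ * lconv D (fun z => ‖v z‖ₑ) x ≤ (ENNReal.ofReal (1 + ‖x‖) * ‖φ x‖ₑ) ^ 2 +
      weight x * lconv D (fun z => ‖v z‖ₑ) x ^ 2 := by
    intro x
    have h2 : ENNReal.ofReal (1 + ‖x‖) * ENNReal.ofReal (1 + ‖x‖)⁻¹ = 1 := by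
      rw [← ENNReal.ofReal_mul (by positivity), mul_inv_cancel₀ (by positivity), ENNReal.ofReal_one]
    have h3 : weight x = ENNReal.ofReal (1 + ‖x‖)⁻¹ ^ 2 := by
      rw [weight, ← ENNReal.ofReal_pow (by positivity), inv_pow]
    rw [h3, ← mul_pow]
    refine le_trans (le_of_eq ?_) (mul_le_sq_add_sq _ _)
    rw [mul_mul_mul_comm, h2, one_mul]
  refine (lintegral_mono h1).trans_lt ?_
  have hm : Measurable fun x : Rn n => (ENNReal.ofReal (1 + ‖x‖) * ‖φ x‖ₑ) ^ 2 := by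
    have := φ.continuous.enorm.measurable
    fun_prop
  rw [lintegral_add_left hm]
  exact ENNReal.add_lt_top.2 ⟨lintegral_norm_mul_schwartz_sq_lt_top φ,
    (lintegral_weight_mul_lconv_sq_le hD hv).trans_lt (ENNReal.mul_lt_top
      (ENNReal.mul_lt_top ((lintegral_le_secondMoment _).trans_lt hD2) hD2) hv2)⟩

/-- The operator on distributions is defined by transposition, so φ is replaced by G * φ; Fubini and
the evenness of G move the convolution to v. With T = J_s f this gives f = G * J_s f. -/
lemma represents_kernelConv {n : ℕ} {s : ℝ} (hs : 0 < s) {T : 𝓢'(Rn n, ℂ)} {v : Rn n → ℂ}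
    (hv : AEStronglyMeasurable v) (hv2 : weightedSq v < ∞) (hT : Represents T v) :
    Represents (besselJ n (-s) T) (kernelConv (besselFun n s) v) := by
  intro φ
  have hk := measurable_besselFun (n := n) hs
  have hF : Integrable (Function.uncurry fun (x z : Rn n) => φ x * (besselFun n s (x - z) * v z))
      (volume.prod volume) := by
    have hm : AEStronglyMeasurable (Function.uncurry fun (x z : Rn n) =>
        φ x * (besselFun n s (x - z) * v z)) (volume.prod volume) :=
      (φ.continuous.comp continuous_fst).aestronglyMeasurable.mul
        ((hk.comp (measurable_fst.sub measurable_snd)).aestronglyMeasurable.mul hv.comp_snd)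
    refine ⟨hm, ?_⟩
    unfold HasFiniteIntegral
    rw [lintegral_prod _ hm.enorm]
    refine lt_of_eq_of_lt (lintegral_congr fun x => ?_) (lintegral_schwartz_mul_lconv_lt_top φ
      hk.enorm (secondMoment_besselFun_lt_top n hs) hv hv2)
    simp only [Function.uncurry, enorm_mul]
    exact lintegral_const_mul' _ _ enorm_ne_top
  have h1 : ∀ x, ∫ z, φ x * (besselFun n s (x - z) * v z) =
      φ x * kernelConv (besselFun n s) v x := fun x => integral_const_mul _ _
  constructor
  · have := hF.integral_prod_left
    simp only [Function.uncurry] at this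
    simpa only [h1] using this
  · have h2 : besselJ n (-s) T φ = T (schwartzBessel n s φ) := rfl
    rw [h2, (hT _).2, ← integral_congr_ae (ae_of_all _ h1), integral_integral_swap hF]
    congr 1
    ext z
    rw [schwartzBessel_apply hs, ← integral_mul_const]
    congr 1
    ext x
    change besselFun n s (z - x) * φ x * v z = _
    rw [besselFun_neg_sub]
    ring

/-! ### Local estimates -/

/-- The weight `(1 + |z|)^{-2(n+1)}`. -/
def tailWeight {n : ℕ} (z : Rn n) : ℝ≥0∞ := ENNReal.ofReal ((1 + ‖z‖) ^ (2 * (n + 1)))⁻¹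

lemma measurable_tailWeight {n : ℕ} : Measurable (tailWeight (n := n)) := by
  unfold tailWeight
  fun_prop

lemma lintegral_tailWeight_lt_top (n : ℕ) : ∫⁻ z : Rn n, tailWeight z < ∞ := by
  have h := integrable_one_add_norm (E := Rn n) (μ := volume) (r := 2 * ((n : ℝ) + 1))
    (by rw [finrank_euclideanSpace_fin]; have : (0 : ℝ) ≤ n := n.cast_nonneg; linarith)
  refine lt_of_eq_of_lt (lintegral_congr fun z => ?_) h.lintegral_lt_top
  rw [tailWeight, Real.rpow_neg (by positivity)]
  norm_cast

/-- The decay used in `localSq` is kept in two factors: one absorbs the growth of v in B*, the other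
is integrable over the centre y. -/
lemma weight_mul_tailWeight {n : ℕ} (z : Rn n) :
    weight z * tailWeight z = ENNReal.ofReal ((1 + ‖z‖) ^ (2 * (n + 2)))⁻¹ := by
  rw [weight, tailWeight, ← ENNReal.ofReal_mul (by positivity), ← mul_inv, ← pow_add]
  ring_nf

lemma weight_le_one {n : ℕ} (z : Rn n) : weight z ≤ 1 :=
  ENNReal.ofReal_le_one.2 (inv_le_one_of_one_le₀ (one_le_pow₀ (by linarith [norm_nonneg z])))

lemma add_sq_le_four_mul (a b : ℝ≥0∞) : (a + b) ^ 2 ≤ 4 * (a ^ 2 + b ^ 2) := by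
  rcases le_total a b with h | h
  · calc (a + b) ^ 2 ≤ (b + b) ^ 2 := pow_le_pow_left' (add_le_add_left h b) 2
      _ = 4 * b ^ 2 := by ring
      _ ≤ _ := mul_le_mul_right le_add_self _
  · calc (a + b) ^ 2 ≤ (a + a) ^ 2 := pow_le_pow_left' (add_le_add_right h a) 2
      _ = 4 * a ^ 2 := by ring
      _ ≤ _ := mul_le_mul_right le_self_add _

/-- The integral `∫ (1 + |z - y|)^{-2(n+2)} |v(z)|² dz`. -/
def localSq {n : ℕ} (v : Rn n → ℂ) (y : Rn n) : ℝ≥0∞ :=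
  ∫⁻ z, weight (z - y) * tailWeight (z - y) * ‖v z‖ₑ ^ 2

lemma setLIntegral_ball_le_localSq {n : ℕ} (v : Rn n → ℂ) (y : Rn n) :
    ∫⁻ z in Metric.ball y 2, ‖v z‖ₑ ^ 2 ≤ 3 ^ (2 * (n + 2)) * localSq v y := by
  unfold localSq
  rw [← lintegral_const_mul' _ _ (by finiteness), ← lintegral_indicator measurableSet_ball]
  refine lintegral_mono fun z => ?_
  by_cases hz : z ∈ Metric.ball y 2
  · rw [indicator_of_mem hz, weight_mul_tailWeight, ← mul_assoc]
    refine le_mul_of_one_le_left' ?_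
    have h3 : (3 : ℝ≥0∞) ^ (2 * (n + 2)) = ENNReal.ofReal (3 ^ (2 * (n + 2))) := by
      rw [ENNReal.ofReal_pow (by norm_num), ENNReal.ofReal_ofNat]
    rw [h3, ← ENNReal.ofReal_mul (by positivity), ENNReal.one_le_ofReal, ← div_eq_mul_inv,
      one_le_div (by positivity)]
    have : ‖z - y‖ < 2 := by simpa [dist_eq_norm] using hz
    exact pow_le_pow_left₀ (by positivity) (by linarith) _
  · rw [indicator_of_notMem hz]
    exact zero_le

/-- The contribution of the points far from the ball `B(y, 1/2)`. -/
lemma exists_lconv_far_sq_le (n : ℕ) {s : ℝ} (hs : 0 < s) :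
    ∃ C : ℝ≥0, ∀ v : Rn n → ℂ, AEStronglyMeasurable v → ∀ y x : Rn n, x ∈ Metric.ball y (1 / 2) →
      lconv (fun z => ‖besselFun n s z‖ₑ) (fun z => ‖(Metric.ball y 2)ᶜ.indicator v z‖ₑ) x ^ 2 ≤
        C * localSq v y := by
  -- The power |x|^{-2(n+2)} matches the weight in `localSq`.
  obtain ⟨C, hC⟩ := exists_besselKernel_le n (s := s) (n + 2)
    (by push_cast; have : (0 : ℝ) ≤ n := n.cast_nonneg; linarith)
  have hI := lintegral_tailWeight_lt_top n
  set I := ∫⁻ z : Rn n, tailWeight z with hIdef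
  refine ⟨(C * 2 ^ (2 * (n + 2))) ^ 2 * I.toNNReal, fun v hv y x hx => ?_⟩
  have hx' : ‖x - y‖ < 1 / 2 := by simpa [dist_eq_norm] using hx
  have h1 : lconv (fun z => ‖besselFun n s z‖ₑ) (fun z => ‖(Metric.ball y 2)ᶜ.indicator v z‖ₑ) x ≤
      (C * 2 ^ (2 * (n + 2)) : ℝ≥0) *
        ∫⁻ z, weight (z - y) * tailWeight (z - y) * ‖v z‖ₑ := by
    rw [← lintegral_const_mul' _ _ ENNReal.coe_ne_top]
    refine lintegral_mono fun z => ?_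
    simp only
    by_cases hz : z ∈ Metric.ball y 2
    · rw [indicator_of_notMem (show z ∉ (Metric.ball y 2)ᶜ from fun h => h hz)]
      simp
    · rw [indicator_of_mem (show z ∈ (Metric.ball y 2)ᶜ from hz), ← mul_assoc]
      refine mul_le_mul_left ?_ _
      have hz' : 2 ≤ ‖z - y‖ := by simpa [dist_eq_norm] using hz
      -- Here |x - z| ≥ |z - y| - 1/2, and this is at least (1 + |z - y|)/2 exactly when |z - y| ≥
      -- 2.
      have hxz : (1 + ‖z - y‖) / 2 ≤ ‖x - z‖ := by
        have := norm_sub_le_norm_sub_add_norm_sub z x y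
        rw [norm_sub_rev z x] at this
        linarith
      have hne : x - z ≠ 0 := norm_pos_iff.1 (by linarith)
      refine (enorm_besselFun_le _).trans ((hC _ hne).trans ?_)
      rw [weight_mul_tailWeight, ENNReal.coe_mul, mul_assoc]
      refine mul_le_mul_right ?_ _
      have h2 : ((2 ^ (2 * (n + 2)) : ℝ≥0) : ℝ≥0∞) = ENNReal.ofReal (2 ^ (2 * (n + 2))) := by
        rw [ENNReal.ofReal_pow (by norm_num), ENNReal.ofReal_ofNat]
        simp
      rw [h2, ← ENNReal.ofReal_mul (by positivity)]
      refine ENNReal.ofReal_le_ofReal ?_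
      rw [← div_eq_mul_inv, inv_le_comm₀ (by positivity) (by positivity), inv_div, ← div_pow]
      exact pow_le_pow_left₀ (by positivity) hxz _
  have hwm : AEMeasurable fun z => weight (z - y) * tailWeight (z - y) :=
    ((measurable_weight.comp (measurable_id.sub measurable_const)).mul
      (measurable_tailWeight.comp (measurable_id.sub measurable_const))).aemeasurable
  have h2 := lintegral_mul_sq_le hwm hv.enorm
  have h3 : ∫⁻ z, weight (z - y) * tailWeight (z - y) ≤ I := by
    rw [hIdef, ← lintegral_sub_right tailWeight y]
    exact lintegral_mono fun z => mul_le_of_le_one_left' (weight_le_one _)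
  refine (pow_le_pow_left' h1 2).trans ?_
  rw [mul_pow, ENNReal.coe_mul (_ ^ 2), ENNReal.coe_toNNReal hI.ne, mul_assoc, ENNReal.coe_pow]
  exact mul_le_mul_right (h2.trans (mul_le_mul_left h3 _)) _

/-- The part of v in B(y, 2) is in L² and the Sobolev inequality applies to it. The other part has a
convolution bounded pointwise on B(y, 1/2), by the decay of the kernel. -/
lemma exists_eLpNorm_ball_sq_le {n : ℕ} {s : ℝ} (hs : 0 < s) {q : ℝ≥0∞} (hq : 1 ≤ q)
    (hS : ∃ C : ℝ≥0, ∀ φ : 𝓢(Rn n, ℂ),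
      eLpNorm (schwartzBessel n s φ) q volume ≤ C * eLpNorm φ 2 volume) :
    ∃ C : ℝ≥0, ∀ v : Rn n → ℂ, MemLpLoc v 2 → weightedSq v < ∞ → ∀ y : Rn n,
      eLpNorm (kernelConv (besselFun n s) v) q (volume.restrict (Metric.ball y (1 / 2))) ^ 2 ≤
        C * localSq v y := by
  obtain ⟨C₁, hC₁⟩ := hS
  obtain ⟨C₂, hC₂⟩ := exists_lconv_far_sq_le n hs
  -- For q = ∞ the exponent is 0 by convention, so m = 1, as it should be.
  set m : ℝ≥0∞ := volume (Metric.ball (0 : Rn n) (1 / 2)) ^ (q.toReal⁻¹) with hm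
  have hmt : m ≠ ∞ := ENNReal.rpow_ne_top_of_nonneg (by positivity) measure_ball_lt_top.ne
  refine ⟨4 * (C₁ ^ 2 * 3 ^ (2 * (n + 2)) + C₂ * m.toNNReal ^ 2), fun v hv hv2 y => ?_⟩
  have hvm := hv.aestronglyMeasurable
  have hk := measurable_besselFun (n := n) hs
  set μ : Measure (Rn n) := volume.restrict (Metric.ball y (1 / 2)) with hμ
  set v₁ := (Metric.ball y 2).indicator v with hv₁
  set v₂ := (Metric.ball y 2)ᶜ.indicator v with hv₂
  have hv₁m : AEStronglyMeasurable v₁ := hvm.indicator measurableSet_ball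
  have hv₂m : AEStronglyMeasurable v₂ := hvm.indicator measurableSet_ball.compl
  have hle₁ : ∀ z, ‖v₁ z‖ₑ ≤ ‖v z‖ₑ := fun z => enorm_indicator_le_enorm_self v z
  have hle₂ : ∀ z, ‖v₂ z‖ₑ ≤ ‖v z‖ₑ := fun z => enorm_indicator_le_enorm_self v z
  have hsplit : kernelConv (besselFun n s) v =ᵐ[μ]
      kernelConv (besselFun n s) v₁ + kernelConv (besselFun n s) v₂ := by
    filter_upwards [ae_restrict_of_ae (ae_lconv_lt_top_of_weightedSq hk
      (secondMoment_besselFun_lt_top n hs) hvm hv2)] with x hx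
    have i₁ := integrable_kernelConv hk hv₁m
      ((lintegral_mono fun z => mul_le_mul_right (hle₁ z) _).trans_lt hx)
    have i₂ := integrable_kernelConv hk hv₂m
      ((lintegral_mono fun z => mul_le_mul_right (hle₂ z) _).trans_lt hx)
    rw [Pi.add_apply, kernelConv, kernelConv, kernelConv, ← integral_add i₁ i₂]
    congr 1
    ext z
    rw [← mul_add, hv₁, hv₂, ← Pi.add_apply, indicator_self_add_compl]
  have hnear : eLpNorm (kernelConv (besselFun n s) v₁) q μ ^ 2 ≤
      C₁ ^ 2 * 3 ^ (2 * (n + 2)) * localSq v y := by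
    have hL : MemLp v₁ 2 volume := by
      rw [hv₁, memLp_indicator_iff_restrict measurableSet_ball]
      exact (hv _ (isCompact_closedBall y 2)).mono_measure
        (Measure.restrict_mono Metric.ball_subset_closedBall le_rfl)
    have h1 : eLpNorm (kernelConv (besselFun n s) v₁) q μ ≤ C₁ * eLpNorm v₁ 2 volume :=
      (eLpNorm_mono_measure _ Measure.restrict_le_self).trans (eLpNorm_besselConv_le hs hC₁ hL)
    refine (pow_le_pow_left' h1 2).trans ?_
    rw [mul_pow, mul_assoc]
    refine mul_le_mul_right (le_trans (le_of_eq ?_) (setLIntegral_ball_le_localSq v y)) _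
    rw [← eLpNorm_two_sq, hv₁, eLpNorm_indicator_eq_eLpNorm_restrict measurableSet_ball]
  have hfar : eLpNorm (kernelConv (besselFun n s) v₂) q μ ^ 2 ≤
      C₂ * m ^ 2 * localSq v y := by
    set B : ℝ≥0∞ := (C₂ * localSq v y) ^ (1 / 2 : ℝ) with hB
    have hB2 : B ^ 2 = C₂ * localSq v y := by
      rw [hB, ← ENNReal.rpow_natCast, ← ENNReal.rpow_mul]
      simp
    have h1 : ∀ᵐ x ∂μ, ‖kernelConv (besselFun n s) v₂ x‖ₑ ≤ B := by
      refine (ae_restrict_iff' measurableSet_ball).2 (ae_of_all _ fun x hx => ?_)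
      refine (enorm_kernelConv_le _ _ _).trans ?_
      rw [← ENNReal.pow_le_pow_left_iff two_ne_zero, hB2]
      exact hC₂ v hvm y x hx
    have h2 := eLpNorm_le_of_ae_enorm_bound (p := q) h1
    rw [hμ, Measure.restrict_apply_univ, Measure.addHaar_ball_center, ← hm] at h2
    refine (pow_le_pow_left' h2 2).trans (le_of_eq ?_)
    rw [smul_eq_mul, mul_pow, hB2]
    ring
  rw [eLpNorm_congr_ae hsplit]
  refine (pow_le_pow_left' (eLpNorm_add_le (aestronglyMeasurable_kernelConv hk hv₁m).restrict
    (aestronglyMeasurable_kernelConv hk hv₂m).restrict hq) 2).trans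
    ((add_sq_le_four_mul _ _).trans ?_)
  push_cast
  rw [ENNReal.coe_toNNReal hmt, mul_assoc 4, add_mul]
  gcongr

/-! ### Estimates on dyadic shells -/

lemma tailWeight_sub_comm {n : ℕ} (y z : Rn n) : tailWeight (z - y) = tailWeight (y - z) := by
  unfold tailWeight
  rw [norm_sub_rev]

/-- Peetre's inequality with 1 + |y| ≤ 3 · 2^j, combined with the trivial bound 1 of the weight. -/
lemma weight_mul_tailWeight_le {n j : ℕ} {y z : Rn n} (hy : ‖y‖ < 2 ^ j + 1 / 2) :
    weight (z - y) * tailWeight (z - y) ≤ 9 * (min 1 (4 ^ j * weight z) * tailWeight (y - z)) := by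
  rw [tailWeight_sub_comm, ← mul_assoc]
  refine mul_le_mul_left ?_ _
  rcases min_choice 1 (4 ^ j * weight z) with h | h
  · rw [h, mul_one]
    exact (weight_le_one _).trans (by norm_num)
  · rw [h, ← mul_assoc]
    refine (weight_le (z - y) z).trans (mul_le_mul_left ?_ _)
    have h9 : (9 : ℝ≥0∞) * 4 ^ j = ENNReal.ofReal (9 * 4 ^ j) := by
      rw [ENNReal.ofReal_mul (by norm_num), ENNReal.ofReal_pow (by norm_num), ENNReal.ofReal_ofNat,
        ENNReal.ofReal_ofNat]
    rw [h9]
    refine ENNReal.ofReal_le_ofReal ?_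
    rw [sub_sub_cancel_left, norm_neg, show (9 : ℝ) * 4 ^ j = (3 * 2 ^ j) ^ 2 by
      rw [mul_pow, ← pow_mul, mul_comm j, pow_mul]; norm_num]
    have h1 : (1 : ℝ) ≤ 2 ^ j := one_le_pow₀ (by norm_num)
    exact pow_le_pow_left₀ (by positivity) (by linarith) 2

/-- After Tonelli the integral in y consumes only the tail weight. The remaining integral of |v|²
against the truncated weight grows like 2^j, the exact growth allowed by B*. -/
lemma setLIntegral_localSq_le {n : ℕ} [NeZero n] {v : Rn n → ℂ} (hv : AEStronglyMeasurable v)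
    (j : ℕ) :
    ∫⁻ y in Metric.ball 0 (2 ^ j + 1 / 2), localSq v y ≤
      81 * (∫⁻ z : Rn n, tailWeight z) * 2 ^ j * bDualENorm v ^ 2 := by
  have hm : AEMeasurable (Function.uncurry fun (y z : Rn n) =>
      weight (z - y) * tailWeight (z - y) * ‖v z‖ₑ ^ 2)
      ((volume.restrict (Metric.ball 0 (2 ^ j + 1 / 2))).prod volume) := by
    refine AEMeasurable.mul (Measurable.aemeasurable ?_) (hv.enorm.comp_snd.pow_const 2)
    exact (measurable_weight.comp (measurable_snd.sub measurable_fst)).mul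
      (measurable_tailWeight.comp (measurable_snd.sub measurable_fst))
  unfold localSq
  rw [lintegral_lintegral_swap hm]
  calc _ ≤ ∫⁻ z, 9 * (∫⁻ z : Rn n, tailWeight z) * (‖v z‖ₑ ^ 2 * min 1 (4 ^ j * weight z)) := by
        refine lintegral_mono fun z => ?_
        have hmz : Measurable fun y => weight (z - y) * tailWeight (z - y) :=
          (measurable_weight.comp (measurable_const.sub measurable_id)).mul
            (measurable_tailWeight.comp (measurable_const.sub measurable_id))
        have hmz2 : Measurable fun y => tailWeight (y - z) :=
          measurable_tailWeight.comp (measurable_id.sub measurable_const)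
        rw [lintegral_mul_const _ hmz, mul_comm (‖v z‖ₑ ^ 2), ← mul_assoc]
        refine mul_le_mul_left ?_ _
        calc _ ≤ ∫⁻ y in Metric.ball 0 (2 ^ j + 1 / 2),
              9 * (min 1 (4 ^ j * weight z) * tailWeight (y - z)) := by
              refine setLIntegral_mono' measurableSet_ball fun y hy => ?_
              exact weight_mul_tailWeight_le (by simpa using hy)
          _ ≤ ∫⁻ y, 9 * (min 1 (4 ^ j * weight z) * tailWeight (y - z)) :=
              lintegral_mono' Measure.restrict_le_self le_rfl
          _ = 9 * (min 1 (4 ^ j * weight z) * ∫⁻ y : Rn n, tailWeight y) := by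
              rw [lintegral_const_mul _ (hmz2.const_mul _), lintegral_const_mul _ hmz2,
                lintegral_sub_right tailWeight z]
          _ = _ := by ring
    _ = 9 * (∫⁻ z : Rn n, tailWeight z) * ∫⁻ z, ‖v z‖ₑ ^ 2 * min 1 (4 ^ j * weight z) := by
        refine lintegral_const_mul' _ _ (ENNReal.mul_ne_top (by norm_num)
          (lintegral_tailWeight_lt_top n).ne)
    _ ≤ 9 * (∫⁻ z : Rn n, tailWeight z) * (9 * 2 ^ j * bDualENorm v ^ 2) :=
        mul_le_mul_right (lintegral_mul_min_weight_le v j) _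
    _ = _ := by ring

/-- An integral over `S` is an average of integrals over the pieces of `S` in small balls. -/
lemma measure_ball_mul_setLIntegral {n : ℕ} {H : Rn n → ℝ≥0∞} (hH : AEMeasurable H)
    {S : Set (Rn n)} (hS : MeasurableSet S) (r : ℝ) :
    volume (Metric.ball (0 : Rn n) r) * ∫⁻ x in S, H x =
      ∫⁻ y, ∫⁻ x in S ∩ Metric.ball y r, H x := by
  have hset : MeasurableSet {q : Rn n × Rn n | dist q.2 q.1 < r} :=
    measurableSet_lt (measurable_snd.dist measurable_fst) measurable_const
  have hm : AEMeasurable (Function.uncurry fun (y x : Rn n) =>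
      {q : Rn n × Rn n | dist q.2 q.1 < r}.indicator (fun q => S.indicator H q.2) (y, x))
      (volume.prod volume) :=
    AEMeasurable.indicator ((hH.indicator hS).comp_snd) hset
  have h1 : ∀ y, ∫⁻ x in S ∩ Metric.ball y r, H x =
      ∫⁻ x, {q : Rn n × Rn n | dist q.2 q.1 < r}.indicator (fun q => S.indicator H q.2) (y, x) := by
    intro y
    rw [← lintegral_indicator (hS.inter measurableSet_ball), inter_comm, ← indicator_indicator]
    refine lintegral_congr fun x => ?_
    simp only [indicator, Metric.mem_ball, mem_ofPred_eq]
  rw [lintegral_congr h1, lintegral_lintegral_swap hm, ← lintegral_indicator hS,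
    ← lintegral_const_mul' _ _ measure_ball_lt_top.ne]
  refine lintegral_congr fun x => ?_
  have h2 : (fun y => {q : Rn n × Rn n | dist q.2 q.1 < r}.indicator
      (fun q => S.indicator H q.2) (y, x)) =
      (Metric.ball x r).indicator fun _ => S.indicator H x := by
    ext y
    simp only [indicator, Metric.mem_ball, mem_ofPred_eq, dist_comm x y]
  rw [h2, lintegral_indicator measurableSet_ball, setLIntegral_const,
    Measure.addHaar_ball_center volume x, mul_comm]

/-- The shell integral is an average of integrals over pieces of radius 1/2. On each, Hölder's
inequality with 1/p + 1/q = 1/2 separates W from the convolution; integrating the local bound over y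
gives the factor 2^{j/2}. -/
lemma exists_eLpNorm_shell_le {n : ℕ} [NeZero n] {s : ℝ} (hs : 0 < s) {p q : ℝ≥0∞}
    [ENNReal.HolderTriple p q 2] (hq : 1 ≤ q)
    (hS : ∃ C : ℝ≥0, ∀ φ : 𝓢(Rn n, ℂ),
      eLpNorm (schwartzBessel n s φ) q volume ≤ C * eLpNorm φ 2 volume) :
    ∃ C : ℝ≥0, ∀ v : Rn n → ℂ, MemBDual v → ∀ W : Rn n → ℝ, AEStronglyMeasurable W →
      ∀ (j : ℕ) (b : ℝ≥0∞), b ≠ ∞ → (∀ y ∈ shell n (j + 1),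
        eLpNorm W p (volume.restrict (shell n (j + 1) ∩ Metric.ball y 1)) ≤ b) →
      eLpNorm (fun x => (W x : ℂ) * kernelConv (besselFun n s) v x) 2
        (volume.restrict (shell n (j + 1))) ≤
        C * b * (2 ^ j : ℝ≥0∞) ^ (1 / 2 : ℝ) * bDualENorm v := by
  obtain ⟨C₀, hC₀⟩ := exists_eLpNorm_ball_sq_le hs hq hS
  set m := volume (Metric.ball (0 : Rn n) (1 / 2)) with hm
  have hm0 : m ≠ 0 := (Metric.measure_ball_pos volume 0 (by norm_num)).ne'
  have hmt : m ≠ ∞ := measure_ball_lt_top.ne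
  have hIt := lintegral_tailWeight_lt_top n
  set I := ∫⁻ z : Rn n, tailWeight z with hI
  set K : ℝ≥0∞ := m⁻¹ * (C₀ * (81 * I)) with hK
  have hKt : K ≠ ∞ := by finiteness
  refine ⟨(K ^ (1 / 2 : ℝ)).toNNReal, fun v hv W hW j b hb hWb => ?_⟩
  have hvm := hv.1.aestronglyMeasurable
  have hk := measurable_besselFun (n := n) hs
  have hv2 : weightedSq v < ∞ := (weightedSq_le v).trans_lt (by have := hv.2; finiteness)
  set u := kernelConv (besselFun n s) v with hu
  have hum : AEStronglyMeasurable u := aestronglyMeasurable_kernelConv hk hvm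
  set f : Rn n → ℂ := fun x => (W x : ℂ) * u x with hf
  have hfW : f = W • u := by
    ext x
    rw [hf, Pi.smul_apply', Complex.real_smul]
  have hfm : AEStronglyMeasurable f := by
    rw [hfW]
    exact hW.smul hum
  set S := shell n (j + 1) with hSdef
  have hSm : MeasurableSet S := measurableSet_shell n (j + 1)
  have hpt : ∀ y, ∫⁻ x in S ∩ Metric.ball y (1 / 2), ‖f x‖ₑ ^ 2 ≤
      (Metric.ball 0 (2 ^ j + 1 / 2)).indicator (fun y => b ^ 2 * C₀ * localSq v y) y := by
    intro y
    -- The bound on W is assumed only at centres in the shell. If the piece is nonempty, any of its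
    -- points y' is such a centre, and B(y, 1/2) lies in B(y', 1).
    rcases (S ∩ Metric.ball y (1 / 2)).eq_empty_or_nonempty with he | ⟨y', hy'S, hy'⟩
    · rw [he]
      simp
    · have hd : ‖y‖ < 2 ^ j + 1 / 2 := by
        have h1 := norm_lt_of_mem_shell hy'S
        have h2 : ‖y' - y‖ < 1 / 2 := by simpa [dist_eq_norm] using hy'
        have h3 := norm_sub_norm_le y y'
        rw [norm_sub_rev] at h3
        linarith
      rw [indicator_of_mem (by simpa using hd), ← eLpNorm_two_sq, hfW]
      have h4 : eLpNorm (W • u) 2 (volume.restrict (S ∩ Metric.ball y (1 / 2))) ≤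
          b * eLpNorm u q (volume.restrict (Metric.ball y (1 / 2))) := by
        refine (eLpNorm_smul_le_mul_eLpNorm (p := p) (q := q) hum.restrict hW.restrict).trans ?_
        refine mul_le_mul' ((eLpNorm_mono_measure _ (Measure.restrict_mono ?_ le_rfl)).trans
          (hWb y' hy'S)) (eLpNorm_mono_measure _ (Measure.restrict_mono inter_subset_right le_rfl))
        refine inter_subset_inter_right _ fun x hx => ?_
        rw [Metric.mem_ball] at hx hy' ⊢
        have := dist_triangle x y y'
        rw [dist_comm y] at this
        linarith
      refine (pow_le_pow_left' h4 2).trans ?_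
      rw [mul_pow, mul_assoc]
      exact mul_le_mul_right (hC₀ v hv.1 hv2 y) _
  have hmain : eLpNorm f 2 (volume.restrict S) ^ 2 ≤ K * b ^ 2 * 2 ^ j * bDualENorm v ^ 2 := by
    rw [eLpNorm_two_sq]
    have h1 : m * ∫⁻ x in S, ‖f x‖ₑ ^ 2 ≤ b ^ 2 * C₀ * (81 * I * 2 ^ j * bDualENorm v ^ 2) := by
      rw [hm, measure_ball_mul_setLIntegral (hfm.enorm.pow_const 2) hSm]
      refine (lintegral_mono hpt).trans ?_
      rw [lintegral_indicator measurableSet_ball, lintegral_const_mul' _ _ (by finiteness)]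
      exact mul_le_mul_right (setLIntegral_localSq_le hvm j) _
    calc ∫⁻ x in S, ‖f x‖ₑ ^ 2 = m⁻¹ * (m * ∫⁻ x in S, ‖f x‖ₑ ^ 2) := by
          rw [← mul_assoc, ENNReal.inv_mul_cancel hm0 hmt, one_mul]
      _ ≤ m⁻¹ * (b ^ 2 * C₀ * (81 * I * 2 ^ j * bDualENorm v ^ 2)) := mul_le_mul_right h1 _
      _ = _ := by
          rw [hK]
          ring
  rw [← ENNReal.pow_le_pow_left_iff two_ne_zero]
  refine hmain.trans (le_of_eq ?_)
  rw [ENNReal.coe_toNNReal (ENNReal.rpow_ne_top_of_nonneg (by norm_num) hKt)]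
  have h2 : ∀ y : ℝ≥0∞, (y ^ (1 / 2 : ℝ)) ^ 2 = y := fun y => by
    rw [← ENNReal.rpow_natCast, ← ENNReal.rpow_mul]
    simp
  simp only [mul_pow]
  rw [h2, h2]

/-! ### The bound from `B*` to `B` -/

/-- The two factors 2^{j/2}, from the shell estimate and from the norm of B, multiply to the 2^j of
the decay sum. It serves for V, giving continuity, and for V - W, giving the approximation;
restricting to the shell in the bound on W allows a different b on either side of a cut-off. -/
lemma exists_bENorm_le {n : ℕ} [NeZero n] {s : ℝ} (hs : 0 < s) {p q : ℝ≥0∞}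
    [ENNReal.HolderTriple p q 2] (hq : 1 ≤ q)
    (hS : ∃ C : ℝ≥0, ∀ φ : 𝓢(Rn n, ℂ),
      eLpNorm (schwartzBessel n s φ) q volume ≤ C * eLpNorm φ 2 volume) :
    ∃ C : ℝ≥0, ∀ v : Rn n → ℂ, MemBDual v → ∀ W : Rn n → ℝ, AEStronglyMeasurable W →
      ∀ b : ℕ → ℝ≥0∞, (∀ j, b j ≠ ∞) → (∀ j, ∀ y ∈ shell n (j + 1),
        eLpNorm W p (volume.restrict (shell n (j + 1) ∩ Metric.ball y 1)) ≤ b j) →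
      bENorm (fun x => (W x : ℂ) * kernelConv (besselFun n s) v x) ≤
        C * (∑' j, 2 ^ j * b j) * bDualENorm v := by
  obtain ⟨C, hC⟩ := exists_eLpNorm_shell_le hs hq hS (p := p)
  refine ⟨C, fun v hv W hW b hb hWb => ?_⟩
  unfold bENorm
  rw [← ENNReal.tsum_mul_left, ← ENNReal.tsum_mul_right]
  refine ENNReal.tsum_le_tsum fun j => ?_
  refine (mul_le_mul_right (hC v hv W hW j (b j) (hb j) (hWb j)) _).trans (le_of_eq ?_)
  have h1 : (2 ^ j : ℝ≥0∞) ^ (1 / 2 : ℝ) * (2 ^ j : ℝ≥0∞) ^ (1 / 2 : ℝ) = 2 ^ j := by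
    rw [← ENNReal.rpow_add_of_nonneg _ _ (by norm_num) (by norm_num)]
    norm_num
  rw [radius_succ]
  calc _ = C * (((2 ^ j : ℝ≥0∞) ^ (1 / 2 : ℝ) * (2 ^ j : ℝ≥0∞) ^ (1 / 2 : ℝ)) * b j) *
        bDualENorm v := by ring
    _ = _ := by rw [h1]

/-! ### Local norms of the potential and the choice of exponents. -/

lemma eLpNorm_translate {n : ℕ} (V : Rn n → ℝ) (hV : AEStronglyMeasurable V) (p : ℝ≥0∞)
    (y : Rn n) :
    eLpNorm (fun x => V (x + y)) p (volume.restrict (Metric.ball 0 1)) =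
      eLpNorm V p (volume.restrict (Metric.ball y 1)) := by
  have h := (measurePreserving_add_right (volume : Measure (Rn n)) y).restrict_preimage
    (measurableSet_ball (x := y) (ε := 1))
  have h2 : (fun x => x + y) ⁻¹' Metric.ball y 1 = Metric.ball 0 1 := by
    ext x
    simp [dist_eq_norm]
  rw [h2] at h
  exact eLpNorm_comp_measurePreserving hV.restrict h

lemma MemLpLoc.aestronglyMeasurable' {n : ℕ} {V : Rn n → ℝ} {p : ℝ≥0∞} (hV : MemLpLoc V p) :
    AEStronglyMeasurable V volume := by
  have h : AEStronglyMeasurable V (volume.restrict (⋃ k : ℕ, Metric.closedBall (0 : Rn n) k)) :=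
    AEStronglyMeasurable.iUnion fun k => (hV _ (isCompact_closedBall 0 (k : ℝ))).1
  rwa [Metric.iUnion_closedBall_nat, Measure.restrict_univ] at h

lemma MemLpLoc.mono_exponent {n : ℕ} {V : Rn n → ℝ} {p p' : ℝ≥0∞} (hV : MemLpLoc V p)
    (h : p' ≤ p) : MemLpLoc V p' := by
  intro K hK
  have : IsFiniteMeasure (volume.restrict K) := ⟨by simpa using hK.measure_lt_top⟩
  exact (hV K hK).mono_exponent h

lemma decaySum_mono {n : ℕ} {V : Rn n → ℝ} {p p' : ℝ≥0∞} (hV : AEStronglyMeasurable V)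
    (h : p' ≤ p) (hp0 : p' ≠ 0) (hfin : decaySum p V < ∞) : decaySum p' V < ∞ := by
  set m : ℝ≥0∞ := volume (Metric.ball (0 : Rn n) 1) ^ (1 / p'.toReal - 1 / p.toReal) with hm
  have hexp : 0 ≤ 1 / p'.toReal - 1 / p.toReal := by
    -- For p = ∞ the term 1 / `p.toReal` is 1/0 = 0, the correct exponent.
    by_cases hp : p = ∞
    · simp [hp]
    · have h1 := ENNReal.toReal_mono hp h
      have h2 : 0 < p'.toReal := ENNReal.toReal_pos hp0 (ne_top_of_le_ne_top hp h)
      have := one_div_le_one_div_of_le h2 h1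
      linarith
  have hmt : m ≠ ∞ := ENNReal.rpow_ne_top_of_nonneg hexp measure_ball_lt_top.ne
  refine lt_of_le_of_lt ?_ (ENNReal.mul_lt_top hfin hmt.lt_top)
  unfold decaySum
  rw [← ENNReal.tsum_mul_right]
  refine ENNReal.tsum_le_tsum fun j => ?_
  rw [mul_assoc]
  refine mul_le_mul_right (iSup₂_le fun y hy => ?_) _
  have hVy : AEStronglyMeasurable (fun x => V (x + y)) volume :=
    hV.comp_measurePreserving (measurePreserving_add_right (volume : Measure (Rn n)) y)
  refine (eLpNorm_le_eLpNorm_mul_rpow_measure_univ h hVy.restrict).trans ?_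
  rw [Measure.restrict_apply_univ, ← hm]
  exact mul_le_mul_left (le_iSup₂ (f := fun y (_ : y ∈ shell n (j + 1)) =>
    eLpNorm (fun x => V (x + y)) p (volume.restrict (Metric.ball 0 1))) y hy) _

/-- The data that a Sobolev embedding with finite exponent `p` provides for the potential. -/
lemma exists_exponents {n : ℕ} [NeZero n] {s : ℝ} (hs : 0 < s) {p : ℝ≥0∞}
    (hp : AdmissibleExponent n s p) {V : Rn n → ℝ} (hV : MemLpLoc V p)
    (hsum : decaySum p V < ∞) :
    ∃ p' q : ℝ≥0∞, 2 ≤ p' ∧ p' ≠ ∞ ∧ 1 ≤ q ∧ ENNReal.HolderTriple p' q 2 ∧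
      (∃ C : ℝ≥0, ∀ φ : 𝓢(Rn n, ℂ),
        eLpNorm (schwartzBessel n s φ) q volume ≤ C * eLpNorm φ 2 volume) ∧
      MemLpLoc V p' ∧ decaySum p' V < ∞ := by
  have hn : (0 : ℝ) < n := by exact_mod_cast Nat.pos_of_neZero n
  rcases lt_or_ge (n / 2 : ℝ) s with h | h
  · obtain rfl := hp.2.2 h
    exact ⟨2, ∞, le_rfl, by norm_num, le_top, ⟨by simp⟩, exists_eLpNorm_top_schwartzBessel_le n h,
      hV, hsum⟩
  -- P = n/s when s < n/2. When s = n/2 every P in (2, p] works: p itself if finite, and 4 if p = ∞,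
  -- since the approximation by bounded potentials needs a finite exponent.
  · obtain ⟨P, hP2, hPs, hPp⟩ : ∃ P : ℝ, 2 < P ∧ n / P ≤ s ∧ ENNReal.ofReal P ≤ p := by
      rcases h.lt_or_eq with h | h
      · refine ⟨n / s, ?_, ?_, (hp.1 h).ge⟩
        · rw [lt_div_iff₀ hs]
          linarith
        · rw [div_div_cancel₀ hn.ne']
      · have h2 := hp.2.1 h
        by_cases hpt : p = ∞
        · refine ⟨4, by norm_num, ?_, by simp [hpt]⟩
          rw [h]
          exact div_le_div_of_nonneg_left hn.le (by norm_num) (by norm_num)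
        · have h3 : 2 < p.toReal := by
            have := (ENNReal.toReal_lt_toReal (by norm_num) hpt).2 h2
            simpa using this
          refine ⟨p.toReal, h3, ?_, ENNReal.ofReal_toReal_le⟩
          rw [h]
          exact div_le_div_of_nonneg_left hn.le (by norm_num) h3.le
    have hP0 : 0 < P := by linarith
    have hP20 : 0 < P - 2 := by linarith
    -- Determined by 1/P + 1/Q = 1/2, which is also the Sobolev relation 1/Q = 1/2 - a/n for a =
    -- n/P.
    set Q : ℝ := 2 * P / (P - 2) with hQ
    have hQ2 : 2 < Q := by
      rw [hQ, lt_div_iff₀ hP20]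
      linarith
    refine ⟨ENNReal.ofReal P, ENNReal.ofReal Q, ?_, ENNReal.ofReal_ne_top, ?_, ⟨?_⟩, ?_,
      hV.mono_exponent hPp,
      decaySum_mono hV.aestronglyMeasurable' hPp (by simpa using hP0) hsum⟩
    · rw [show (2 : ℝ≥0∞) = ENNReal.ofReal 2 by simp]
      exact ENNReal.ofReal_le_ofReal hP2.le
    · rw [ENNReal.one_le_ofReal]
      linarith
    · rw [← ENNReal.ofReal_inv_of_pos hP0, ← ENNReal.ofReal_inv_of_pos (by linarith),
        ← ENNReal.ofReal_add (by positivity) (by positivity),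
        show (2 : ℝ≥0∞)⁻¹ = ENNReal.ofReal 2⁻¹ by
          rw [ENNReal.ofReal_inv_of_pos (by norm_num), ENNReal.ofReal_ofNat]]
      congr 1
      rw [hQ]
      field_simp
      ring
    · refine exists_eLpNorm_schwartzBessel_le n (a := n / P) (by positivity) hPs
        (div_lt_div_of_pos_left hn (by norm_num) hP2) hQ2 ?_
      rw [hQ]
      field_simp
      ring

/-! ### Completeness of `B` -/

/-- The weights are at least 1 and the ℓ² norm is at most the ℓ¹ norm. -/
lemma eLpNorm_le_bENorm {n : ℕ} [NeZero n] (u : Rn n → ℂ) : eLpNorm u 2 volume ≤ bENorm u := by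
  set e : ℕ → ℝ≥0∞ := fun j => eLpNorm u 2 (volume.restrict (shell n (j + 1))) with he
  have h1 : eLpNorm u 2 volume ^ 2 ≤ (∑' j, e j) ^ 2 := by
    rw [eLpNorm_two_sq]
    refine (lintegral_le_tsum_shell _).trans ?_
    rw [sq (∑' j, e j), ← ENNReal.tsum_mul_right]
    refine ENNReal.tsum_le_tsum fun j => ?_
    rw [← eLpNorm_two_sq, sq]
    exact mul_le_mul_right (ENNReal.le_tsum j) _
  refine ((ENNReal.pow_le_pow_left_iff two_ne_zero).1 h1).trans (ENNReal.tsum_le_tsum fun j => ?_)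
  refine le_mul_of_one_le_left' ?_
  rw [radius_succ]
  exact ENNReal.one_le_rpow (one_le_pow₀ (by norm_num)) (by norm_num)

/-- The norm of `B` is lower semicontinuous with respect to convergence in `L²`. -/
lemma bENorm_le_of_tendsto {n : ℕ} {w : ℕ → Rn n → ℂ} {g : Rn n → ℂ}
    (hw : ∀ k, AEStronglyMeasurable (w k)) (hg : AEStronglyMeasurable g) {ε : ℝ≥0∞}
    (hε : ∀ᶠ k in atTop, bENorm (w k) ≤ ε)
    (hlim : Tendsto (fun k => eLpNorm (w k - g) 2 volume) atTop (𝓝 0)) : bENorm g ≤ ε := by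
  unfold bENorm
  -- The weights are unbounded, so only finite partial sums are continuous for the L² norm.
  rw [ENNReal.tsum_eq_iSup_sum]
  refine iSup_le fun t => ?_
  set c : ℝ≥0∞ := ∑ j ∈ t, (radius (j + 1) : ℝ≥0∞) ^ (1 / 2 : ℝ) with hc
  have hct : c ≠ ∞ := by
    rw [hc]
    exact ENNReal.sum_ne_top.2 fun j _ =>
      ENNReal.rpow_ne_top_of_nonneg (by norm_num) ENNReal.coe_ne_top
  have h1 : Tendsto (fun k => ε + c * eLpNorm (w k - g) 2 volume) atTop (𝓝 ε) := by
    have := (tendsto_const_nhds (x := ε)).add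
      (ENNReal.Tendsto.const_mul hlim (Or.inr hct))
    simpa using this
  refine ge_of_tendsto h1 ?_
  filter_upwards [hε] with k hk
  have h2 : ∑ j ∈ t, (radius (j + 1) : ℝ≥0∞) ^ (1 / 2 : ℝ) *
      eLpNorm (w k) 2 (volume.restrict (shell n (j + 1))) ≤ ε :=
    (ENNReal.sum_le_tsum t).trans hk
  refine le_trans ?_ (add_le_add_left h2 _)
  rw [hc, Finset.sum_mul, ← Finset.sum_add_distrib]
  refine Finset.sum_le_sum fun j _ => ?_
  rw [← mul_add]
  refine mul_le_mul_right ?_ _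
  have h3 := eLpNorm_sub_le (hw k).restrict ((hw k).sub hg).restrict (p := 2)
    (μ := volume.restrict (shell n (j + 1))) (by norm_num)
  rw [sub_sub_cancel] at h3
  exact h3.trans (add_le_add_right (eLpNorm_mono_measure _ Measure.restrict_le_self) _)

/-- The element of `B` given by a function. -/
def BSpace.mk {n : ℕ} [NeZero n] (u : Rn n → ℂ) (hu : AEStronglyMeasurable u)
    (hB : bENorm u < ∞) : BSpace n :=
  ⟨AEEqFun.mk u hu, (memLp_congr_ae (AEEqFun.coeFn_mk u hu)).2
    ⟨hu, (eLpNorm_le_bENorm u).trans_lt hB⟩, by rwa [bENorm_congr (AEEqFun.coeFn_mk u hu)]⟩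

lemma BSpace.toFun_mk {n : ℕ} [NeZero n] {u : Rn n → ℂ} (hu : AEStronglyMeasurable u)
    (hB : bENorm u < ∞) : (BSpace.mk u hu hB).toFun =ᵐ[volume] u :=
  AEEqFun.coeFn_mk u hu

lemma BSpace.toFun_sub {n : ℕ} (u v : BSpace n) :
    (u - v).toFun =ᵐ[volume] u.toFun - v.toFun :=
  AEEqFun.coeFn_sub u.1 v.1

lemma BSpace.aestronglyMeasurable {n : ℕ} (u : BSpace n) : AEStronglyMeasurable u.toFun :=
  AEEqFun.aestronglyMeasurable u.1

lemma BSpace.bENorm_lt_top {n : ℕ} (u : BSpace n) : bENorm u.toFun < ∞ := u.2.2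

lemma BSpace.ofReal_norm {n : ℕ} (u : BSpace n) : ENNReal.ofReal ‖u‖ = bENorm u.toFun :=
  ENNReal.ofReal_toReal u.bENorm_lt_top.ne

lemma BSpace.ofReal_dist {n : ℕ} [NeZero n] (u v : BSpace n) :
    ENNReal.ofReal (dist u v) = bENorm (u.toFun - v.toFun) := by
  rw [dist_eq_norm]
  exact (BSpace.ofReal_norm (u - v)).trans (bENorm_congr (BSpace.toFun_sub u v))

/-- A Cauchy sequence of B has a limit g in L². Lower semicontinuity applied to u_k - u_l as l → ∞
shows that it converges to g in B. -/
instance (n : ℕ) [NeZero n] : CompleteSpace (BSpace n) := by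
  refine Metric.complete_of_cauchySeq_tendsto fun u hu => ?_
  have hu2 : ∀ k, MemLp (u k).toFun 2 volume := fun k => (u k).2.1
  have hdist : ∀ k l, ENNReal.ofReal (dist ((hu2 k).toLp _) ((hu2 l).toLp _)) ≤
      ENNReal.ofReal (dist (u k) (u l)) := by
    intro k l
    rw [BSpace.ofReal_dist, ← edist_dist, Lp.edist_toLp_toLp]
    exact eLpNorm_le_bENorm _
  have hc : CauchySeq fun k => (hu2 k).toLp (u k).toFun := by
    rw [Metric.cauchySeq_iff] at hu ⊢
    intro ε hε
    obtain ⟨N, hN⟩ := hu ε hε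
    exact ⟨N, fun k hk l hl => ((ENNReal.ofReal_le_ofReal_iff dist_nonneg).1
      (hdist k l)).trans_lt (hN k hk l hl)⟩
  obtain ⟨g, hg⟩ := cauchySeq_tendsto_of_complete hc
  have hgm : AEStronglyMeasurable (g : Rn n → ℂ) volume := Lp.aestronglyMeasurable g
  have hlim : Tendsto (fun k => eLpNorm ((u k).toFun - (g : Rn n → ℂ)) 2 volume) atTop (𝓝 0) := by
    have h1 := (tendsto_iff_edist_tendsto_0).1 hg
    refine h1.congr fun k => ?_
    rw [Lp.edist_def]
    refine eLpNorm_congr_ae ?_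
    filter_upwards [(hu2 k).coeFn_toLp] with x hx
    rw [Pi.sub_apply, Pi.sub_apply, hx]
  have hkey : ∀ ε > 0, ∃ N, ∀ k ≥ N, bENorm ((u k).toFun - (g : Rn n → ℂ)) ≤ ENNReal.ofReal ε := by
    intro ε hε
    obtain ⟨N, hN⟩ := Metric.cauchySeq_iff.1 hu ε hε
    refine ⟨N, fun k hk => ?_⟩
    refine bENorm_le_of_tendsto (w := fun l => (u k).toFun - (u l).toFun)
      (fun l => (u k).aestronglyMeasurable.sub (u l).aestronglyMeasurable)
      ((u k).aestronglyMeasurable.sub hgm) ?_ ?_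
    · filter_upwards [eventually_ge_atTop N] with l hl
      rw [← BSpace.ofReal_dist]
      exact ENNReal.ofReal_le_ofReal (hN k hk l hl).le
    · refine hlim.congr fun l => ?_
      rw [sub_sub_sub_cancel_left, ← eLpNorm_neg, neg_sub]
  obtain ⟨N, hN⟩ := hkey 1 one_pos
  have hgB : bENorm (g : Rn n → ℂ) < ∞ := by
    have h1 : (g : Rn n → ℂ) = (u N).toFun + -((u N).toFun - (g : Rn n → ℂ)) := by
      rw [neg_sub, add_sub_cancel]
    have h2 : bENorm (-((u N).toFun - (g : Rn n → ℂ))) = bENorm ((u N).toFun - (g : Rn n → ℂ)) := by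
      unfold bENorm
      simp only [eLpNorm_neg]
    rw [h1]
    refine (bENorm_add_le (u N).aestronglyMeasurable
      ((u N).aestronglyMeasurable.sub hgm).neg).trans_lt ?_
    rw [h2]
    exact ENNReal.add_lt_top.2 ⟨(u N).bENorm_lt_top, (hN N le_rfl).trans_lt ENNReal.ofReal_lt_top⟩
  refine ⟨BSpace.mk g hgm hgB, Metric.tendsto_atTop.2 fun ε hε => ?_⟩
  obtain ⟨M, hM⟩ := hkey (ε / 2) (half_pos hε)
  refine ⟨M, fun k hk => lt_of_le_of_lt ?_ (half_lt_self hε)⟩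
  rw [← ENNReal.ofReal_le_ofReal_iff (half_pos hε).le, BSpace.ofReal_dist]
  refine le_trans (le_of_eq (bENorm_congr ?_)) (hM k hk)
  filter_upwards [BSpace.toFun_mk hgm hgB] with x hx
  rw [Pi.sub_apply, Pi.sub_apply, hx]

/-! ### Finite rank approximation -/

/-- Density of C_c in L¹, applied to (1 + |x|)² k; the approximant is then divided by the weight. -/
lemma exists_continuous_secondMoment_sub_le {n : ℕ} {k : Rn n → ℂ} (hk : Measurable k)
    (hk2 : secondMoment (fun x => ‖k x‖ₑ) < ∞) {δ : ℝ≥0∞} (hδ : δ ≠ 0) :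
    ∃ g : Rn n → ℂ, Continuous g ∧ HasCompactSupport g ∧
      secondMoment (fun x => ‖k x - g x‖ₑ) ≤ δ := by
  have hw : Continuous fun x : Rn n => (((1 + ‖x‖) ^ 2 : ℝ) : ℂ) := by fun_prop
  have hw0 : ∀ x : Rn n, (((1 + ‖x‖) ^ 2 : ℝ) : ℂ) ≠ 0 := fun x => by
    rw [Complex.ofReal_ne_zero]
    positivity
  have hwe : ∀ x : Rn n, ‖(((1 + ‖x‖) ^ 2 : ℝ) : ℂ)‖ₑ = ENNReal.ofReal ((1 + ‖x‖) ^ 2) := by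
    intro x
    rw [← ofReal_norm, Complex.norm_real, Real.norm_of_nonneg (by positivity)]
  have hm : MemLp (fun x => (((1 + ‖x‖) ^ 2 : ℝ) : ℂ) * k x) 1 volume := by
    refine ⟨(hw.measurable.mul hk).aestronglyMeasurable, ?_⟩
    rw [eLpNorm_one_eq_lintegral_enorm]
    refine lt_of_le_of_lt (le_of_eq (lintegral_congr fun x => ?_)) hk2
    rw [enorm_mul, hwe]
  obtain ⟨g, hgs, hgle, hgc, -⟩ :=
    hm.exists_hasCompactSupport_eLpNorm_sub_le (by norm_num) hδ
  refine ⟨fun x => (((1 + ‖x‖) ^ 2 : ℝ) : ℂ)⁻¹ * g x, (hw.inv₀ hw0).mul hgc, hgs.mul_left, ?_⟩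
  rw [eLpNorm_one_eq_lintegral_enorm] at hgle
  refine le_trans (le_of_eq (lintegral_congr fun x => ?_)) hgle
  rw [← hwe, ← enorm_mul, mul_sub, mul_inv_cancel_left₀ (hw0 x), Pi.sub_apply]

lemma sq_setLIntegral_ball_enorm_le {n : ℕ} {v : Rn n → ℂ} (hv : AEStronglyMeasurable v)
    {ρ : ℝ} (hρ : 0 ≤ ρ) :
    (∫⁻ z in Metric.ball 0 ρ, ‖v z‖ₑ) ^ 2 ≤
      volume (Metric.ball (0 : Rn n) ρ) * (ENNReal.ofReal ((1 + ρ) ^ 2) * weightedSq v) := by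
  have h1 := lintegral_mul_sq_le (μ := volume.restrict (Metric.ball (0 : Rn n) ρ))
    (f := fun _ => 1) (g := fun z => ‖v z‖ₑ) aemeasurable_const hv.restrict.enorm
  simp only [one_mul, lintegral_const, Measure.restrict_apply_univ] at h1
  refine h1.trans (mul_le_mul_right ?_ _)
  unfold weightedSq
  rw [← lintegral_const_mul' _ _ ENNReal.ofReal_ne_top]
  refine (setLIntegral_mono' measurableSet_ball fun z hz => ?_).trans
    (setLIntegral_le_lintegral _ _)
  rw [← mul_assoc]
  refine le_mul_of_one_le_left' ?_
  rw [mem_ball_zero_iff] at hz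
  unfold weight
  rw [← ENNReal.ofReal_mul (by positivity), ENNReal.one_le_ofReal, ← div_eq_mul_inv,
    one_le_div (by positivity)]
  gcongr

/-- A fixed ball meets finitely many shells, so for potentials of compact support the errors can be
measured in L². -/
lemma exists_bENorm_le_eLpNorm (n J : ℕ) :
    ∃ C : ℝ≥0, ∀ u : Rn n → ℂ, (∀ x ∉ Metric.ball 0 (2 ^ J), u x = 0) →
      bENorm u ≤ C * eLpNorm u 2 volume := by
  have hr : ∀ j, (radius (j + 1) : ℝ≥0∞) ^ (1 / 2 : ℝ) ≠ ∞ := fun j =>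
    ENNReal.rpow_ne_top_of_nonneg (by norm_num) ENNReal.coe_ne_top
  have hC : ∑ j ∈ Finset.range (J + 1), (radius (j + 1) : ℝ≥0∞) ^ (1 / 2 : ℝ) ≠ ∞ :=
    ENNReal.sum_ne_top.2 fun j _ => hr j
  refine ⟨(∑ j ∈ Finset.range (J + 1), (radius (j + 1) : ℝ≥0∞) ^ (1 / 2 : ℝ)).toNNReal,
    fun u hu => ?_⟩
  rw [ENNReal.coe_toNNReal hC, Finset.sum_mul]
  unfold bENorm
  rw [tsum_eq_sum (s := Finset.range (J + 1))]
  · exact Finset.sum_le_sum fun j _ =>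
      mul_le_mul_right (eLpNorm_mono_measure _ Measure.restrict_le_self) _
  · intro j hj
    have hj' : J < j := by simpa using hj
    obtain ⟨i, rfl⟩ := Nat.exists_eq_add_of_lt hj'
    have h0 : u =ᵐ[volume.restrict (shell n (J + i + 1 + 1))] 0 := by
      refine (ae_restrict_iff' (measurableSet_shell _ _)).2 (Eventually.of_forall fun x hx => ?_)
      refine hu x fun hx2 => ?_
      have h1 : (2 : ℝ) ^ (J + i) < ‖x‖ := by simpa [radius] using hx.1
      have h2 : ‖x‖ < 2 ^ J := mem_ball_zero_iff.1 hx2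
      have h3 : (2 : ℝ) ^ J ≤ 2 ^ (J + i) := pow_le_pow_right₀ (by norm_num) (by lia)
      linarith
    rw [eLpNorm_congr_ae h0, eLpNorm_zero, mul_zero]

/-- A bound for convolutions with bounded, compactly supported kernels. -/
lemma lconv_le_of_support {n : ℕ} {D h : Rn n → ℝ≥0∞} {m : ℝ≥0} {r ρ : ℝ} {x : Rn n}
    (hD : ∀ y, D y ≤ m) (hs : ∀ y ∉ Metric.ball 0 r, D y = 0) (hx : ‖x‖ + r ≤ ρ) :
    lconv D h x ≤ m * ∫⁻ z in Metric.ball 0 ρ, h z := by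
  have h1 : lconv D h x = ∫⁻ z in Metric.ball 0 ρ, D (x - z) * h z := by
    refine (setLIntegral_eq_of_support_subset fun z hz => ?_).symm
    by_contra hz2
    refine hz ?_
    change D (x - z) * h z = 0
    rw [hs, zero_mul]
    intro h3
    rw [mem_ball_zero_iff] at h3 hz2
    have := norm_sub_norm_le z x
    rw [norm_sub_rev] at this
    linarith
  rw [h1]
  exact (lintegral_mono fun z => mul_le_mul_left (hD _) _).trans
    (lintegral_const_mul' _ _ ENNReal.coe_ne_top).le

/-- The number 9 is the bound of `weightedSq_le` on the unit ball of B*; the point is that B does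
not depend on v. -/
lemma exists_setLIntegral_ball_le (n : ℕ) :
    ∃ B : ℝ → ℝ≥0, ∀ ρ, 0 ≤ ρ → ∀ v : Rn n → ℂ, AEStronglyMeasurable v → weightedSq v ≤ 9 →
      ∫⁻ z in Metric.ball 0 ρ, ‖v z‖ₑ ≤ B ρ := by
  set A : ℝ → ℝ≥0∞ := fun ρ =>
    volume (Metric.ball (0 : Rn n) ρ) * (ENNReal.ofReal ((1 + ρ) ^ 2) * 9) with hA
  have hAt : ∀ ρ, A ρ ^ (1 / 2 : ℝ) ≠ ∞ := fun ρ => by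
    refine ENNReal.rpow_ne_top_of_nonneg (by norm_num) (ENNReal.mul_ne_top ?_ ?_)
    · exact measure_ball_lt_top.ne
    · exact ENNReal.mul_ne_top ENNReal.ofReal_ne_top (by norm_num)
  refine ⟨fun ρ => (A ρ ^ (1 / 2 : ℝ)).toNNReal, fun ρ hρ v hv hv2 => ?_⟩
  rw [ENNReal.coe_toNNReal (hAt ρ), ← ENNReal.pow_le_pow_left_iff two_ne_zero,
    ← ENNReal.rpow_natCast (A ρ ^ (1 / 2 : ℝ)), ← ENNReal.rpow_mul]
  norm_num
  exact (sq_setLIntegral_ball_enorm_le hv hρ).trans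
    (mul_le_mul_right (mul_le_mul_right hv2 _) _)

lemma integrable_kernelConv_of_support {n : ℕ} {g v : Rn n → ℂ} (hg : Continuous g) {m : ℝ≥0}
    {r : ℝ} (hm : ∀ y, ‖g y‖ₑ ≤ m) (hs : ∀ y ∉ Metric.ball 0 r, g y = 0)
    (hv : AEStronglyMeasurable v) (hv2 : ∀ ρ, ∫⁻ z in Metric.ball 0 ρ, ‖v z‖ₑ < ∞) (x : Rn n) :
    Integrable fun z => g (x - z) * v z := by
  refine integrable_kernelConv hg.measurable hv ((lconv_le_of_support (D := fun y => ‖g y‖ₑ)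
    (h := fun z => ‖v z‖ₑ) (r := r) hm (fun y hy => ?_) le_rfl).trans_lt
    (ENNReal.mul_lt_top ENNReal.coe_lt_top (hv2 _)))
  simp [hs y hy]

/-- Equicontinuity of g * v: the difference is the convolution of v with w ↦ g(w) - g(w - (x - y)),
which is bounded by ω and supported in the ball of radius r + 1. -/
lemma enorm_kernelConv_sub_le {n : ℕ} {g v : Rn n → ℂ} (hg : Continuous g) {m : ℝ≥0}
    {r : ℝ} (hm : ∀ y, ‖g y‖ₑ ≤ m) (hs : ∀ y ∉ Metric.ball 0 r, g y = 0)
    (hv : AEStronglyMeasurable v) (hv2 : ∀ ρ, ∫⁻ z in Metric.ball 0 ρ, ‖v z‖ₑ < ∞)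
    {ω : ℝ≥0} {x y : Rn n} (hω : ∀ z, ‖g (x - z) - g (y - z)‖ₑ ≤ ω) {ρ : ℝ}
    (hxy : dist x y ≤ 1) (hx : ‖x‖ + (r + 1) ≤ ρ) :
    ‖kernelConv g v x - kernelConv g v y‖ₑ ≤ ω * ∫⁻ z in Metric.ball 0 ρ, ‖v z‖ₑ := by
  set k : Rn n → ℂ := fun w => g w - g (w - (x - y)) with hk
  have hkx : ∀ z, k (x - z) = g (x - z) - g (y - z) := fun z => by
    simp only [hk]
    rw [show x - z - (x - y) = y - z by abel]
  have h1 : kernelConv g v x - kernelConv g v y = kernelConv k v x := by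
    unfold kernelConv
    rw [← integral_sub (integrable_kernelConv_of_support hg hm hs hv hv2 x)
      (integrable_kernelConv_of_support hg hm hs hv hv2 y)]
    simp only [hkx, sub_mul]
  rw [h1]
  refine (enorm_kernelConv_le k v x).trans (lconv_le_of_support (fun w => ?_) (fun w hw => ?_) hx)
  · have := hω (x - w)
    rwa [← hkx, sub_sub_cancel] at this
  · rw [mem_ball_zero_iff, not_lt] at hw
    have h2 : g w = 0 := hs w (by rw [mem_ball_zero_iff]; linarith)
    have h3 : g (w - (x - y)) = 0 := by
      refine hs _ ?_
      rw [mem_ball_zero_iff]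
      have := norm_sub_norm_le w (x - y)
      rw [dist_eq_norm] at hxy
      linarith
    simp [hk, h2, h3]

/-- Finitely many points of a dense sequence form a net of the ball. The nearest-point map is
measurable with finite range; its fibres replace a partition into small cells. -/
lemma exists_measurable_finite_approx {n : ℕ} {R η : ℝ} (hη : 0 < η) :
    ∃ P : SimpleFunc (Rn n) (Rn n), ∀ x ∈ Metric.ball (0 : Rn n) R, dist x (P x) < η := by
  obtain ⟨t, ht⟩ := (isCompact_closedBall (0 : Rn n) R).elim_finite_subcover
    (fun i : ℕ => Metric.ball (TopologicalSpace.denseSeq (Rn n) i) η)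
    (fun i => Metric.isOpen_ball) fun x _ => by
      obtain ⟨i, hi⟩ := (TopologicalSpace.denseRange_denseSeq (Rn n)).exists_dist_lt x hη
      exact mem_iUnion.2 ⟨i, hi⟩
  refine ⟨SimpleFunc.nearestPt (TopologicalSpace.denseSeq (Rn n)) (t.sup id), fun x hx => ?_⟩
  obtain ⟨i, hi, hxi⟩ := mem_iUnion₂.1 (ht (Metric.ball_subset_closedBall hx))
  have h1 := SimpleFunc.edist_nearestPt_le (TopologicalSpace.denseSeq (Rn n)) x
    (Finset.le_sup (f := id) hi)
  rw [edist_dist, edist_dist, ENNReal.ofReal_le_ofReal_iff dist_nonneg, id_eq] at h1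
  rw [Metric.mem_ball, dist_comm] at hxi
  rw [dist_comm]
  exact h1.trans_lt hxi

/-- The product of a bounded potential of compact support and a convolution operator is a limit
of operators of finite rank. -/
lemma exists_finite_rank_approx {n : ℕ} {k : Rn n → ℂ} (hk : Measurable k)
    (hk2 : secondMoment (fun x => ‖k x‖ₑ) < ∞) {W : Rn n → ℝ} (hW : Measurable W) {M : ℝ≥0}
    (hM : ∀ x, ‖W x‖ₑ ≤ M) {J : ℕ} (hWs : ∀ x ∉ Metric.ball 0 (2 ^ J), W x = 0) {ε : ℝ≥0∞}
    (hε : ε ≠ 0) :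
    ∃ (S : Finset (Rn n)) (ψ : Rn n → Rn n → ℂ) (L : Rn n → ℝ≥0),
      (∀ y, AEStronglyMeasurable (ψ y) ∧ bENorm (ψ y) < ∞) ∧
      ∀ v : Rn n → ℂ, AEStronglyMeasurable v → weightedSq v ≤ 9 →
        ∃ c : Rn n → ℂ, (∀ y, ‖c y‖ₑ ≤ L y) ∧
          bENorm (fun x => (W x : ℂ) * kernelConv k v x - ∑ y ∈ S, c y * ψ y x) ≤ ε := by
  obtain ⟨C, hC⟩ := exists_bENorm_le_eLpNorm n J
  obtain ⟨B, hB⟩ := exists_setLIntegral_ball_le n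
  have hWe : ∀ x, ‖(W x : ℂ)‖ₑ ≤ M := fun x => by
    have := hM x
    rwa [← ofReal_norm, ← Complex.norm_real, ofReal_norm] at this
  have hWc : Measurable fun x => (W x : ℂ) := Complex.measurable_ofReal.comp hW
  have hε2 : ε / 2 ≠ 0 := (ENNReal.half_pos hε).ne'
  -- The error of replacing k by g is at most a δ; the 3 is the square root of the bound 9.
  set a : ℝ≥0∞ := C * (M * ENNReal.ofReal (1 + 2 ^ J) * 3) with ha
  have hat : a ≠ ∞ := ENNReal.mul_ne_top ENNReal.coe_ne_top (ENNReal.mul_ne_top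
    (ENNReal.mul_ne_top ENNReal.coe_ne_top ENNReal.ofReal_ne_top) (by norm_num))
  obtain ⟨δ, hδ0, hδ⟩ := ENNReal.exists_nnreal_pos_mul_lt hat hε2
  obtain ⟨g, hgc, hgs, hgδ⟩ := exists_continuous_secondMoment_sub_le hk hk2
    (ENNReal.coe_ne_zero.2 hδ0.ne')
  obtain ⟨m', hm'⟩ := hgc.bounded_above_of_compact_support hgs
  set m : ℝ≥0 := m'.toNNReal
  have hm : ∀ y, ‖g y‖ₑ ≤ m := fun y => by
    rw [← ofReal_norm]
    exact ENNReal.ofReal_le_ofReal (hm' y)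
  obtain ⟨r, hr0, hr⟩ := hgs.isCompact.isBounded.subset_ball_lt 0 0
  have hgr : ∀ y ∉ Metric.ball 0 r, g y = 0 := fun y hy =>
    image_eq_zero_of_notMem_tsupport fun h => hy (hr h)
  -- For x in the support of W, a kernel supported in the ball of radius r + 1 sees v only inside
  -- the ball of radius ρ.
  set ρ : ℝ := 2 ^ J + (r + 1) with hρ
  have hρ0 : 0 ≤ ρ := by positivity
  set b : ℝ≥0∞ := C * (volume (Metric.ball (0 : Rn n) (2 ^ J)) ^ (2 : ℝ≥0∞).toReal⁻¹ *
    (M * B ρ)) with hb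
  have hbt : b ≠ ∞ := ENNReal.mul_ne_top ENNReal.coe_ne_top (ENNReal.mul_ne_top
    (ENNReal.rpow_ne_top_of_nonneg (by norm_num) measure_ball_lt_top.ne)
    (ENNReal.mul_ne_top ENNReal.coe_ne_top ENNReal.coe_ne_top))
  obtain ⟨ω, hω0, hω⟩ := ENNReal.exists_nnreal_pos_mul_lt hbt hε2
  obtain ⟨η, hη0, hη⟩ := Metric.uniformContinuous_iff.1
    (hgs.uniformContinuous_of_continuous hgc) ω (NNReal.coe_pos.2 hω0)
  obtain ⟨P, hP⟩ := exists_measurable_finite_approx (n := n) (R := 2 ^ J) (lt_min hη0 one_pos)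
  -- W cut to the cell of points sent to y. The coefficient will be the value of g * v at y, so the
  -- sum is W times g * v frozen on each cell.
  set ψ : Rn n → Rn n → ℂ := fun y x => if P x = y then (W x : ℂ) else 0 with hψ
  have hψm : ∀ y, Measurable (ψ y) := fun y =>
    Measurable.ite (P.measurableSet_fiber y) hWc measurable_const
  have hψ0 : ∀ y, ∀ x ∉ Metric.ball 0 (2 ^ J), ψ y x = 0 := fun y x hx => by
    simp [hψ, hWs x hx]
  refine ⟨P.range, ψ, fun y => m * B (‖y‖ + r), fun y => ⟨(hψm y).aestronglyMeasurable, ?_⟩, ?_⟩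
  · refine (hC _ (hψ0 y)).trans_lt (ENNReal.mul_lt_top ENNReal.coe_lt_top ?_)
    rw [← eLpNorm_restrict_eq_of_support_subset (s := Metric.ball 0 (2 ^ J)) fun x hx => by
      by_contra h
      exact hx (hψ0 y x h)]
    refine (eLpNorm_le_of_ae_enorm_bound (C := M)
      (Eventually.of_forall fun x => ?_)).trans_lt ?_
    · simp only [hψ]
      split_ifs
      · exact hWe x
      · simp
    · rw [Measure.restrict_apply_univ]
      exact ENNReal.mul_lt_top ENNReal.coe_lt_top
        (ENNReal.rpow_lt_top_of_nonneg (by norm_num) measure_ball_lt_top.ne)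
  intro v hv hv9
  have hv9t : weightedSq v < ∞ := hv9.trans_lt (by norm_num)
  have hvt : ∀ ρ, ∫⁻ z in Metric.ball 0 ρ, ‖v z‖ₑ < ∞ := fun ρ =>
    (lintegral_mono_set (Metric.ball_subset_ball (le_abs_self ρ))).trans_lt
      ((hB |ρ| (abs_nonneg _) v hv hv9).trans_lt ENNReal.coe_lt_top)
  refine ⟨kernelConv g v, fun y => ?_, ?_⟩
  · refine (enorm_kernelConv_le g v y).trans ((lconv_le_of_support (r := r)
      (ρ := ‖y‖ + r) (m := m) hm (fun z hz => ?_) le_rfl).trans ?_)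
    · simp [hgr z hz]
    · rw [ENNReal.coe_mul]
      exact mul_le_mul_right (hB _ (by positivity) v hv hv9) _
  set F₁ : Rn n → ℂ := fun x => (W x : ℂ) * (kernelConv k v x - kernelConv g v x) with hF₁
  set F₂ : Rn n → ℂ := fun x => (W x : ℂ) * (kernelConv g v x - kernelConv g v (P x)) with hF₂
  have hsum : (fun x => (W x : ℂ) * kernelConv k v x - ∑ y ∈ P.range, kernelConv g v y * ψ y x) =
      F₁ + F₂ := by
    ext x
    have h1 : ∑ y ∈ P.range, kernelConv g v y * ψ y x = kernelConv g v (P x) * W x := by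
      simp only [hψ, mul_ite, mul_zero]
      rw [Finset.sum_ite_eq, if_pos (P.mem_range_self x)]
    rw [h1, Pi.add_apply, hF₁, hF₂]
    ring
  have hgm := aestronglyMeasurable_kernelConv hgc.measurable hv
  have hPm : Measurable fun x => kernelConv g v (P x) :=
    (P.map (kernelConv g v)).measurable
  rw [hsum, ← ENNReal.add_halves ε]
  refine (bENorm_add_le (hWc.aestronglyMeasurable.mul
    ((aestronglyMeasurable_kernelConv hk hv).sub hgm)) (hWc.aestronglyMeasurable.mul
    (hgm.sub hPm.aestronglyMeasurable))).trans (add_le_add ?_ ?_)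
  · have h0 : ∀ x ∉ Metric.ball 0 (2 ^ J), F₁ x = 0 := fun x hx => by simp [hF₁, hWs x hx]
    refine (hC _ h0).trans (le_trans ?_ hδ.le)
    rw [ha, mul_comm (δ : ℝ≥0∞), mul_assoc]
    refine mul_le_mul_right ?_ _
    rw [← eLpNorm_restrict_eq_of_support_subset (s := Metric.ball 0 (2 ^ J)) fun x hx => by
      by_contra h
      exact hx (h0 x h), ← ENNReal.pow_le_pow_left_iff two_ne_zero, eLpNorm_two_sq]
    set D : Rn n → ℝ≥0∞ := fun x => ‖k x - g x‖ₑ with hD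
    have hDm : Measurable D := (hk.sub hgc.measurable).enorm
    have h1 : ∀ᵐ x, ‖F₁ x‖ₑ ^ 2 ≤ (M : ℝ≥0∞) ^ 2 * lconv D (fun z => ‖v z‖ₑ) x ^ 2 := by
      filter_upwards [ae_lconv_lt_top_of_weightedSq hk hk2 hv hv9t] with x hx
      have h2 : kernelConv k v x - kernelConv g v x = kernelConv (fun y => k y - g y) v x := by
        unfold kernelConv
        rw [← integral_sub (integrable_kernelConv hk hv hx)
          (integrable_kernelConv_of_support hgc hm hgr hv hvt x)]
        simp only [sub_mul]
      simp only [hF₁]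
      rw [← mul_pow, h2, enorm_mul]
      exact pow_le_pow_left' (mul_le_mul' (hWe x) (enorm_kernelConv_le _ _ _)) 2
    refine (lintegral_mono_ae (ae_restrict_of_ae h1)).trans ?_
    rw [lintegral_const_mul' _ _ (by finiteness)]
    have h3 := setLIntegral_ball_lconv_sq_le hDm hv (R := 2 ^ J) (by positivity)
    refine (mul_le_mul_right (h3.trans (mul_le_mul_right (mul_le_mul'
      (mul_le_mul' ((lintegral_le_secondMoment D).trans hgδ) hgδ) hv9) _)) _).trans (le_of_eq ?_)
    rw [ENNReal.ofReal_pow (by positivity)]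
    ring
  · have h0 : ∀ x ∉ Metric.ball 0 (2 ^ J), F₂ x = 0 := fun x hx => by simp [hF₂, hWs x hx]
    refine (hC _ h0).trans (le_trans ?_ hω.le)
    rw [hb, mul_comm (ω : ℝ≥0∞), mul_assoc]
    refine mul_le_mul_right ?_ _
    rw [← eLpNorm_restrict_eq_of_support_subset (s := Metric.ball 0 (2 ^ J)) fun x hx => by
      by_contra h
      exact hx (h0 x h)]
    refine (eLpNorm_le_of_ae_enorm_bound (C := M * (ω * B ρ))
      ((ae_restrict_iff' measurableSet_ball).2 (Eventually.of_forall fun x hx => ?_))).trans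
      (le_of_eq ?_)
    · simp only [hF₂]
      rw [enorm_mul]
      have hxP := hP x hx
      rw [mem_ball_zero_iff] at hx
      refine mul_le_mul' (hWe x) ((enorm_kernelConv_sub_le hgc hm hgr hv hvt (ω := ω)
        (ρ := ρ) (fun z => ?_) (hxP.le.trans (min_le_right _ _)) (by linarith)).trans
        (mul_le_mul_right (hB ρ hρ0 v hv hv9) _))
      have h3 : dist (x - z) (P x - z) < η := by
        rw [dist_sub_right]
        exact hxP.trans_le (min_le_left _ _)
      have h4 := hη h3
      rw [dist_eq_norm] at h4
      rw [← ofReal_norm, ← ENNReal.ofReal_coe_nnreal]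
      exact ENNReal.ofReal_le_ofReal h4.le
    · rw [Measure.restrict_apply_univ, smul_eq_mul]
      ring

/-! ### The multiplication operator -/

lemma BSpace.ext_ae {n : ℕ} {u v : BSpace n} (h : u.toFun =ᵐ[volume] v.toFun) : u = v :=
  Subtype.ext (AEEqFun.ext h)

lemma BSpace.toFun_add {n : ℕ} (u v : BSpace n) :
    (u + v).toFun =ᵐ[volume] u.toFun + v.toFun :=
  AEEqFun.coeFn_add u.1 v.1

lemma BSpace.toFun_smul {n : ℕ} (c : ℂ) (u : BSpace n) :
    (c • u).toFun =ᵐ[volume] c • u.toFun :=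
  AEEqFun.coeFn_smul c u.1

lemma BSpace.toFun_sum {n : ℕ} {ι : Type*} (S : Finset ι) (u : ι → BSpace n) :
    (∑ i ∈ S, u i).toFun =ᵐ[volume] fun x => ∑ i ∈ S, (u i).toFun x := by
  classical
  induction S using Finset.induction_on with
  | empty =>
    simp only [Finset.sum_empty]
    exact AEEqFun.coeFn_zero
  | insert i S hi ih =>
    rw [Finset.sum_insert hi]
    filter_upwards [BSpace.toFun_add (u i) (∑ i ∈ S, u i), ih] with x hx hx2
    rw [hx, Pi.add_apply, hx2, Finset.sum_insert hi]

/-- The function `(I - Δ)^{-s/2} v` which represents the element `f` of `B_s*` with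
`v = (I - Δ)^{s/2} f`. -/
def BsDual.potential {n : ℕ} {s : ℝ} (f : BsDual n s) : Rn n → ℂ :=
  kernelConv (besselFun n s) f.density

lemma BsDual.weightedSq_lt_top {n : ℕ} [NeZero n] {s : ℝ} (f : BsDual n s) :
    weightedSq f.density < ∞ :=
  (weightedSq_le _).trans_lt
    (ENNReal.mul_lt_top (by norm_num) (ENNReal.pow_lt_top f.memBDual_density.2))

lemma BsDual.memLpLoc_potential {n : ℕ} [NeZero n] {s : ℝ} (hs : 0 < s) (f : BsDual n s) :
    MemLpLoc f.potential 2 :=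
  memLpLoc_kernelConv (measurable_besselFun hs) (secondMoment_besselFun_lt_top n hs)
    f.memBDual_density.1.aestronglyMeasurable f.weightedSq_lt_top

lemma BsDual.represents_potential {n : ℕ} [NeZero n] {s : ℝ} (hs : 0 < s) (f : BsDual n s) :
    Represents f.toDistribution f.potential := by
  have h := represents_kernelConv hs f.memBDual_density.1.aestronglyMeasurable
    f.weightedSq_lt_top f.represents_density
  rwa [besselJ_neg_besselJ] at h

/-- The density is a choice and need not be additive pointwise; uniqueness of the representing
function restores additivity almost everywhere. -/
lemma BsDual.potential_add {n : ℕ} [NeZero n] {s : ℝ} (hs : 0 < s) (f g : BsDual n s) :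
    (f + g).potential =ᵐ[volume] f.potential + g.potential :=
  ((f + g).represents_potential hs).unique
    ((f.represents_potential hs).add (g.represents_potential hs))
    ((f + g).memLpLoc_potential hs).locallyIntegrable
    ((f.memLpLoc_potential hs).locallyIntegrable.add (g.memLpLoc_potential hs).locallyIntegrable)

lemma BsDual.potential_smul {n : ℕ} [NeZero n] {s : ℝ} (hs : 0 < s) (c : ℂ) (f : BsDual n s) :
    (c • f).potential =ᵐ[volume] c • f.potential :=
  ((c • f).represents_potential hs).unique ((f.represents_potential hs).const_smul c)
    ((c • f).memLpLoc_potential hs).locallyIntegrable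
    ((f.memLpLoc_potential hs).locallyIntegrable.smul c)

lemma BsDual.ofReal_norm {n : ℕ} {s : ℝ} (f : BsDual n s) :
    ENNReal.ofReal ‖f‖ = bDualENorm f.density :=
  ENNReal.ofReal_toReal f.memBDual_density.2.ne

lemma exists_multiplication {n : ℕ} [NeZero n] {s : ℝ} (hs : 0 < s) {V : Rn n → ℝ}
    (hV : AEStronglyMeasurable V) {C : ℝ≥0}
    (hC : ∀ f : BsDual n s,
      bENorm (fun x => (V x : ℂ) * f.potential x) ≤ C * bDualENorm f.density) :
    ∃ T : BsDual n s →L[ℂ] BSpace n,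
      ∀ f, (T f).toFun =ᵐ[volume] fun x => (V x : ℂ) * f.potential x := by
  have hm : ∀ f : BsDual n s, AEStronglyMeasurable fun x => (V x : ℂ) * f.potential x :=
    fun f => (Complex.continuous_ofReal.comp_aestronglyMeasurable hV).mul
      (f.memLpLoc_potential hs).aestronglyMeasurable
  have hf : ∀ f : BsDual n s, bENorm (fun x => (V x : ℂ) * f.potential x) < ∞ := fun f =>
    (hC f).trans_lt (ENNReal.mul_lt_top ENNReal.coe_lt_top f.memBDual_density.2)
  have ht := fun f : BsDual n s => BSpace.toFun_mk (hm f) (hf f)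
  let T : BsDual n s →ₗ[ℂ] BSpace n :=
    { toFun := fun f => BSpace.mk _ (hm f) (hf f)
      map_add' := fun f g => by
        refine BSpace.ext_ae ?_
        filter_upwards [ht (f + g), ht f, ht g, BsDual.potential_add hs f g,
          BSpace.toFun_add (BSpace.mk _ (hm f) (hf f)) (BSpace.mk _ (hm g) (hf g))]
          with x h1 h2 h3 h4 h5
        rw [h1, h5, Pi.add_apply, h2, h3, h4, Pi.add_apply, mul_add]
      map_smul' := fun c f => by
        refine BSpace.ext_ae ?_
        filter_upwards [ht (c • f), ht f, BsDual.potential_smul hs c f,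
          BSpace.toFun_smul c (BSpace.mk _ (hm f) (hf f))] with x h1 h2 h3 h4
        rw [h1, RingHom.id_apply, h4, Pi.smul_apply, h2, h3, Pi.smul_apply, smul_eq_mul,
          smul_eq_mul, mul_left_comm] }
  refine ⟨T.mkContinuous C fun f => ?_, ht⟩
  rw [← ENNReal.ofReal_le_ofReal_iff (by positivity), BSpace.ofReal_norm,
    ENNReal.ofReal_mul C.coe_nonneg, BsDual.ofReal_norm, ENNReal.ofReal_coe_nnreal]
  exact (bENorm_congr (ht f)).trans_le (hC f)

/-! ### Compactness -/

/-- Within ε/2 of a totally bounded set, the image of the unit ball has finite ε-nets; completeness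
makes its closure compact. -/
lemma isCompactOperator_of_approx {E F : Type*} [NormedAddCommGroup E] [NormedAddCommGroup F]
    [CompleteSpace F] {T : E → F}
    (h : ∀ ε > 0, ∃ K : Set F, IsCompact K ∧ ∀ f, ‖f‖ ≤ 1 → ∃ z ∈ K, dist (T f) z ≤ ε) :
    IsCompactOperator T := by
  refine (isCompactOperator_iff_exists_mem_nhds_isCompact_closure_image T).2
    ⟨Metric.closedBall 0 1, Metric.closedBall_mem_nhds 0 one_pos, ?_⟩
  refine (TotallyBounded.closure ?_).isCompact_of_isClosed isClosed_closure
  rw [Metric.totallyBounded_iff]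
  intro ε hε
  obtain ⟨K, hK, hT⟩ := h (ε / 2) (half_pos hε)
  obtain ⟨t, ht, hKt⟩ := Metric.totallyBounded_iff.1 hK.totallyBounded (ε / 2) (half_pos hε)
  refine ⟨t, ht, ?_⟩
  rintro _ ⟨f, hf, rfl⟩
  obtain ⟨z, hz, hfz⟩ := hT f (mem_closedBall_zero_iff.1 hf)
  obtain ⟨y, hy, hzy⟩ := mem_iUnion₂.1 (hKt hz)
  refine mem_iUnion₂.2 ⟨y, hy, ?_⟩
  rw [Metric.mem_ball] at hzy ⊢
  linarith [dist_triangle (T f) z y]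

lemma isCompactOperator_of_finite_rank_approx {n : ℕ} [NeZero n] {E : Type*}
    [NormedAddCommGroup E] {T : E → BSpace n}
    (h : ∀ ε : ℝ≥0∞, ε ≠ 0 → ∃ (S : Finset (Rn n)) (ψ : Rn n → Rn n → ℂ) (L : Rn n → ℝ≥0),
      (∀ y, AEStronglyMeasurable (ψ y) ∧ bENorm (ψ y) < ∞) ∧ ∀ f, ‖f‖ ≤ 1 →
        ∃ c : Rn n → ℂ, (∀ y, ‖c y‖ₑ ≤ L y) ∧
          bENorm (fun x => (T f).toFun x - ∑ y ∈ S, c y * ψ y x) ≤ ε) :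
    IsCompactOperator T := by
  refine isCompactOperator_of_approx fun ε hε => ?_
  obtain ⟨S, ψ, L, hψ, hT⟩ := h (ENNReal.ofReal ε) (by simpa using hε)
  set Ψ : Rn n → BSpace n := fun y => BSpace.mk (ψ y) (hψ y).1 (hψ y).2 with hΨ
  have hΦ : Continuous fun c : Rn n → ℂ => ∑ y ∈ S, c y • Ψ y :=
    continuous_finsetSum S fun y _ => (continuous_apply y).smul continuous_const
  -- The coefficients range over a product of closed discs indexed by all of ℝⁿ, compact by
  -- Tychonoff; only the coordinates in S enter the sum.
  refine ⟨_, (isCompact_univ_pi fun y => isCompact_closedBall (0 : ℂ) (L y : ℝ)).image hΦ,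
    fun f hf => ?_⟩
  obtain ⟨c, hc, hfc⟩ := hT f hf
  refine ⟨_, ⟨c, fun y _ => ?_, rfl⟩, ?_⟩
  · rw [mem_closedBall_zero_iff]
    have := hc y
    rw [← ofReal_norm, ← ENNReal.ofReal_coe_nnreal] at this
    exact (ENNReal.ofReal_le_ofReal_iff (L y).coe_nonneg).1 this
  · rw [← ENNReal.ofReal_le_ofReal_iff hε.le, BSpace.ofReal_dist]
    refine (bENorm_congr ?_).trans_le hfc
    have h1 : ∀ y ∈ S, ∀ᵐ x, (c y • Ψ y).toFun x = c y * ψ y x := fun y _ => by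
      filter_upwards [BSpace.toFun_smul (c y) (Ψ y), BSpace.toFun_mk (hψ y).1 (hψ y).2]
        with x hx hx2
      rw [hx, Pi.smul_apply, smul_eq_mul, hΨ, hx2]
    filter_upwards [BSpace.toFun_sum S fun y => c y • Ψ y, (ae_ball_iff S.countable_toSet).2 h1]
      with x hx hx2
    rw [Pi.sub_apply, hx]
    exact congrArg _ (Finset.sum_congr rfl fun y hy => hx2 y hy)

/-- The supremum over the points of a shell of the local `L^p` norms of `V`. -/
def shellSup {n : ℕ} (p : ℝ≥0∞) (V : Rn n → ℝ) (j : ℕ) : ℝ≥0∞ :=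
  ⨆ y ∈ shell n (j + 1), eLpNorm (fun x => V (x + y)) p (volume.restrict (Metric.ball 0 1))

lemma decaySum_eq {n : ℕ} (p : ℝ≥0∞) (V : Rn n → ℝ) :
    decaySum p V = ∑' j, 2 ^ j * shellSup p V j := by
  unfold decaySum
  simp only [radius_succ]
  rfl

lemma shellSup_ne_top {n : ℕ} {p : ℝ≥0∞} {V : Rn n → ℝ} (h : decaySum p V < ∞) (j : ℕ) :
    shellSup p V j ≠ ∞ := by
  rw [decaySum_eq] at h
  exact ((le_mul_of_one_le_left' (one_le_pow₀ (by norm_num))).trans_lt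
    ((ENNReal.le_tsum j).trans_lt h)).ne

lemma eLpNorm_le_shellSup {n : ℕ} {p : ℝ≥0∞} {V : Rn n → ℝ} (hV : AEStronglyMeasurable V)
    {j : ℕ} {y : Rn n} (hy : y ∈ shell n (j + 1)) :
    eLpNorm V p (volume.restrict (shell n (j + 1) ∩ Metric.ball y 1)) ≤ shellSup p V j := by
  refine (eLpNorm_mono_measure _ (Measure.restrict_mono inter_subset_right le_rfl)).trans ?_
  rw [← eLpNorm_translate V hV]
  exact le_iSup₂ (f := fun y (_ : y ∈ shell n (j + 1)) =>
    eLpNorm (fun x => V (x + y)) p (volume.restrict (Metric.ball 0 1))) y hy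

/-- A potential is approximated by bounded potentials of compact support. -/
lemma exists_bounded_approx {n : ℕ} {p : ℝ≥0∞} (hp : p ≠ ∞) {V : Rn n → ℝ} (hV : MemLpLoc V p)
    (hsum : decaySum p V < ∞) {ε : ℝ≥0∞} (hε : ε ≠ 0) :
    ∃ (W : Rn n → ℝ) (M : ℝ≥0) (J : ℕ) (b : ℕ → ℝ≥0∞), Measurable W ∧ (∀ x, ‖W x‖ₑ ≤ M) ∧
      (∀ x ∉ Metric.ball 0 (2 ^ J), W x = 0) ∧ (∀ j, b j ≠ ∞) ∧
      (∀ j, ∀ y ∈ shell n (j + 1),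
        eLpNorm (fun x => V x - W x) p (volume.restrict (shell n (j + 1) ∩ Metric.ball y 1)) ≤
          b j) ∧
      ∑' j, 2 ^ j * b j ≤ ε := by
  have hVm := hV.aestronglyMeasurable'
  have hfin : ∑' j, 2 ^ j * shellSup p V j ≠ ∞ := by
    rw [← decaySum_eq]
    exact hsum.ne
  have hε2 : ε / 2 ≠ 0 := (ENNReal.half_pos hε).ne'
  -- J is the cut-off: the tail of the series beyond it is at most ε/2, and A δ < ε/2 will cover the
  -- finitely many shells before it.
  obtain ⟨J, hJ⟩ := ((ENNReal.tendsto_sum_nat_add _ hfin).eventually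
    (gt_mem_nhds (pos_iff_ne_zero.2 hε2))).exists_forall_of_atTop
  have htail := (hJ (J + 1) (Nat.le_succ J)).le
  set A : ℝ≥0∞ := ∑ j ∈ Finset.range (J + 1), 2 ^ j with hA
  have hAt : A ≠ ∞ := ENNReal.sum_ne_top.2 fun j _ => ENNReal.pow_ne_top (by norm_num)
  obtain ⟨δ, hδ0, hδ⟩ := ENNReal.exists_nnreal_pos_mul_lt hAt hε2
  have hVJ : MemLp V p (volume.restrict (Metric.ball 0 (2 ^ J))) :=
    (hV _ (isCompact_closedBall 0 (2 ^ J))).mono_measure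
      (Measure.restrict_mono Metric.ball_subset_closedBall le_rfl)
  obtain ⟨g, hg, -⟩ := hVJ.exists_simpleFunc_eLpNorm_sub_lt hp (ENNReal.coe_ne_zero.2 hδ0.ne')
  obtain ⟨M, hM⟩ := g.exists_forall_norm_le
  -- The cut is along a shell boundary: shells of index j ≤ J lie in the ball, where V - W is
  -- δ-small in L^p, and on the others W vanishes and V - W = V.
  refine ⟨(Metric.ball 0 (2 ^ J)).indicator g, M.toNNReal, J,
    fun j => if j ≤ J then (δ : ℝ≥0∞) else shellSup p V j,
    g.measurable.indicator measurableSet_ball, fun x => ?_, fun x hx => indicator_of_notMem hx _,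
    fun j => ?_, fun j y hy => ?_, ?_⟩
  · rw [← ofReal_norm]
    exact ENNReal.ofReal_le_ofReal ((norm_indicator_le_norm_self _ _).trans (hM x))
  · dsimp only
    split_ifs
    · exact ENNReal.coe_ne_top
    · exact shellSup_ne_top hsum j
  · dsimp only
    split_ifs with hj
    · have hsub : shell n (j + 1) ∩ Metric.ball y 1 ⊆ Metric.ball 0 (2 ^ J) := fun x hx => by
        rw [mem_ball_zero_iff]
        exact (norm_lt_of_mem_shell hx.1).trans_le (pow_le_pow_right₀ (by norm_num) hj)
      refine le_trans (le_of_eq ?_)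
        ((eLpNorm_mono_measure _ (Measure.restrict_mono hsub le_rfl)).trans hg.le)
      refine eLpNorm_congr_ae ?_
      refine (ae_restrict_iff' ((measurableSet_shell _ _).inter measurableSet_ball)).2
        (Eventually.of_forall fun x hx => ?_)
      dsimp only
      rw [indicator_of_mem (hsub hx), Pi.sub_apply]
    · refine le_trans (le_of_eq (eLpNorm_congr_ae ?_)) (eLpNorm_le_shellSup hVm hy)
      refine (ae_restrict_iff' ((measurableSet_shell _ _).inter measurableSet_ball)).2
        (Eventually.of_forall fun x hx => ?_)
      dsimp only
      rw [indicator_of_notMem, sub_zero]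
      obtain ⟨i, rfl⟩ := Nat.exists_eq_add_of_lt (not_le.1 hj)
      have h1 : (2 : ℝ) ^ (J + i) < ‖x‖ := by simpa [radius] using hx.1.1
      have h3 : (2 : ℝ) ^ J ≤ 2 ^ (J + i) := pow_le_pow_right₀ (by norm_num) (by lia)
      rw [mem_ball_zero_iff]
      linarith
  · rw [← Summable.sum_add_tsum_nat_add' (k := J + 1) ENNReal.summable, ← ENNReal.add_halves ε]
    refine add_le_add ?_ ?_
    · refine le_trans (le_of_eq ?_) hδ.le
      rw [hA, Finset.mul_sum]
      refine Finset.sum_congr rfl fun j hj => ?_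
      dsimp only
      rw [if_pos (Nat.lt_succ_iff.1 (Finset.mem_range.1 hj)), mul_comm]
    · refine le_trans (le_of_eq (tsum_congr fun j => ?_)) htail
      dsimp only
      rw [if_neg (by lia)]

/-- The same estimate gives the continuity of T and the smallness of its difference from the
operator with potential W; the latter is approximated by finite sums. -/
lemma isCompactMultiplication_of_sobolev {n : ℕ} [NeZero n] {s : ℝ} (hs : 0 < s) {p q : ℝ≥0∞}
    [ENNReal.HolderTriple p q 2] (hp : p ≠ ∞) (hq : 1 ≤ q)
    (hS : ∃ C : ℝ≥0, ∀ φ : 𝓢(Rn n, ℂ),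
      eLpNorm (schwartzBessel n s φ) q volume ≤ C * eLpNorm φ 2 volume)
    {V : Rn n → ℝ} (hV : MemLpLoc V p) (hsum : decaySum p V < ∞) :
    IsCompactMultiplication s V := by
  have hVm := hV.aestronglyMeasurable'
  obtain ⟨C, hC⟩ := exists_bENorm_le hs hq hS (p := p)
  have hsum' : (decaySum p V).toNNReal = decaySum p V := ENNReal.coe_toNNReal hsum.ne
  obtain ⟨T, hT⟩ := exists_multiplication hs hVm (C := C * (decaySum p V).toNNReal) fun f => by
    rw [ENNReal.coe_mul, hsum', decaySum_eq]
    exact hC _ f.memBDual_density V hVm _ (shellSup_ne_top hsum)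
      fun j y hy => eLpNorm_le_shellSup hVm hy
  refine ⟨T, isCompactOperator_of_finite_rank_approx fun ε hε => ?_, fun f =>
    ⟨f.potential, f.memLpLoc_potential hs, f.represents_potential hs, hT f⟩⟩
  have hε2 : ε / 2 ≠ 0 := (ENNReal.half_pos hε).ne'
  obtain ⟨δ, hδ0, hδ⟩ := ENNReal.exists_nnreal_pos_mul_lt (ENNReal.coe_ne_top (r := C)) hε2
  obtain ⟨W, M, J, b, hW, hM, hWs, hb, hWb, hbs⟩ :=
    exists_bounded_approx hp hV hsum (ENNReal.coe_ne_zero.2 hδ0.ne')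
  obtain ⟨S, ψ, L, hψ, hA⟩ := exists_finite_rank_approx (measurable_besselFun (n := n) hs)
    (secondMoment_besselFun_lt_top n hs) hW hM hWs hε2
  refine ⟨S, ψ, L, hψ, fun f hf => ?_⟩
  have hfm := f.memBDual_density.1.aestronglyMeasurable
  have hf1 : bDualENorm f.density ≤ 1 := by
    rw [← BsDual.ofReal_norm]
    exact ENNReal.ofReal_le_one.2 hf
  have hf9 : weightedSq f.density ≤ 9 := (weightedSq_le _).trans
    ((mul_le_mul_right (pow_le_one' hf1 2) _).trans_eq (mul_one _))
  obtain ⟨c, hc, hcb⟩ := hA f.density hfm hf9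
  refine ⟨c, hc, ?_⟩
  have hpm : AEStronglyMeasurable f.potential := (f.memLpLoc_potential hs).aestronglyMeasurable
  have hVW : AEStronglyMeasurable fun x => V x - W x := hVm.sub hW.aestronglyMeasurable
  have hVWm : AEStronglyMeasurable fun x => ((V x - W x : ℝ) : ℂ) * f.potential x :=
    (Complex.continuous_ofReal.comp_aestronglyMeasurable hVW).mul hpm
  have hrm : AEStronglyMeasurable
      fun x => (W x : ℂ) * f.potential x - ∑ y ∈ S, c y * ψ y x :=
    ((Complex.continuous_ofReal.comp_aestronglyMeasurable hW.aestronglyMeasurable).mul hpm).sub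
      (Finset.aestronglyMeasurable_fun_sum S fun y _ => (hψ y).1.const_mul (c y))
  have hsplit : (fun x => (T f).toFun x - ∑ y ∈ S, c y * ψ y x) =ᵐ[volume]
      (fun x => ((V x - W x : ℝ) : ℂ) * f.potential x) +
        fun x => (W x : ℂ) * f.potential x - ∑ y ∈ S, c y * ψ y x := by
    filter_upwards [hT f] with x hx
    rw [hx, Pi.add_apply]
    push_cast
    ring
  rw [bENorm_congr hsplit, ← ENNReal.add_halves ε]
  refine (bENorm_add_le hVWm hrm).trans (add_le_add ?_ hcb)
  refine (hC _ f.memBDual_density _ hVW b hb hWb).trans ?_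
  calc (C : ℝ≥0∞) * (∑' j, 2 ^ j * b j) * bDualENorm f.density ≤ C * δ * 1 :=
        mul_le_mul' (mul_le_mul_right hbs _) hf1
    _ ≤ ε / 2 := by
        rw [mul_one, mul_comm]
        exact hδ.le

end ShortRange

end

theorem proposition2p5 (n : ℕ) [NeZero n] (s : ℝ) (hs : 0 < s) (p : ℝ≥0∞)
    (hp : ShortRange.AdmissibleExponent n s p)
    (V : ShortRange.Rn n → ℝ) (hV : ShortRange.MemLpLoc V p)
    (hsum : ShortRange.decaySum p V < ∞) :
    ShortRange.IsCompactMultiplication s V ∧ ShortRange.IsShortRange s V := by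
  obtain ⟨p', q, hp2, hpt, hq, hH, hS, hV', hsum'⟩ :=
    ShortRange.exists_exponents hs hp hV hsum
  have h := ShortRange.isCompactMultiplication_of_sobolev hs hpt hq hS hV' hsum'
  -- Local square integrability, the other half of being short range, comes from p' ≥ 2.
  exact ⟨h, hV'.mono_exponent hp2, h⟩
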